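/- Let $n,k$ be coprime integers with $1\le k<n$ and let $\tau\in\mathbb C$, $\operatorname{Im}\tau>0$. Put $\theta(z)=\sum_{\alpha\in\mathbb Z}(-1)^\alpha e^{2\pi i(\alpha z+\frac{\alpha(\alpha-1)}2\tau)}$ and, for $\alpha\in\mathbb Z/n\mathbb Z$, $$\theta_\alpha(z)=\prod_{s=0}^{n-1}\theta\Big(z+\frac sn+\frac\alpha n\tau\Big)\,e^{\pi i((2\alpha-n)z-\frac\alpha n+\frac{\alpha(\alpha-n)}n\tau)}$$ (this depends only on $\alpha$ modulo $n$). For $i,r\in\mathbb Z/n\mathbb Z$ put $$c_{i,r}=\frac{\theta_0'(0)\,\theta_{i+r(k-1)}(0)}{\theta_{kr}(0)\,\theta_{i-r}(0)}\ \ (r\ne0,i),\qquad c_{0,0}=0,\qquad c_{i,0}=\frac{\theta_i'(0)}{\theta_i(0)},\quad c_{i,i}=\frac{\theta_{ki}'(0)}{\theta_{ki}(0)}\ \ (i\neq 0).$$ For a $\mathbb C$-algebra $R$ let $F(R)=R/[R,R]$ ($[R,R]$ the linear span of the commutators) and let $\mathrm{tr}:R\to F(R)$ be the quotient map. A nonabelian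 vector field on $R$ is a linear map $F(R)\to F(R)$ that lifts to a derivation of $R$. A nonabelian bivector field is a bilinear antisymmetric map $F(R)\times F(R)\to F(R)$ that is a nonabelian vector field in each argument. It is a nonabelian Poisson structure on $R$ if its Schouten square vanishes, i.e. if the Jacobi identity holds. Let $A=\mathbb C\langle x_i : i\in\mathbb Z/n\mathbb Z\rangle$ be the free algebra and let $\partial/\partial x_i:F(A)\to A$ be the nonabelian partial derivatives, defined by $df=\sum_i\frac{\partial f}{\partial x_i}dx_i$ modulo commutators; they extend to noncommutative Laurent polynomials by $d(x^{-1})=-x^{-1}\,dx\,x^{-1}$. Put $$\nu(f,g)=\mathrm{tr}\Big(\sum_{i,j,r\in\mathbb Z/n\mathbb Z}c_{i-j,r}\frac{\partial f}{\partial x_i}x_{i-r}\frac{\partial g}{\partial x_j}x_{j+r}\Big).$$ Then: 1. $\nu$ is a nonabelian bivector field on $A$, and it is homogeneous: if $a$ is an additional invertible noncommutative generator with $da=0$ and $f\mapsto f^a$ is the homomorphism $x_i\mapsto ax_i$, $a\mapsto a$, then $\nu(f^a,g^a)=\nu(f,g)^a$ for all $f,g\in A$. 2. The Schouten square $[\nu,\nu](f,g,h)$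 vanishes modulo the identities $\sum_i x_i\frac{\partial f}{\partial x_i}=0$, $\sum_i\frac{\partial f}{\partial x_i}x_i=0$ and the same identities for $g$ and $h$. That is, it is a linear combination of expressions $\mathrm{tr}\big(p\,E(f_1)\,q\,\frac{\partial f_2}{\partial x_j}\,s\,\frac{\partial f_3}{\partial x_l}\big)$ with $p,q,s\in A$, $(f_1,f_2,f_3)$ a permutation of $(f,g,h)$, and $E(f_1)=\sum_i x_i\frac{\partial f_1}{\partial x_i}$ or $E(f_1)=\sum_i \frac{\partial f_1}{\partial x_i}x_i$. 3. $\nu$ defines a nonabelian Poisson structure on the noncommutative $\mathbb CP^{n-1}$: there are nonabelian Poisson structures $\{\cdot,\cdot\}_j$ on the affine charts $\mathbb C\langle u_{i,j}: i\ne j\rangle$, $j\in\mathbb Z/n\mathbb Z$, which the substitution $u_{i,j}=x_j^{-1}x_i$ carries to $\nu$, and for $j\ne l$ the brackets $\{\cdot,\cdot\}_j$ and $\{\cdot,\cdot\}_l$ are restrictions of one nonabelian Poisson structure on the overlap $\mathbb C\langle u_{i,j}\,(i\neq j),\,u_{l,j}^{-1}\rangle$ under the change of coordinates $u_{i,l}=u_{l,j}^{-1}u_{i,j}$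 (with $u_{j,j}=1$). 4. Let $q_{n,k}(\tau)$ be the polynomial algebra $\mathbb C[x_i: i\in\mathbb Z/n\mathbb Z]$ with the biderivation defined by $\{x_i,x_i\}=0$ and, for $i\ne j$, $$\{x_i,x_j\}=\Big(\frac{\theta'_{j-i}(0)}{\theta_{j-i}(0)}+\frac{\theta'_{k(j-i)}(0)}{\theta_{k(j-i)}(0)}\Big)x_ix_j+\sum_{r\ne0,j-i}\frac{\theta_0'(0)\theta_{j-i+r(k-1)}(0)}{\theta_{kr}(0)\theta_{j-i-r}(0)}x_{j-r}x_{i+r}.$$ This is a Poisson algebra. The abelianization of $\nu$, that is, the bracket that $\nu$ induces on $\mathbb C[x_i]$ through $F(A)\to\mathbb C[x_i]$, is $-\{\cdot,\cdot\}$, and $x_i\mapsto x_{-i}$ is an isomorphism of Poisson algebras from it to $q_{n,k}(\tau)$. -/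

import Mathlib

open scoped TensorProduct

noncomputable section

namespace NCPoisson

/-! ### Nonabelian functions, vector fields and Poisson structures on an algebra -/

section General

variable {R S : Type*} [Ring R] [Algebra ℂ R] [Ring S] [Algebra ℂ S]

/-- `[R, R]`, the linear span of the commutators. -/
def commSpan (R : Type*) [Ring R] [Algebra ℂ R] : Submodule ℂ R :=
  Submodule.span ℂ {z | ∃ a b : R, z = a * b - b * a}

/-- `F = R / [R, R]`, the space of nonabelian functions. -/
abbrev Cyc (R : Type*) [Ring R] [Algebra ℂ R] : Type _ := R ⧸ commSpan R

/-- The natural map `tr : R → R / [R, R]`. -/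
def tr : R →ₗ[ℂ] Cyc R := (commSpan R).mkQ

/-- A linear map that is symmetric on products descends to `R / [R, R]`. -/
def Cyc.lift {M : Type*} [AddCommGroup M] [Module ℂ M] (φ : R →ₗ[ℂ] M)
    (h : ∀ a b, φ (a * b) = φ (b * a)) : Cyc R →ₗ[ℂ] M :=
  (commSpan R).liftQ φ <| Submodule.span_le.2 <| by
    rintro _ ⟨a, b, rfl⟩
    simp [h a b]

/-- The map `R / [R, R] → S / [S, S]` induced by an algebra homomorphism. -/
def Cyc.map (φ : R →ₐ[ℂ] S) : Cyc R →ₗ[ℂ] Cyc S :=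
  Cyc.lift (tr ∘ₗ φ.toLinearMap) fun a b => by
    refine (Submodule.Quotient.eq _).2 (Submodule.subset_span ⟨φ a, φ b, ?_⟩)
    simp

/-- Derivations of a (noncommutative) algebra. -/
def IsDer (D : R →ₗ[ℂ] R) : Prop := ∀ a b, D (a * b) = D a * b + a * D b

/-- Nonabelian vector fields: linear maps `F → F` that lift to a derivation of `R`. -/
def IsNCVectorField (v : Cyc R →ₗ[ℂ] Cyc R) : Prop :=
  ∃ D : R →ₗ[ℂ] R, IsDer D ∧ ∀ a, v (tr a) = tr (D a)

/-- Nonabelian bivector fields. -/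
structure IsNCBivector (β : Cyc R →ₗ[ℂ] Cyc R →ₗ[ℂ] Cyc R) : Prop where
  antisymm : ∀ f g, β f g = -β g f
  left : ∀ g, IsNCVectorField (β.flip g)
  right : ∀ f, IsNCVectorField (β f)

/-- The Schouten bracket of two bivector fields. -/
def schouten (μ ν : Cyc R →ₗ[ℂ] Cyc R →ₗ[ℂ] Cyc R) (v : Fin 3 → Cyc R) : Cyc R :=
  ∑ σ : Equiv.Perm (Fin 3), (Equiv.Perm.sign σ : ℤ) • μ (ν (v (σ 0)) (v (σ 1))) (v (σ 2)) +
  ∑ σ : Equiv.Perm (Fin 3), (Equiv.Perm.sign σ : ℤ) • ν (μ (v (σ 0)) (v (σ 1))) (v (σ 2))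

/-- Nonabelian Poisson structures. -/
def IsNCPoisson (β : Cyc R →ₗ[ℂ] Cyc R →ₗ[ℂ] Cyc R) : Prop :=
  IsNCBivector β ∧ ∀ v, schouten β β v = 0

/-- The linear map `a ⊗ b ↦ b a`. -/
def revMul (R : Type*) [Ring R] [Algebra ℂ R] : R ⊗[ℂ] R →ₗ[ℂ] R :=
  LinearMap.mul' ℂ R ∘ₗ (TensorProduct.comm ℂ R R).toLinearMap

/-- The matrix form of a derivation `Δ : R → R ⊗ R` (outer bimodule structure): an algebra
homomorphism `f ↦ (f ⊗ 1, Δ f; 0, 1 ⊗ f)`. -/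
def IsDoubleDer (Φ : R →ₐ[ℂ] Matrix (Fin 2) (Fin 2) (R ⊗[ℂ] R)) : Prop :=
  ∀ f, Φ f 0 0 = f ⊗ₜ[ℂ] (1 : R) ∧ Φ f 1 0 = 0 ∧ Φ f 1 1 = (1 : R) ⊗ₜ[ℂ] f

theorem revMul_comm (f : R) (t : R ⊗[ℂ] R) :
    revMul R ((f ⊗ₜ[ℂ] (1 : R)) * t) = revMul R (t * ((1 : R) ⊗ₜ[ℂ] f)) := by
  induction t using TensorProduct.induction_on with
  | zero => simp
  | tmul a b => simp [revMul, mul_assoc]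
  | add s t hs ht => simp [mul_add, add_mul, hs, ht]

/-- The cyclic derivative `F → R` attached to a double derivation: if `Δ f = ∑ a ⊗ b`, that is
`df = ∑ a dx b`, then the derivative of `tr f` is `∑ b a`, because `a dx b = b a dx`
modulo commutators. -/
def cycDeriv (Φ : R →ₐ[ℂ] Matrix (Fin 2) (Fin 2) (R ⊗[ℂ] R)) (h : IsDoubleDer Φ) :
    Cyc R →ₗ[ℂ] R :=
  Cyc.lift (revMul R ∘ₗ Matrix.entryLinearMap ℂ (R ⊗[ℂ] R) 0 1 ∘ₗ Φ.toLinearMap) fun a b => by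
    simp [Matrix.mul_apply, Fin.sum_univ_two, (h a).1, (h a).2.2, (h b).1, (h b).2.2,
      revMul_comm, add_comm]

end General

/-! ### Partial derivatives on free algebras and on noncommutative Laurent polynomials -/

section Partial

variable {X : Type*} [DecidableEq X]

/-- On the free algebra: the double derivation `D/Dx_i`, with `D x_j / D x_i = δ_ij 1 ⊗ 1`. -/
def freeDD (i : X) : FreeAlgebra ℂ X →ₐ[ℂ]
    Matrix (Fin 2) (Fin 2) (FreeAlgebra ℂ X ⊗[ℂ] FreeAlgebra ℂ X) :=
  FreeAlgebra.lift ℂ fun j =>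
    !![FreeAlgebra.ι ℂ j ⊗ₜ[ℂ] 1, if j = i then 1 else 0; 0, 1 ⊗ₜ[ℂ] FreeAlgebra.ι ℂ j]

theorem isDoubleDer_freeDD (i : X) : IsDoubleDer (freeDD i) := by
  intro f
  induction f using FreeAlgebra.induction with
  | grade0 r =>
    simp [Algebra.algebraMap_eq_smul_one, Algebra.TensorProduct.one_def, TensorProduct.smul_tmul']
  | grade1 x => simp [freeDD]
  | mul a b ha hb =>
    simp [Matrix.mul_apply, Fin.sum_univ_two, ha.1, ha.2.1, ha.2.2, hb.1, hb.2.1, hb.2.2]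
  | add a b ha hb =>
    simp [ha.1, ha.2.1, ha.2.2, hb.1, hb.2.1, hb.2.2, TensorProduct.add_tmul,
      TensorProduct.tmul_add]

/-- The nonabelian partial derivative `∂/∂x_i : F → A` on a free algebra. -/
def freePartial (i : X) : Cyc (FreeAlgebra ℂ X) →ₗ[ℂ] FreeAlgebra ℂ X :=
  cycDeriv (freeDD i) (isDoubleDer_freeDD i)

/-- Noncommutative Laurent polynomials: the group algebra of the free group. -/
abbrev Laurent (X : Type*) : Type _ := MonoidAlgebra ℂ (FreeGroup X)

/-- A group element as a Laurent monomial. -/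
abbrev lmon (w : FreeGroup X) : Laurent X := MonoidAlgebra.of ℂ (FreeGroup X) w

/-- The generator `x_i` of the algebra of Laurent polynomials. -/
abbrev lx (i : X) : Laurent X := lmon (FreeGroup.of i)

/-- The inverse `x_i⁻¹` in the algebra of Laurent polynomials. -/
abbrev lxInv (i : X) : Laurent X := lmon (FreeGroup.of i)⁻¹

/-- The invertible matrix `(x_j ⊗ 1, δ_ij; 0, 1 ⊗ x_j)`; its inverse encodes
`d(x⁻¹) = -x⁻¹ dx x⁻¹`. -/
def lauUnit (i j : X) : (Matrix (Fin 2) (Fin 2) (Laurent X ⊗[ℂ] Laurent X))ˣ where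
  val := !![lx j ⊗ₜ[ℂ] 1, if j = i then 1 else 0; 0, 1 ⊗ₜ[ℂ] lx j]
  inv := !![lxInv j ⊗ₜ[ℂ] 1, if j = i then (-lxInv j) ⊗ₜ[ℂ] lxInv j else 0;
    0, 1 ⊗ₜ[ℂ] lxInv j]
  val_inv := by
    have h : lx j * lxInv j = 1 := by rw [← map_mul, mul_inv_cancel, map_one]
    rw [Matrix.mul_fin_two, Matrix.one_fin_two]
    split_ifs <;> simp [h, Algebra.TensorProduct.one_def, ← TensorProduct.add_tmul,
      -MonoidAlgebra.of_apply]
  inv_val := by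
    have h : lxInv j * lx j = 1 := by rw [← map_mul, inv_mul_cancel, map_one]
    rw [Matrix.mul_fin_two, Matrix.one_fin_two]
    split_ifs <;> simp [h, Algebra.TensorProduct.one_def, ← TensorProduct.add_tmul,
      -MonoidAlgebra.of_apply]

/-- On Laurent polynomials: the double derivation `D/Dx_i`. -/
def lauDD (i : X) : Laurent X →ₐ[ℂ] Matrix (Fin 2) (Fin 2) (Laurent X ⊗[ℂ] Laurent X) :=
  MonoidAlgebra.lift ℂ _ _ ((Units.coeHom _).comp (FreeGroup.lift (lauUnit i)))

theorem isDoubleDer_lauDD (i : X) : IsDoubleDer (lauDD i) := by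
  have key : ∀ w : FreeGroup X, lauDD i (lmon w) 0 0 = lmon w ⊗ₜ[ℂ] 1 ∧
      lauDD i (lmon w) 1 0 = 0 ∧ lauDD i (lmon w) 1 1 = 1 ⊗ₜ[ℂ] lmon w := by
    intro w
    induction w using FreeGroup.induction_on with
    | C1 =>
      have e : lmon (1 : FreeGroup X) = 1 := map_one _
      simp [e, Algebra.TensorProduct.one_def, -MonoidAlgebra.of_apply]
    | of j => simp [lauDD, lauUnit]
    | inv_of j _ => simp [lauDD, lauUnit]
    | mul a b ha hb =>
      have e : lauDD i (lmon (a * b)) = lauDD i (lmon a) * lauDD i (lmon b) := by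
        rw [← map_mul, ← map_mul]
      have e' : lmon (a * b) = lmon a * lmon b := map_mul _ _ _
      rw [e, e']
      simp [Matrix.mul_apply, Fin.sum_univ_two, ha.1, ha.2.1, ha.2.2, hb.1, hb.2.1, hb.2.2,
        -MonoidAlgebra.of_apply]
  intro f
  induction f using MonoidAlgebra.induction_on with
  | of w => exact key w
  | add a b ha hb =>
    simp [ha.1, ha.2.1, ha.2.2, hb.1, hb.2.1, hb.2.2, TensorProduct.add_tmul,
      TensorProduct.tmul_add]
  | smul r a ha =>
    simp [ha.1, ha.2.1, ha.2.2, TensorProduct.smul_tmul']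

/-- The nonabelian partial derivative `∂/∂x_i` on Laurent polynomials. -/
def lauPartial (i : X) : Cyc (Laurent X) →ₗ[ℂ] Laurent X :=
  cycDeriv (lauDD i) (isDoubleDer_lauDD i)

end Partial

/-! ### Theta functions and the coefficients -/

section Theta

/-- `θ(z) = ∑_α (-1)^α exp(2πi(αz + α(α-1)τ/2))`. -/
def theta (τ z : ℂ) : ℂ :=
  ∑' α : ℤ, (-1 : ℂ) ^ α *
    Complex.exp (2 * Real.pi * Complex.I * (α * z + (α * (α - 1) : ℂ) / 2 * τ))

/-- The theta function with characteristic `α`; it depends only on `α` modulo `n`. -/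
def thetaChar (n : ℕ) (τ : ℂ) (α : ℤ) (z : ℂ) : ℂ :=
  (∏ s ∈ Finset.range n, theta τ (z + s / n + α / n * τ)) *
    Complex.exp (Real.pi * Complex.I *
      ((2 * α - n) * z - α / n + (α * (α - n) : ℂ) / n * τ))

variable (n : ℕ) [NeZero n]

/-- `θ_α(0)` for `α ∈ ℤ/n`. -/
def th (τ : ℂ) (α : ZMod n) : ℂ := thetaChar n τ α.val 0

/-- `θ'_α(0)` for `α ∈ ℤ/n`. -/
def thD (τ : ℂ) (α : ZMod n) : ℂ := deriv (thetaChar n τ α.val) 0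

/-- The coefficients `c_{i,r}`. -/
def ellCoeff (k : ℕ) (τ : ℂ) (i r : ZMod n) : ℂ :=
  if r = 0 then (if i = 0 then 0 else thD n τ i / th n τ i)
  else if r = i then thD n τ (k * i) / th n τ (k * i)
  else thD n τ 0 * th n τ (i + r * (k - 1)) / (th n τ (k * r) * th n τ (i - r))

end Theta

/-! ### The bivector field -/

section Field

variable {n : ℕ} [NeZero n]

/-- The bracket `tr (∑ c_{i-j,r} ∂f/∂x_i x_{i-r} ∂g/∂x_j x_{j+r})` on `R / [R, R]`, for elements
`x_i` and partial derivatives `∂/∂x_i` on an algebra `R`. -/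
def quadBracket {R : Type*} [Ring R] [Algebra ℂ R] (c : ZMod n → ZMod n → ℂ) (x : ZMod n → R)
    (p : ZMod n → Cyc R →ₗ[ℂ] R) : Cyc R →ₗ[ℂ] Cyc R →ₗ[ℂ] Cyc R :=
  LinearMap.mk₂ ℂ
    (fun f g => tr (∑ i, ∑ j, ∑ r, c (i - j) r • (p i f * x (i - r) * p j g * x (j + r))))
    (by intros; simp [add_mul, Finset.sum_add_distrib])
    (by intros; simp only [map_smul, smul_mul_assoc, Finset.smul_sum, map_sum,
      smul_comm (c _ _)])
    (by intros; simp [add_mul, mul_add, Finset.sum_add_distrib])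
    (by intros; simp only [map_smul, smul_mul_assoc, mul_smul_comm, Finset.smul_sum, map_sum,
      smul_comm (c _ _)])

variable (n)

/-- The free algebra `A = ℂ⟨x_i⟩`, `i ∈ ℤ/n`. -/
abbrev Aff : Type := FreeAlgebra ℂ (ZMod n)

/-- The elliptic nonabelian bivector field `ν` on `A`. -/
def ellNu (k : ℕ) (τ : ℂ) : Cyc (Aff n) →ₗ[ℂ] Cyc (Aff n) →ₗ[ℂ] Cyc (Aff n) :=
  quadBracket (ellCoeff n k τ) (FreeAlgebra.ι ℂ) freePartial

/-- `ν` on Laurent polynomials in the `x_i`. -/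
def ellNuLaurent (k : ℕ) (τ : ℂ) : Cyc (Laurent (ZMod n)) →ₗ[ℂ] Cyc (Laurent (ZMod n)) →ₗ[ℂ]
    Cyc (Laurent (ZMod n)) :=
  quadBracket (ellCoeff n k τ) lx lauPartial

/-! Homogeneity: invariance under `x_i ↦ a x_i`, `a` a noncommutative constant. -/

/-- Laurent polynomials in the `x_i` and an auxiliary generator `a`. -/
abbrev LaurentA : Type := Laurent (Option (ZMod n))

/-- `ν` on Laurent polynomials in the `x_i` and `a`, where `a` is a constant. -/
def ellNuA (k : ℕ) (τ : ℂ) : Cyc (LaurentA n) →ₗ[ℂ] Cyc (LaurentA n) →ₗ[ℂ] Cyc (LaurentA n) :=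
  quadBracket (ellCoeff n k τ) (fun i => lx (some i)) (fun i => lauPartial (some i))

/-- The inclusion of `A` into the Laurent polynomials in the `x_i` and `a`. -/
def inclA : Aff n →ₐ[ℂ] LaurentA n := FreeAlgebra.lift ℂ fun i => lx (some i)

/-- The homomorphism `f ↦ f^a`: `x_i ↦ a x_i`, `a ↦ a`. -/
def dilate : LaurentA n →ₐ[ℂ] LaurentA n :=
  MonoidAlgebra.mapDomainAlgHom ℂ ℂ (FreeGroup.lift fun o : Option (ZMod n) =>
    o.elim (FreeGroup.of none) fun i => FreeGroup.of none * FreeGroup.of (some i))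

/-! The Euler-type relations. -/

/-- `∑ x_i ∂f/∂x_i`. -/
def eulerLeft (f : Cyc (Aff n)) : Aff n := ∑ i, FreeAlgebra.ι ℂ i * freePartial i f

/-- `∑ (∂f/∂x_i) x_i`. -/
def eulerRight (f : Cyc (Aff n)) : Aff n := ∑ i, freePartial i f * FreeAlgebra.ι ℂ i

/-- The trilinear expressions in the derivatives of three functions that vanish modulo the relations
`∑ x_i ∂f/∂x_i = 0`, `∑ (∂f/∂x_i) x_i = 0` for each of the three arguments. -/
def eulerSpan : Submodule ℂ ((Fin 3 → Cyc (Aff n)) → Cyc (Aff n)) :=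
  Submodule.span ℂ {T | ∃ (σ : Equiv.Perm (Fin 3)) (E : Cyc (Aff n) → Aff n) (a b c : Aff n)
    (j l : ZMod n), (E = eulerLeft n ∨ E = eulerRight n) ∧
      T = fun v => tr (a * E (v (σ 0)) * b * freePartial j (v (σ 1)) * c *
        freePartial l (v (σ 2)))}

end Field

/-! ### Nonabelian Poisson structures on the noncommutative projective space, by affine charts -/

section Proj

variable (n : ℕ) [NeZero n]

/-- The chart `ℂ⟨u_{i,j} : i ≠ j⟩`. -/
abbrev Chart (j : ZMod n) : Type := FreeAlgebra ℂ {i : ZMod n // i ≠ j}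

/-- The relations that make `w` the inverse of `u_{k,j}`. -/
inductive OverlapRel (j k : ZMod n) (h : k ≠ j) :
    FreeAlgebra ℂ (Option {i : ZMod n // i ≠ j}) →
      FreeAlgebra ℂ (Option {i : ZMod n // i ≠ j}) → Prop
  | mul_inv : OverlapRel j k h
      (FreeAlgebra.ι ℂ (some ⟨k, h⟩) * FreeAlgebra.ι ℂ none) 1
  | inv_mul : OverlapRel j k h
      (FreeAlgebra.ι ℂ none * FreeAlgebra.ι ℂ (some ⟨k, h⟩)) 1

/-- The overlap of the charts `j` and `k`: `ℂ⟨u_{i,j} (i ≠ j), u_{k,j}⁻¹⟩`. -/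
abbrev Overlap (j k : ZMod n) (h : k ≠ j) : Type := RingQuot (OverlapRel n j k h)

/-- The coordinate `u_{i,j}` on the overlap, with `u_{j,j} = 1`. -/
def ovU (j k : ZMod n) (h : k ≠ j) (i : ZMod n) : Overlap n j k h :=
  if hi : i = j then 1
  else RingQuot.mkAlgHom ℂ (OverlapRel n j k h) (FreeAlgebra.ι ℂ (some ⟨i, hi⟩))

/-- `u_{k,j}⁻¹` on the overlap. -/
def ovInv (j k : ZMod n) (h : k ≠ j) : Overlap n j k h :=
  RingQuot.mkAlgHom ℂ (OverlapRel n j k h) (FreeAlgebra.ι ℂ none)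

/-- Restriction from the chart `j` to the overlap. -/
def resFst (j k : ZMod n) (h : k ≠ j) : Chart n j →ₐ[ℂ] Overlap n j k h :=
  FreeAlgebra.lift ℂ fun i => ovU n j k h i

/-- Restriction from the chart `k` to the overlap: `u_{i,k} = u_{k,j}⁻¹ u_{i,j}`. -/
def resSnd (j k : ZMod n) (h : k ≠ j) : Chart n k →ₐ[ℂ] Overlap n j k h :=
  FreeAlgebra.lift ℂ fun i => ovInv n j k h * ovU n j k h i

/-- A nonabelian Poisson structure on the noncommutative `ℂP^{n-1}`: nonabelian Poisson structures
on all affine charts, any two of which are restrictions of one nonabelian Poisson structure on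
the overlap of the charts. -/
structure IsProjPoisson
    (b : ∀ j, Cyc (Chart n j) →ₗ[ℂ] Cyc (Chart n j) →ₗ[ℂ] Cyc (Chart n j)) : Prop where
  poisson : ∀ j, IsNCPoisson (b j)
  glue : ∀ (j k : ZMod n) (h : k ≠ j),
    ∃ β : Cyc (Overlap n j k h) →ₗ[ℂ] Cyc (Overlap n j k h) →ₗ[ℂ] Cyc (Overlap n j k h),
      IsNCPoisson β ∧
      (∀ f g, β (Cyc.map (resFst n j k h) f) (Cyc.map (resFst n j k h) g) =
        Cyc.map (resFst n j k h) (b j f g)) ∧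
      (∀ f g, β (Cyc.map (resSnd n j k h) f) (Cyc.map (resSnd n j k h) g) =
        Cyc.map (resSnd n j k h) (b k f g))

/-- The affine coordinates in terms of the homogeneous ones: `u_{i,j} = x_j⁻¹ x_i`. -/
def chartEmb (j : ZMod n) : Chart n j →ₐ[ℂ] Laurent (ZMod n) :=
  FreeAlgebra.lift ℂ fun i => lxInv j * lx (i : ZMod n)

end Proj

/-! ### Abelianization and the Poisson algebra `q_{n,k}(τ)` -/

section Abelian

variable (n : ℕ) [NeZero n]

/-- The abelianization map `F = A / [A, A] → ℂ[x_i]`. -/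
def abel : Cyc (Aff n) →ₗ[ℂ] MvPolynomial (ZMod n) ℂ :=
  Cyc.lift (FreeAlgebra.lift ℂ (MvPolynomial.X (R := ℂ) (σ := ZMod n))).toLinearMap fun a b => by
    simp [mul_comm]

/-- The polynomial `{x_i, x_j}` in `q_{n,k}(τ)`. -/
def qGen (k : ℕ) (τ : ℂ) (i j : ZMod n) : MvPolynomial (ZMod n) ℂ :=
  if i = j then 0
  else
    (thD n τ (j - i) / th n τ (j - i) + thD n τ (k * (j - i)) / th n τ (k * (j - i))) •
      (MvPolynomial.X i * MvPolynomial.X j) +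
    ∑ r ∈ Finset.univ.filter (fun r : ZMod n => r ≠ 0 ∧ r ≠ j - i),
      (thD n τ 0 * th n τ (j - i + r * (k - 1)) / (th n τ (k * r) * th n τ (j - i - r))) •
        (MvPolynomial.X (j - r) * MvPolynomial.X (i + r))

/-- The bracket of `q_{n,k}(τ)`: the biderivation of `ℂ[x_i]` with the given values `{x_i, x_j}`. -/
def qBracket (k : ℕ) (τ : ℂ) :
    MvPolynomial (ZMod n) ℂ →ₗ[ℂ] MvPolynomial (ZMod n) ℂ →ₗ[ℂ] MvPolynomial (ZMod n) ℂ :=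
  LinearMap.mk₂ ℂ
    (fun f g => ∑ i, ∑ j, qGen n k τ i j * MvPolynomial.pderiv i f * MvPolynomial.pderiv j g)
    (by intros; simp [add_mul, mul_add, Finset.sum_add_distrib])
    (by intros; simp [Finset.smul_sum])
    (by intros; simp [mul_add, Finset.sum_add_distrib])
    (by intros; simp [Finset.smul_sum])

/-- Poisson brackets on a commutative algebra. -/
structure IsPoissonBracket {P : Type*} [CommRing P] [Algebra ℂ P] (b : P →ₗ[ℂ] P →ₗ[ℂ] P) :
    Prop where
  antisymm : ∀ f g, b f g = -b g f
  leibniz : ∀ f g h, b (f * g) h = f * b g h + g * b f h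
  jacobi : ∀ f g h, b (b f g) h + b (b g h) f + b (b h f) g = 0

/-- The bracket `b` on `ℂ[x_i]` is the abelianization of the bivector field `ν` on `A`
(it is determined by `ν`, as the abelianization map is surjective). -/
def IsAbelianization (ν : Cyc (Aff n) →ₗ[ℂ] Cyc (Aff n) →ₗ[ℂ] Cyc (Aff n))
    (b : MvPolynomial (ZMod n) ℂ →ₗ[ℂ] MvPolynomial (ZMod n) ℂ →ₗ[ℂ] MvPolynomial (ZMod n) ℂ) :
    Prop :=
  ∀ f g, abel n (ν f g) = b (abel n f) (abel n g)

/-- The relabelling `x_i ↦ x_{-i}` of `ℂ[x_i]`. -/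
def relabel : MvPolynomial (ZMod n) ℂ ≃ₐ[ℂ] MvPolynomial (ZMod n) ℂ :=
  MvPolynomial.renameEquiv ℂ (Equiv.neg (ZMod n))

end Abelian

end NCPoisson

end

open NCPoisson

/-!
The coefficients `c_{i,r}` are the constant terms at the origin of the Kronecker functions
`θ_0'(0) θ_{α+β}(x+y) / (θ_α(x) θ_β(y))` with `α = kr`, `β = i - r`. The addition theorem for
theta functions says that the Kronecker functions satisfy the associative Yang–Baxter equation. Its
constant term along a line through the origin is the quadratic relation between the `c_{i,r}` needed
for the Jacobi identity, except that the simple poles at `α = 0` and `β = 0`, multiplied by the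
linear terms of the other factor, leave a remainder supported on the indices where the trilinear
expression is a multiple of `∑ x_i ∂f/∂x_i` or `∑ (∂f/∂x_i) x_i`.

A nonabelian bivector field has Hamiltonian derivations, and by the symmetry of second derivatives
only the terms without second derivatives survive in its Jacobiator; these are the terms just
described. On an affine chart the Euler relation `∑ u_i ∂f/∂u_i = 0` with `u_j = 1` defines
`∂f/∂u_j`, the other relation follows because `∑ [∂f/∂u_i, u_i] = 0`, and so the Jacobi identity
holds there. After abelianization the remainder is symmetric in its arguments, while the Jacobiator
contains its antisymmetrization, so it cancels.
-/

open scoped TensorProduct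

noncomputable section

namespace NCPoisson

/-! ### The Jacobi triple product -/

section FiniteTripleProduct

open Finset

variable {K : Type*} [Field K] {q y : K}

/-- The finite `q`-Pochhammer symbol `(q; q)_N`. -/
def qPochFin (q : K) (N : ℕ) : K := ∏ i ∈ range N, (1 - q ^ (i + 1))

/-- The reciprocal of `(q; q)_m`, extended by zero to negative `m`. With this convention the
recursion `qPochFinInv_sub_one` holds for all integers. -/
def qPochFinInv (q : K) (m : ℤ) : K := if 0 ≤ m then (qPochFin q m.toNat)⁻¹ else 0

/-- The coefficient `(-1)^j q^(j(j-1)/2)` of `y^j` in the theta series. -/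
def thetaCoeff (q : K) (j : ℤ) : K := (-1) ^ j * q ^ (j * (j - 1) / 2)

/-- The coefficient of `y^j` in the `N`-th partial product of the triple product: `thetaCoeff q j`
times the Gaussian binomial coefficient of `2N` and `N + j`. -/
def tripleCoeff (q : K) (N : ℕ) (j : ℤ) : K :=
  thetaCoeff q j * (qPochFin q (2 * N) * qPochFinInv q (N + j) * qPochFinInv q (N - j))

theorem qPochFin_ne_zero (hq : ∀ m : ℕ, 1 - q ^ (m + 1) ≠ 0) (N : ℕ) : qPochFin q N ≠ 0 :=
  prod_ne_zero_iff.2 fun i _ => hq i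

theorem qPochFin_succ (q : K) (N : ℕ) : qPochFin q (N + 1) = qPochFin q N * (1 - q ^ (N + 1)) :=
  prod_range_succ _ N

theorem qPochFinInv_sub_one (hq : ∀ m : ℕ, 1 - q ^ (m + 1) ≠ 0) (m : ℤ) :
    qPochFinInv q (m - 1) = (1 - q ^ m) * qPochFinInv q m := by
  rcases lt_trichotomy m 0 with h | rfl | h
  · simp [qPochFinInv, not_le.2 h, show ¬ 1 ≤ m by omega]
  · simp [qPochFinInv]
  · obtain ⟨k, rfl⟩ : ∃ k : ℕ, m = k + 1 := ⟨(m - 1).toNat, by omega⟩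
    have hk : (1 - q ^ (k + 1)) ≠ 0 := hq k
    rw [add_sub_cancel_right, qPochFinInv, qPochFinInv, if_pos (by omega), if_pos (by omega),
      Int.toNat_natCast, show ((k : ℤ) + 1).toNat = k + 1 by omega, qPochFin_succ,
      show q ^ ((k : ℤ) + 1) = q ^ (k + 1) by exact_mod_cast zpow_natCast q (k + 1)]
    field_simp [qPochFin_ne_zero hq k]

theorem thetaCoeff_add_one (hq0 : q ≠ 0) (j : ℤ) :
    thetaCoeff q (j + 1) = -(q ^ j * thetaCoeff q j) := by
  have h : (j + 1) * (j + 1 - 1) / 2 = j + j * (j - 1) / 2 := by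
    rw [show (j + 1) * (j + 1 - 1) = j * (j - 1) + j * 2 by ring,
      Int.add_mul_ediv_right _ _ two_ne_zero, add_comm]
  rw [thetaCoeff, thetaCoeff, h, zpow_add₀ hq0, zpow_add_one₀ (by simp)]
  ring

theorem thetaCoeff_one_sub (q : K) (j : ℤ) : thetaCoeff q (1 - j) = -thetaCoeff q j := by
  have h : (1 - j) * (1 - j - 1) = j * (j - 1) := by ring
  have hsign : (-1 : K) ^ (1 - j) = -(-1) ^ j := by
    rw [zpow_sub₀ (by simp), zpow_one, div_eq_mul_inv, ← inv_zpow]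
    simp [inv_neg]
  rw [thetaCoeff, thetaCoeff, h, hsign, neg_mul]

theorem tripleCoeff_zero (q : K) (j : ℤ) : tripleCoeff q 0 j = if j = 0 then 1 else 0 := by
  rcases lt_trichotomy j 0 with h | rfl | h
  · simp [tripleCoeff, qPochFinInv, h.ne, not_le.2 h]
  · simp [tripleCoeff, thetaCoeff, qPochFinInv, qPochFin]
  · simp [tripleCoeff, qPochFinInv, h.ne', not_le.2 h]

theorem tripleCoeff_succ (hq : ∀ m : ℕ, 1 - q ^ (m + 1) ≠ 0) (hq0 : q ≠ 0) (N : ℕ) (j : ℤ) :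
    tripleCoeff q (N + 1) j = (1 + q ^ (2 * N + 1)) * tripleCoeff q N j
      - q ^ N * tripleCoeff q N (j - 1) - q ^ (N + 1) * tripleCoeff q N (j + 1) := by
  have lower : ∀ m : ℤ, qPochFinInv q m = (1 - q ^ (m + 1)) * qPochFinInv q (m + 1) := fun m => by
    simpa using qPochFinInv_sub_one hq (m + 1)
  have hup : qPochFinInv q (N + j) = (1 - q ^ ((N : ℤ) + j + 1)) * qPochFinInv q (N + 1 + j) := by
    rw [lower, add_right_comm]
  have hdn : qPochFinInv q (N - j) = (1 - q ^ ((N : ℤ) - j + 1)) * qPochFinInv q (N + 1 - j) := by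
    rw [lower, sub_add_eq_add_sub]
  have hup' : qPochFinInv q (N + (j - 1)) = (1 - q ^ ((N : ℤ) + j)) * qPochFinInv q (N + j) := by
    rw [← qPochFinInv_sub_one hq, add_sub_assoc]
  have hdn' : qPochFinInv q (N - (j + 1)) = (1 - q ^ ((N : ℤ) - j)) * qPochFinInv q (N - j) := by
    rw [← qPochFinInv_sub_one hq, sub_sub]
  have hprev : thetaCoeff q (j - 1) = -(thetaCoeff q j * (q * (q ^ j)⁻¹)) := by
    have h := thetaCoeff_add_one hq0 (j - 1)
    rw [sub_add_cancel, zpow_sub_one₀ hq0] at h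
    rw [h]
    field_simp [zpow_ne_zero j hq0]
  have hz : q ^ j ≠ 0 := zpow_ne_zero j hq0
  simp only [tripleCoeff, Nat.cast_add, Nat.cast_one, show 2 * (N + 1) = 2 * N + 1 + 1 by ring,
    qPochFin_succ, hup', hdn', show (N : ℤ) - (j - 1) = N + 1 - j by ring,
    show (N : ℤ) + (j + 1) = N + 1 + j by ring, hup, hdn, hprev, thetaCoeff_add_one hq0,
    zpow_add₀ hq0, zpow_sub₀ hq0, zpow_natCast, zpow_one]
  field_simp
  ring

theorem hasSum_tripleCoeff [TopologicalSpace K] [IsTopologicalRing K]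
    (hq : ∀ m : ℕ, 1 - q ^ (m + 1) ≠ 0) (hq0 : q ≠ 0) (hy : y ≠ 0) (N : ℕ) :
    HasSum (fun j : ℤ => tripleCoeff q N j * y ^ j)
      (∏ m ∈ range N, ((1 - q ^ m * y) * (1 - q ^ (m + 1) * y⁻¹))) := by
  induction N with
  | zero =>
    rw [prod_range_zero]
    refine (hasSum_ite_eq (0 : ℤ) (1 : K)).congr_fun fun j => ?_
    rcases eq_or_ne j 0 with rfl | hj <;> simp [tripleCoeff_zero, *]
  | succ N ih =>
    have hfactor : (1 - q ^ N * y) * (1 - q ^ (N + 1) * y⁻¹) =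
        1 + q ^ (2 * N + 1) + (-(q ^ N * y) + -(q ^ (N + 1) * y⁻¹)) := by
      field_simp
      ring
    rw [prod_range_succ, mul_comm, hfactor, add_mul (1 + _), add_mul (-_)]
    refine ((ih.mul_left _).add
      (((Equiv.subRight (1 : ℤ)).hasSum_iff.2 (ih.mul_left _)).add
        ((Equiv.addRight (1 : ℤ)).hasSum_iff.2 (ih.mul_left _)))).congr_fun fun j => ?_
    simp only [Function.comp_apply, Equiv.subRight_apply, Equiv.coe_addRight,
      tripleCoeff_succ hq hq0, zpow_sub_one₀ hy, zpow_add_one₀ hy]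
    field_simp
    ring

end FiniteTripleProduct

section QPochhammer

open Filter Finset Topology

variable {𝕜 : Type*} [NormedField 𝕜] {q y : 𝕜}

/-- The infinite `q`-Pochhammer symbol `(y; q)_∞ = ∏_{m ≥ 0} (1 - q^m y)`. -/
def qPoch (q y : 𝕜) : 𝕜 := ∏' m : ℕ, (1 - q ^ m * y)

theorem one_sub_pow_succ_ne_zero (hq : ‖q‖ < 1) (m : ℕ) : 1 - q ^ (m + 1) ≠ 0 := by
  refine sub_ne_zero.2 fun h => ?_
  have := pow_lt_one₀ (norm_nonneg q) hq m.succ_ne_zero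
  rw [← norm_pow, ← h, norm_one] at this
  exact this.false

theorem summable_norm_neg_pow_mul (hq : ‖q‖ < 1) (y : 𝕜) :
    Summable fun m : ℕ => ‖-(q ^ m * y)‖ := by
  simpa using (summable_geometric_of_lt_one (norm_nonneg q) hq).mul_right ‖y‖

variable [CompleteSpace 𝕜]

theorem multipliable_one_sub_pow_mul (hq : ‖q‖ < 1) (y : 𝕜) :
    Multipliable fun m : ℕ => 1 - q ^ m * y := by
  simpa [sub_eq_add_neg] using multipliable_one_add_of_summable (summable_norm_neg_pow_mul hq y)

theorem qPoch_ne_zero (hq : ‖q‖ < 1) (hy : ∀ m : ℕ, q ^ m * y ≠ 1) : qPoch q y ≠ 0 := by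
  simp only [qPoch, sub_eq_add_neg]
  exact tprod_one_add_ne_zero_of_summable
    (fun m => by rw [← sub_eq_add_neg]; exact sub_ne_zero.2 (hy m).symm)
    (summable_norm_neg_pow_mul hq y)

theorem qPoch_self_ne_zero (hq : ‖q‖ < 1) : qPoch q q ≠ 0 :=
  qPoch_ne_zero hq fun m => by
    rw [← pow_succ]
    exact (sub_ne_zero.1 (one_sub_pow_succ_ne_zero hq m)).symm

theorem qPoch_eq_one_sub_mul (hq : ‖q‖ < 1) (y : 𝕜) : qPoch q y = (1 - y) * qPoch q (q * y) := by
  have h := (multipliable_one_sub_pow_mul hq (q * y)).hasProd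
  simp only [← mul_assoc, ← pow_succ] at h
  simpa [qPoch, ← mul_assoc, ← pow_succ] using
    (HasProd.zero_mul (f := fun m : ℕ => 1 - q ^ m * y) h).tprod_eq

theorem continuous_qPoch [LocallyCompactSpace 𝕜] (hq : ‖q‖ < 1) : Continuous (qPoch q) := by
  refine continuous_iff_continuousAt.2 fun y => ?_
  have hK : IsOpen (Metric.ball (0 : 𝕜) (‖y‖ + 1)) := Metric.isOpen_ball
  have hprod := Summable.hasProdLocallyUniformlyOn_nat_one_add (f := fun m z => -(q ^ m * z)) hK
    ((summable_geometric_of_lt_one (norm_nonneg q) hq).mul_right (‖y‖ + 1))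
    (.of_forall fun m z hz => by
      rw [norm_neg, norm_mul, norm_pow]
      gcongr
      exact (mem_ball_zero_iff.1 hz).le)
    fun m => by fun_prop
  simp only [← sub_eq_add_neg] at hprod
  refine (TendstoLocallyUniformlyOn.continuousOn hprod ?_).continuousAt
    (hK.mem_nhds (by simp))
  exact .of_forall fun s => by fun_prop

theorem prod_qPoch_mul_pow {ζ : 𝕜} {n : ℕ} (hζ : IsPrimitiveRoot ζ n) (hn : 0 < n)
    (hq : ‖q‖ < 1) (y : 𝕜) :
    ∏ s ∈ range n, qPoch q (ζ ^ s * y) = qPoch (q ^ n) (y ^ n) := by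
  have hfactor : ∀ t : 𝕜, ∏ s ∈ range n, (1 - ζ ^ s * t) = 1 - t ^ n := fun t => by
    simpa [Polynomial.eval_prod] using
      (congrArg (Polynomial.eval 1) (X_pow_sub_C_eq_prod hζ hn (rfl : t ^ n = _))).symm
  simp only [qPoch]
  rw [← Multipliable.tprod_finsetProd fun s _ => multipliable_one_sub_pow_mul hq _]
  refine tprod_congr fun m => ?_
  rw [← pow_mul, mul_comm n m, pow_mul, ← mul_pow, ← hfactor]
  exact prod_congr rfl fun s _ => by rw [mul_left_comm]

end QPochhammer

section TripleProduct

open Filter Finset Topology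

variable {𝕜 : Type*} [NormedField 𝕜] {q y : 𝕜}

theorem summable_norm_thetaCoeff_mul_pow (hq : ‖q‖ < 1) (hq0 : q ≠ 0) (y : 𝕜) :
    Summable fun j : ℕ => ‖thetaCoeff q j * y ^ j‖ := by
  have hratio : Tendsto (fun j : ℕ => ‖q ^ j * y‖) atTop (𝓝 0) := by
    simpa using ((tendsto_pow_atTop_nhds_zero_of_norm_lt_one hq).mul_const y).norm
  refine summable_of_ratio_norm_eventually_le one_half_lt_one
    ((hratio.eventually_le_const one_half_pos).mono fun j hj => ?_)
  rw [norm_norm, norm_norm, Nat.cast_succ, thetaCoeff_add_one hq0, zpow_natCast, pow_succ,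
    show -(q ^ j * thetaCoeff q j) * (y ^ j * y) = -(q ^ j * y * (thetaCoeff q j * y ^ j)) by ring,
    norm_neg, norm_mul]
  gcongr

theorem summable_norm_thetaCoeff_mul_zpow (hq : ‖q‖ < 1) (hq0 : q ≠ 0) (hy : y ≠ 0) :
    Summable fun j : ℤ => ‖thetaCoeff q j * y ^ j‖ := by
  refine .of_nat_of_neg (by simpa using summable_norm_thetaCoeff_mul_pow hq hq0 y) ?_
  have h := (summable_nat_add_iff 1).2 (summable_norm_thetaCoeff_mul_pow hq hq0 y⁻¹)
  refine (h.mul_left ‖-y‖).congr fun j => ?_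
  rw [← norm_mul, ← neg_eq_iff_eq_neg.2 (thetaCoeff_one_sub q _), Nat.cast_add, Nat.cast_one,
    zpow_neg, zpow_natCast, pow_succ, inv_pow, show (1 : ℤ) - (j + 1) = -j by ring]
  congr 1
  field_simp

variable [CompleteSpace 𝕜]

theorem tendsto_qPochFin (hq : ‖q‖ < 1) : Tendsto (qPochFin q) atTop (𝓝 (qPoch q q)) := by
  have hfin : qPochFin q = fun N => ∏ i ∈ range N, (1 - q ^ i * q) :=
    funext fun N => by simp only [qPochFin, pow_succ]
  exact hfin ▸ (multipliable_one_sub_pow_mul hq q).hasProd.tendsto_prod_nat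

theorem tendsto_qPochFinInv (hq : ‖q‖ < 1) :
    Tendsto (qPochFinInv q) atTop (𝓝 (qPoch q q)⁻¹) := by
  have htoNat : Tendsto Int.toNat atTop atTop :=
    tendsto_atTop.2 fun b => (eventually_ge_atTop (b : ℤ)).mono fun a ha => by omega
  refine (((tendsto_qPochFin hq).inv₀ (qPoch_self_ne_zero hq)).comp htoNat).congr' ?_
  filter_upwards [eventually_ge_atTop 0] with m hm
  simp [qPochFinInv, hm]

theorem exists_norm_qPochFinInv_le (hq : ‖q‖ < 1) : ∃ C, ∀ m, ‖qPochFinInv q m‖ ≤ C := by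
  obtain ⟨C, hC⟩ := (Metric.isBounded_range_of_tendsto _
    ((tendsto_qPochFin hq).inv₀ (qPoch_self_ne_zero hq))).exists_norm_le
  refine ⟨C, fun m => ?_⟩
  rw [qPochFinInv]
  split_ifs
  · exact hC _ ⟨_, rfl⟩
  · simpa using (norm_nonneg _).trans (hC _ ⟨0, rfl⟩)

theorem tendsto_tripleCoeff (hq : ‖q‖ < 1) (j : ℤ) :
    Tendsto (fun N => tripleCoeff q N j) atTop (𝓝 (thetaCoeff q j * (qPoch q q)⁻¹)) := by
  have hbin : Tendsto (fun N : ℕ => qPochFin q (2 * N)) atTop (𝓝 (qPoch q q)) :=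
    (tendsto_qPochFin hq).comp (tendsto_id.const_mul_atTop' two_pos)
  have hup : Tendsto (fun N : ℕ => qPochFinInv q (N + j)) atTop _ :=
    (tendsto_qPochFinInv hq).comp (tendsto_natCast_atTop_atTop.atTop_add tendsto_const_nhds)
  have hdn : Tendsto (fun N : ℕ => qPochFinInv q (N - j)) atTop _ :=
    (tendsto_qPochFinInv hq).comp
      (tendsto_atTop_add_const_right _ (-j) tendsto_natCast_atTop_atTop)
  simpa only [tripleCoeff, mul_inv_cancel₀ (qPoch_self_ne_zero hq), one_mul] using
    ((hbin.mul hup).mul hdn).const_mul (thetaCoeff q j)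

theorem exists_norm_tripleCoeff_le (hq : ‖q‖ < 1) :
    ∃ C, ∀ N j, ‖tripleCoeff q N j‖ ≤ C * ‖thetaCoeff q j‖ := by
  obtain ⟨C, hC⟩ := (Metric.isBounded_range_of_tendsto _ (tendsto_qPochFin hq)).exists_norm_le
  obtain ⟨C', hC'⟩ := exists_norm_qPochFinInv_le hq
  have hC0 : 0 ≤ C := (norm_nonneg _).trans (hC _ ⟨0, rfl⟩)
  have hC'0 : 0 ≤ C' := (norm_nonneg _).trans (hC' 0)
  refine ⟨C * C' * C', fun N j => ?_⟩
  rw [tripleCoeff, mul_comm, norm_mul, norm_mul, norm_mul]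
  gcongr
  · exact hC _ ⟨_, rfl⟩
  · exact hC' _
  · exact hC' _

theorem jacobi_triple_product (hq : ‖q‖ < 1) (hq0 : q ≠ 0) (hy : y ≠ 0) :
    ∑' j : ℤ, thetaCoeff q j * y ^ j = qPoch q q * (qPoch q y * qPoch q (q * y⁻¹)) := by
  obtain ⟨C, hC⟩ := exists_norm_tripleCoeff_le hq
  have hsum : Tendsto (fun N => ∑' j : ℤ, tripleCoeff q N j * y ^ j) atTop
      (𝓝 (∑' j : ℤ, thetaCoeff q j * (qPoch q q)⁻¹ * y ^ j)) := by
    refine tendsto_tsum_of_dominated_convergence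
      ((summable_norm_thetaCoeff_mul_zpow hq hq0 hy).mul_left C)
      (fun j => (tendsto_tripleCoeff hq j).mul_const _) (.of_forall fun N j => ?_)
    rw [norm_mul, norm_mul, ← mul_assoc]
    gcongr
    exact hC N j
  have hprod := ((multipliable_one_sub_pow_mul hq y).hasProd.mul
    (multipliable_one_sub_pow_mul hq (q * y⁻¹)).hasProd).tendsto_prod_nat
  simp only [← mul_assoc, ← pow_succ] at hprod
  simp only [(hasSum_tripleCoeff (one_sub_pow_succ_ne_zero hq) hq0 hy _).tsum_eq] at hsum
  have hlim := tendsto_nhds_unique hsum hprod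
  simp only [mul_right_comm, tsum_mul_right] at hlim
  rw [← eq_mul_inv_iff_mul_eq₀ (inv_ne_zero (qPoch_self_ne_zero hq)), inv_inv] at hlim
  rw [hlim, mul_comm]
  simp only [qPoch, ← mul_assoc, ← pow_succ]

end TripleProduct

/-! ### Zeros and quasi-periodicity of theta functions -/

section ThetaZeros

open Complex Filter Finset Topology

/-- The function `e(z) = exp (2πiz)`. -/
def expTwoPi (z : ℂ) : ℂ := Complex.exp (2 * Real.pi * I * z)

theorem expTwoPi_ne_zero (z : ℂ) : expTwoPi z ≠ 0 := Complex.exp_ne_zero _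

theorem expTwoPi_zero : expTwoPi 0 = 1 := by rw [expTwoPi, mul_zero, Complex.exp_zero]

theorem expTwoPi_add (z w : ℂ) : expTwoPi (z + w) = expTwoPi z * expTwoPi w := by
  rw [expTwoPi, mul_add, Complex.exp_add, expTwoPi, expTwoPi]

theorem expTwoPi_neg (z : ℂ) : expTwoPi (-z) = (expTwoPi z)⁻¹ := by
  rw [expTwoPi, mul_neg, Complex.exp_neg, expTwoPi]

theorem expTwoPi_int_mul (m : ℤ) (z : ℂ) : expTwoPi (m * z) = expTwoPi z ^ m := by
  rw [expTwoPi, expTwoPi, ← Complex.exp_int_mul, mul_left_comm]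

theorem expTwoPi_nat_mul (m : ℕ) (z : ℂ) : expTwoPi (m * z) = expTwoPi z ^ m := by
  exact_mod_cast expTwoPi_int_mul m z

theorem expTwoPi_eq_one_iff {z : ℂ} : expTwoPi z = 1 ↔ ∃ a : ℤ, z = a := by
  rw [expTwoPi, Complex.exp_eq_one_iff]
  exact exists_congr fun a => by
    rw [mul_comm (a : ℂ), mul_right_inj' Complex.two_pi_I_ne_zero]

theorem hasDerivAt_expTwoPi (z : ℂ) : HasDerivAt expTwoPi (2 * Real.pi * I * expTwoPi z) z := by
  have h := ((hasDerivAt_id z).const_mul (2 * Real.pi * I)).cexp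
  rwa [mul_one, mul_comm (Complex.exp _)] at h

theorem isPrimitiveRoot_expTwoPi {n : ℕ} (hn : n ≠ 0) : IsPrimitiveRoot (expTwoPi (1 / n)) n := by
  simpa only [expTwoPi, mul_one_div] using Complex.isPrimitiveRoot_exp n hn

theorem norm_expTwoPi_lt_one {τ : ℂ} (hτ : 0 < τ.im) : ‖expTwoPi τ‖ < 1 := by
  rw [expTwoPi, Complex.norm_exp, Real.exp_lt_one_iff]
  simpa using mul_pos Real.two_pi_pos hτ

theorem theta_eq_tsum (τ z : ℂ) :
    theta τ z = ∑' α : ℤ, thetaCoeff (expTwoPi τ) α * expTwoPi z ^ α := by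
  refine tsum_congr fun α => ?_
  have hdiv : ((α * (α - 1) / 2 : ℤ) : ℂ) = (α * (α - 1) : ℂ) / 2 := by
    rw [Int.cast_div (Int.even_mul_pred_self α).two_dvd (by norm_num)]
    push_cast
    rfl
  rw [thetaCoeff, ← expTwoPi_int_mul, ← expTwoPi_int_mul, hdiv, mul_assoc ((-1 : ℂ) ^ α),
    ← expTwoPi_add, expTwoPi, add_comm (_ * τ)]

theorem theta_eq_jacobiTheta₂ (τ z : ℂ) : theta τ z = jacobiTheta₂ (z + 1 / 2 - τ / 2) τ := by
  refine tsum_congr fun α => ?_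
  rw [jacobiTheta₂_term, ← Complex.exp_pi_mul_I, ← Complex.exp_int_mul, ← Complex.exp_add]
  ring_nf

theorem theta_neg (τ z : ℂ) : theta τ (-z) = -(expTwoPi (-z) * theta τ z) := by
  rw [theta_eq_tsum, theta_eq_tsum, ← tsum_mul_left, ← tsum_neg,
    ← (Equiv.subLeft (1 : ℤ)).tsum_eq]
  refine tsum_congr fun α => ?_
  rw [Equiv.subLeft_apply, thetaCoeff_one_sub, expTwoPi_neg, inv_zpow, ← zpow_neg, neg_sub,
    zpow_sub_one₀ (expTwoPi_ne_zero z)]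
  ring

theorem theta_add_tau (τ z : ℂ) : theta τ (z + τ) = -(expTwoPi (-z) * theta τ z) := by
  have hz := expTwoPi_ne_zero z
  rw [theta_eq_tsum, theta_eq_tsum, ← tsum_mul_left, ← tsum_neg,
    ← (Equiv.addRight (1 : ℤ)).tsum_eq (fun α => -(expTwoPi (-z) * _))]
  refine tsum_congr fun α => ?_
  rw [Equiv.coe_addRight, thetaCoeff_add_one (expTwoPi_ne_zero τ), expTwoPi_add, mul_zpow,
    expTwoPi_neg, zpow_add_one₀ hz]
  field_simp

variable {τ : ℂ}

theorem differentiable_theta (hτ : 0 < τ.im) : Differentiable ℂ (theta τ) := by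
  rw [show theta τ = fun z => jacobiTheta₂ (z + 1 / 2 - τ / 2) τ from
    funext (theta_eq_jacobiTheta₂ τ)]
  exact fun z => (differentiableAt_jacobiTheta₂_fst _ hτ).comp z (by fun_prop)

theorem theta_eq_qPoch (hτ : 0 < τ.im) (z : ℂ) :
    theta τ z = qPoch (expTwoPi τ) (expTwoPi τ) *
      (qPoch (expTwoPi τ) (expTwoPi z) * qPoch (expTwoPi τ) (expTwoPi τ * (expTwoPi z)⁻¹)) := by
  rw [theta_eq_tsum, jacobi_triple_product (norm_expTwoPi_lt_one hτ) (expTwoPi_ne_zero τ)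
    (expTwoPi_ne_zero z)]

theorem theta_ne_zero (hτ : 0 < τ.im) {z : ℂ} (hz : ∀ a b : ℤ, z ≠ a + b * τ) :
    theta τ z ≠ 0 := by
  have hq := norm_expTwoPi_lt_one hτ
  rw [theta_eq_qPoch hτ]
  refine mul_ne_zero (qPoch_self_ne_zero hq)
    (mul_ne_zero (qPoch_ne_zero hq fun m h => ?_) (qPoch_ne_zero hq fun m h => ?_))
  · rw [← expTwoPi_nat_mul, ← expTwoPi_add] at h
    obtain ⟨a, ha⟩ := expTwoPi_eq_one_iff.1 h
    exact hz a (-m) (by push_cast; linear_combination ha)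
  · rw [← mul_assoc, ← pow_succ, ← expTwoPi_nat_mul, ← expTwoPi_neg, ← expTwoPi_add] at h
    obtain ⟨a, ha⟩ := expTwoPi_eq_one_iff.1 h
    exact hz (-a) (m + 1) (by push_cast at ha ⊢; linear_combination -ha)

theorem theta_eq_one_sub_mul (hτ : 0 < τ.im) (z : ℂ) :
    theta τ z = (1 - expTwoPi z) * (qPoch (expTwoPi τ) (expTwoPi τ) *
      (qPoch (expTwoPi τ) (expTwoPi τ * expTwoPi z) *
        qPoch (expTwoPi τ) (expTwoPi τ * (expTwoPi z)⁻¹))) := by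
  rw [theta_eq_qPoch hτ, qPoch_eq_one_sub_mul (norm_expTwoPi_lt_one hτ) (expTwoPi z)]
  ring

theorem theta_zero (hτ : 0 < τ.im) : theta τ 0 = 0 := by
  rw [theta_eq_one_sub_mul hτ, expTwoPi_zero, sub_self, zero_mul]

theorem deriv_theta_zero (hτ : 0 < τ.im) :
    deriv (theta τ) 0 = -(2 * Real.pi * I) * qPoch (expTwoPi τ) (expTwoPi τ) ^ 3 := by
  have hslope := hasDerivAt_iff_tendsto_slope_zero.1 ((hasDerivAt_expTwoPi 0).const_sub 1)
  have hfactor := theta_eq_one_sub_mul hτ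
  set q := expTwoPi τ
  have hq : Continuous (qPoch q) := continuous_qPoch (norm_expTwoPi_lt_one hτ)
  have he : Continuous expTwoPi := by unfold expTwoPi; fun_prop
  have hcof : Continuous fun z => qPoch q q *
      (qPoch q (q * expTwoPi z) * qPoch q (q * (expTwoPi z)⁻¹)) := by
    have hinv := he.inv₀ expTwoPi_ne_zero
    exact continuous_const.mul ((hq.comp (he.const_mul q)).mul (hq.comp (hinv.const_mul q)))
  refine HasDerivAt.deriv (hasDerivAt_iff_tendsto_slope_zero.2 ?_)
  convert hslope.mul ((hcof.tendsto 0).mono_left nhdsWithin_le_nhds) using 2 with z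
  · rw [zero_add, theta_zero hτ, hfactor, expTwoPi_zero]
    simp [mul_assoc]
  · simp only [expTwoPi_zero, mul_one, inv_one]
    ring

theorem deriv_theta_zero_ne_zero (hτ : 0 < τ.im) : deriv (theta τ) 0 ≠ 0 := by
  rw [deriv_theta_zero hτ]
  exact mul_ne_zero (neg_ne_zero.2 Complex.two_pi_I_ne_zero)
    (pow_ne_zero 3 (qPoch_self_ne_zero (norm_expTwoPi_lt_one hτ)))

theorem natCast_mul_im_pos {n : ℕ} (hn : 0 < n) (hτ : 0 < τ.im) : 0 < ((n : ℂ) * τ).im := by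
  simpa using mul_pos (Nat.cast_pos.2 hn : (0 : ℝ) < n) hτ

theorem exists_prod_theta_eq (hτ : 0 < τ.im) {n : ℕ} (hn : 0 < n) :
    ∃ C : ℂ, C ≠ 0 ∧ ∀ w, ∏ s ∈ range n, theta τ (w + s / n) = C * theta (n * τ) (n * w) := by
  have hnτ := natCast_mul_im_pos hn hτ
  have hq := norm_expTwoPi_lt_one hτ
  have hζ := isPrimitiveRoot_expTwoPi hn.ne'
  have hpole := qPoch_self_ne_zero (norm_expTwoPi_lt_one hnτ)
  refine ⟨qPoch (expTwoPi τ) (expTwoPi τ) ^ n / qPoch (expTwoPi (n * τ)) (expTwoPi (n * τ)),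
    div_ne_zero (pow_ne_zero n (qPoch_self_ne_zero hq)) hpole, fun w => ?_⟩
  have hpt : ∀ s : ℕ, expTwoPi (w + s / n) = expTwoPi (1 / n) ^ s * expTwoPi w := fun s => by
    rw [expTwoPi_add, ← expTwoPi_nat_mul, mul_one_div, mul_comm]
  simp only [theta_eq_qPoch hτ, hpt, mul_inv, ← inv_pow, mul_left_comm (expTwoPi τ)]
  rw [prod_mul_distrib, prod_mul_distrib, prod_const, card_range, prod_qPoch_mul_pow hζ hn hq,
    prod_qPoch_mul_pow hζ.inv hn hq, theta_eq_qPoch hnτ, expTwoPi_nat_mul n τ,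
    expTwoPi_nat_mul n w, mul_pow, inv_pow, ← expTwoPi_nat_mul n τ, ← mul_assoc (_ / _),
    div_mul_cancel₀ _ hpole]

end ThetaZeros

/-! ### The addition formula, and theta functions with characteristics -/

section ThetaAddition

open Complex Finset

/-- Pairs of integers as pairs `(a + b, a - b)` of equal parity and pairs `(a + b + 1, a - b)` of
opposite parity. -/
def paritySplit : (ℤ × ℤ) ⊕ (ℤ × ℤ) ≃ ℤ × ℤ :=
  Equiv.ofBijective
    (Sum.elim (fun p => (p.1 + p.2, p.1 - p.2)) fun p => (p.1 + p.2 + 1, p.1 - p.2)) <| by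
    constructor
    · rintro (⟨a, b⟩ | ⟨a, b⟩) (⟨c, d⟩ | ⟨c, d⟩) h <;>
        simp only [Sum.elim_inl, Sum.elim_inr, Prod.mk.injEq, Sum.inl.injEq, Sum.inr.injEq,
          reduceCtorEq] at h ⊢ <;> omega
    · rintro ⟨a, b⟩
      rcases Int.even_or_odd' (a + b) with ⟨m, h | h⟩
      · exact ⟨.inl (m, a - m), by simp only [Sum.elim_inl, Prod.mk.injEq]; omega⟩
      · exact ⟨.inr (m, a - m - 1), by simp only [Sum.elim_inr, Prod.mk.injEq]; omega⟩

theorem jacobiTheta₂_term_mul_even (τ x y : ℂ) (a b : ℤ) :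
    jacobiTheta₂_term (a + b) (x + y + 1 / 2 - τ / 2) τ *
        jacobiTheta₂_term (a - b) (x - y + 1 / 2 - τ / 2) τ =
      jacobiTheta₂_term a (2 * x - τ) (2 * τ) * jacobiTheta₂_term b (2 * y) (2 * τ) := by
  simp only [jacobiTheta₂_term, ← Complex.exp_add]
  refine Complex.exp_eq_exp_iff_exists_int.2 ⟨a, ?_⟩
  push_cast
  ring

theorem jacobiTheta₂_term_mul_odd (τ x y : ℂ) (a b : ℤ) :
    jacobiTheta₂_term (a + b + 1) (x + y + 1 / 2 - τ / 2) τ *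
        jacobiTheta₂_term (a - b) (x - y + 1 / 2 - τ / 2) τ =
      -expTwoPi (x + y) *
        (jacobiTheta₂_term a (2 * x) (2 * τ) * jacobiTheta₂_term b (2 * y + τ) (2 * τ)) := by
  have hneg : -expTwoPi (x + y) = Complex.exp (Real.pi * I + 2 * Real.pi * I * (x + y)) := by
    rw [Complex.exp_add, Complex.exp_pi_mul_I, expTwoPi, neg_one_mul]
  simp only [jacobiTheta₂_term, hneg, ← Complex.exp_add]
  refine Complex.exp_eq_exp_iff_exists_int.2 ⟨a, ?_⟩
  push_cast
  ring

variable {τ : ℂ}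

theorem summable_norm_jacobiTheta₂_term (hτ : 0 < τ.im) (z : ℂ) :
    Summable fun a => ‖jacobiTheta₂_term a z τ‖ :=
  ((summable_jacobiTheta₂_term_iff z τ).2 hτ).norm

theorem theta_add_mul_theta_sub (hτ : 0 < τ.im) (x y : ℂ) :
    theta τ (x + y) * theta τ (x - y) =
      jacobiTheta₂ (2 * x - τ) (2 * τ) * jacobiTheta₂ (2 * y) (2 * τ) -
      expTwoPi (x + y) * (jacobiTheta₂ (2 * x) (2 * τ) * jacobiTheta₂ (2 * y + τ) (2 * τ)) := by
  have h := summable_norm_jacobiTheta₂_term hτ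
  have h₂ := summable_norm_jacobiTheta₂_term (τ := 2 * τ) (by simpa using hτ)
  have heven := (summable_mul_of_summable_norm (h₂ (2 * x - τ)) (h₂ (2 * y))).hasSum
  have hodd := ((summable_mul_of_summable_norm (h₂ (2 * x)) (h₂ (2 * y + τ))).hasSum).mul_left
    (-expTwoPi (x + y))
  simp only [theta_eq_jacobiTheta₂, jacobiTheta₂]
  rw [tsum_mul_tsum_of_summable_norm (h _) (h _), tsum_mul_tsum_of_summable_norm (h₂ _) (h₂ _),
    tsum_mul_tsum_of_summable_norm (h₂ _) (h₂ _), ← paritySplit.tsum_eq, sub_eq_add_neg (tsum _),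
    ← neg_mul]
  refine (HasSum.sum (heven.congr_fun ?_) (hodd.congr_fun ?_)).tsum_eq
  · exact fun p => jacobiTheta₂_term_mul_even τ x y p.1 p.2
  · exact fun p => jacobiTheta₂_term_mul_odd τ x y p.1 p.2

theorem exists_theta_add_mul_sub (hτ : 0 < τ.im) :
    ∃ A B : ℂ → ℂ, ∀ x y, theta τ (x + y) * theta τ (x - y) =
      expTwoPi x * (A x * B y - B x * A y) := by
  refine ⟨fun x => expTwoPi x * jacobiTheta₂ (2 * x + τ) (2 * τ),
    fun x => jacobiTheta₂ (2 * x) (2 * τ), fun x y => ?_⟩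
  have hexp : Complex.exp (-Real.pi * I * (2 * τ + 2 * (2 * x - τ))) =
      (expTwoPi x * expTwoPi x)⁻¹ := by
    rw [← expTwoPi_add, ← expTwoPi_neg, expTwoPi]
    congr 1
    ring
  have hperiod := jacobiTheta₂_add_left' (2 * x - τ) (2 * τ)
  rw [show 2 * x - τ + 2 * τ = 2 * x + τ by ring, hexp] at hperiod
  have hx := expTwoPi_ne_zero x
  simp only [theta_add_mul_theta_sub hτ, expTwoPi_add, hperiod]
  field_simp

theorem differentiable_thetaChar (hτ : 0 < τ.im) (n : ℕ) (α : ℤ) :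
    Differentiable ℂ (thetaChar n τ α) := by
  have hθ := differentiable_theta hτ
  unfold thetaChar
  fun_prop

variable (n : ℕ) [NeZero n]

theorem exists_thetaChar_eq (hτ : 0 < τ.im) :
    ∃ C : ℂ, C ≠ 0 ∧ ∀ (α : ℤ) (z : ℂ), thetaChar n τ α z = C * theta (n * τ) (n * z + α * τ) *
      Complex.exp (Real.pi * I * ((2 * α - n) * z - α / n + (α * (α - n) : ℂ) / n * τ)) := by
  obtain ⟨C, hC, hprod⟩ := exists_prod_theta_eq hτ (NeZero.pos n)
  refine ⟨C, hC, fun α z => ?_⟩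
  have hpt : (n * z + α * τ : ℂ) = n * (z + α / n * τ) := by
    field_simp [NeZero.ne (n : ℂ)]
  rw [thetaChar, hpt, ← hprod]
  simp only [add_right_comm]

theorem exists_thetaChar_zero_eq (hτ : 0 < τ.im) :
    ∃ C : ℂ, C ≠ 0 ∧ ∀ z, thetaChar n τ 0 z =
      C * theta (n * τ) (n * z) * Complex.exp (Real.pi * I * (-n * z)) := by
  obtain ⟨C, hC, h⟩ := exists_thetaChar_eq n hτ
  exact ⟨C, hC, fun z => by simp [h]⟩

theorem thetaChar_add_natCast (hτ : 0 < τ.im) (α : ℤ) (z : ℂ) :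
    thetaChar n τ (α + n) z = thetaChar n τ α z := by
  have hn : (n : ℂ) ≠ 0 := NeZero.ne _
  obtain ⟨C, -, h⟩ := exists_thetaChar_eq n hτ
  have hpt : (n * z + ((α + n : ℤ) : ℂ) * τ : ℂ) = n * z + α * τ + n * τ := by push_cast; ring
  have hsign : -expTwoPi (-(n * z + α * τ)) =
      Complex.exp (Real.pi * I + 2 * Real.pi * I * (-(n * z + α * τ))) := by
    rw [Complex.exp_add, Complex.exp_pi_mul_I, expTwoPi, neg_one_mul]
  rw [h, h, hpt, theta_add_tau, ← neg_mul, mul_left_comm C, mul_rotate (-_), hsign, mul_assoc,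
    ← Complex.exp_add]
  congr 2
  push_cast
  field_simp
  ring

theorem thetaChar_add_mul_natCast (hτ : 0 < τ.im) (α m : ℤ) (z : ℂ) :
    thetaChar n τ (α + m * n) z = thetaChar n τ α z :=
  Function.Periodic.int_mul (f := fun α => thetaChar n τ α z)
    (fun α => thetaChar_add_natCast n hτ α z) m α

theorem thetaChar_eq_shift (τ : ℂ) (α : ℤ) (z : ℂ) : thetaChar n τ α z =
    Complex.exp (Real.pi * I * (2 * α * z - α / n + α ^ 2 / n * τ)) *
      thetaChar n τ 0 (z + α / n * τ) := by
  have hn : (n : ℂ) ≠ 0 := NeZero.ne _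
  rw [thetaChar, thetaChar, mul_left_comm, ← Complex.exp_add]
  congr 1
  · simp only [Int.cast_zero, zero_div, zero_mul, add_zero, add_right_comm]
  · congr 1
    push_cast
    field_simp
    ring

theorem thetaChar_zero_neg (hτ : 0 < τ.im) (z : ℂ) :
    thetaChar n τ 0 (-z) = -thetaChar n τ 0 z := by
  obtain ⟨C, -, h⟩ := exists_thetaChar_zero_eq n hτ
  have hexp : expTwoPi (-(n * z)) * Complex.exp (Real.pi * I * (-n * -z)) =
      Complex.exp (Real.pi * I * (-n * z)) := by
    rw [expTwoPi, ← Complex.exp_add]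
    congr 1
    ring
  rw [h, h, mul_neg, theta_neg, ← hexp]
  ring

theorem thetaChar_zero_zero (hτ : 0 < τ.im) : thetaChar n τ 0 0 = 0 :=
  self_eq_neg.1 (by simpa using thetaChar_zero_neg n hτ 0)

theorem thetaChar_apply_zero_ne_zero (hτ : 0 < τ.im) {α : ℤ} (hα : ¬ (n : ℤ) ∣ α) :
    thetaChar n τ α 0 ≠ 0 := by
  obtain ⟨C, hC, h⟩ := exists_thetaChar_eq n hτ
  rw [h]
  refine mul_ne_zero (mul_ne_zero hC (theta_ne_zero (natCast_mul_im_pos (NeZero.pos n) hτ)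
    fun a b hab => hα ⟨b, ?_⟩)) (Complex.exp_ne_zero _)
  have him : (α : ℝ) * τ.im = n * b * τ.im := by
    simpa [mul_assoc, mul_left_comm] using congrArg Complex.im hab
  exact_mod_cast mul_right_cancel₀ hτ.ne' him

theorem deriv_thetaChar_zero_ne_zero (hτ : 0 < τ.im) : deriv (thetaChar n τ 0) 0 ≠ 0 := by
  obtain ⟨C, hC, h⟩ := exists_thetaChar_zero_eq n hτ
  have hnτ := natCast_mul_im_pos (NeZero.pos n) hτ
  have hθ : HasDerivAt (fun z : ℂ => theta (n * τ) (n * z)) (deriv (theta (n * τ)) 0 * n) 0 := by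
    refine HasDerivAt.comp_of_eq 0 (differentiable_theta hnτ 0).hasDerivAt ?_ (mul_zero _).symm
    simpa using (hasDerivAt_id (0 : ℂ)).const_mul (n : ℂ)
  have hexp : DifferentiableAt ℂ (fun z : ℂ => Complex.exp (Real.pi * I * (-n * z))) 0 := by
    fun_prop
  rw [funext h, ((hθ.const_mul C).fun_mul hexp.hasDerivAt).deriv]
  simp [theta_zero hnτ, hC, NeZero.ne, deriv_theta_zero_ne_zero hnτ]

theorem exists_thetaChar_add_mul_sub (hτ : 0 < τ.im) :
    ∃ A B : ℂ → ℂ, ∀ x y, thetaChar n τ 0 (x + y) * thetaChar n τ 0 (x - y) =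
      A x * B y - B x * A y := by
  obtain ⟨C, -, h⟩ := exists_thetaChar_zero_eq n hτ
  obtain ⟨A, B, hAB⟩ := exists_theta_add_mul_sub (natCast_mul_im_pos (NeZero.pos n) hτ)
  refine ⟨fun x => C ^ 2 * A (n * x), fun x => B (n * x), fun x y => ?_⟩
  have hexp : Complex.exp (Real.pi * I * (-n * (x + y))) *
      Complex.exp (Real.pi * I * (-n * (x - y))) * expTwoPi (n * x) = 1 := by
    rw [expTwoPi, ← Complex.exp_add, ← Complex.exp_add, ← Complex.exp_zero]
    congr 1
    ring
  rw [h, h, mul_add, mul_sub]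
  linear_combination C ^ 2 * Complex.exp (Real.pi * I * (-n * (x + y))) *
    Complex.exp (Real.pi * I * (-n * (x - y))) * hAB (n * x) (n * y) +
    C ^ 2 * (A (n * x) * B (n * y) - B (n * x) * A (n * y)) * hexp

end ThetaAddition

/-! ### Second-order expansions -/

section Jets

open Filter Topology

/-- The expansion `f(ε) = a + bε + cε² + o(ε²)` as `ε → 0`, `ε ≠ 0`; the value `f(0)` is irrelevant,
so that it applies to a function with a removable singularity at zero. -/
def HasJet {𝕜 : Type*} [NontriviallyNormedField 𝕜] (f : 𝕜 → 𝕜) (a b c : 𝕜) : Prop :=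
  ∃ s : 𝕜 → 𝕜, Tendsto s (𝓝[≠] 0) (𝓝 c) ∧ ∀ᶠ ε in 𝓝[≠] 0, f ε = a + b * ε + s ε * ε ^ 2

namespace HasJet

variable {𝕜 : Type*} [NontriviallyNormedField 𝕜] {f g : 𝕜 → 𝕜} {a b c a' b' c' : 𝕜}

theorem congr (hf : HasJet f a b c) (h : ∀ᶠ ε in 𝓝[≠] 0, g ε = f ε) : HasJet g a b c := by
  obtain ⟨s, hs, hfs⟩ := hf
  exact ⟨s, hs, by filter_upwards [hfs, h] with ε hε hgf; rw [hgf, hε]⟩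

theorem const (a : 𝕜) : HasJet (fun _ => a) a 0 0 :=
  ⟨fun _ => 0, tendsto_const_nhds, .of_forall fun ε => by ring⟩

theorem id : HasJet (fun ε : 𝕜 => ε) 0 1 0 :=
  ⟨fun _ => 0, tendsto_const_nhds, .of_forall fun ε => by ring⟩

theorem tendsto (hf : HasJet f a b c) : Tendsto f (𝓝[≠] 0) (𝓝 a) := by
  obtain ⟨s, hs, hfs⟩ := hf
  have hid : Tendsto (fun ε : 𝕜 => ε) (𝓝[≠] 0) (𝓝 0) := nhdsWithin_le_nhds
  have hlim := (tendsto_const_nhds (x := a)).add ((hid.const_mul b).add (hs.mul (hid.pow 2)))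
  rw [mul_zero, zero_pow two_ne_zero, mul_zero, add_zero, add_zero] at hlim
  exact hlim.congr' (by filter_upwards [hfs] with ε hε; rw [hε, add_assoc])

theorem eventually_ne_zero (hf : HasJet f a b c) (ha : a ≠ 0) : ∀ᶠ ε in 𝓝[≠] 0, f ε ≠ 0 :=
  hf.tendsto.eventually_ne ha

theorem add (hf : HasJet f a b c) (hg : HasJet g a' b' c') :
    HasJet (fun ε => f ε + g ε) (a + a') (b + b') (c + c') := by
  obtain ⟨s, hs, hfs⟩ := hf
  obtain ⟨s', hs', hgs⟩ := hg
  refine ⟨fun ε => s ε + s' ε, hs.add hs', ?_⟩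
  filter_upwards [hfs, hgs] with ε hfε hgε
  rw [hfε, hgε]
  ring

theorem mul (hf : HasJet f a b c) (hg : HasJet g a' b' c') :
    HasJet (fun ε => f ε * g ε) (a * a') (a * b' + b * a') (a * c' + b * b' + c * a') := by
  obtain ⟨s, hs, hfs⟩ := hf
  obtain ⟨s', hs', hgs⟩ := hg
  have hid : Tendsto (fun ε : 𝕜 => ε) (𝓝[≠] 0) (𝓝 0) := nhdsWithin_le_nhds
  refine ⟨fun ε => a * s' ε + b * b' + s ε * a' + (b * s' ε + s ε * b') * ε + s ε * s' ε * ε ^ 2,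
    ?_, ?_⟩
  · have hlim := ((((hs'.const_mul a).add_const (b * b')).add (hs.mul_const a')).add
      (((hs'.const_mul b).add (hs.mul_const b')).mul hid)).add ((hs.mul hs').mul (hid.pow 2))
    simpa using hlim
  · filter_upwards [hfs, hgs] with ε hfε hgε
    rw [hfε, hgε]
    ring

theorem neg (hf : HasJet f a b c) : HasJet (fun ε => -f ε) (-a) (-b) (-c) := by
  simpa using (HasJet.const (-1)).mul hf

theorem inv (hf : HasJet f a b c) (ha : a ≠ 0) :
    HasJet (fun ε => (f ε)⁻¹) a⁻¹ (-b / a ^ 2) ((b ^ 2 - a * c) / a ^ 3) := by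
  have hf0 := hf.eventually_ne_zero ha
  have hfa := hf.tendsto
  obtain ⟨s, hs, hfs⟩ := hf
  have hid : Tendsto (fun ε : 𝕜 => ε) (𝓝[≠] 0) (𝓝 0) := nhdsWithin_le_nhds
  refine ⟨fun ε => (b ^ 2 - a * s ε + b * s ε * ε) / (a ^ 2 * f ε), ?_, ?_⟩
  · have hlim := (((hs.const_mul a).const_sub (b ^ 2)).add ((hs.const_mul b).mul hid)).div
      (hfa.const_mul (a ^ 2)) (mul_ne_zero (pow_ne_zero 2 ha) ha)
    simpa [pow_succ, Pi.div_def] using hlim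
  · filter_upwards [hfs, hf0] with ε hε hε0
    field_simp
    rw [hε]
    ring

theorem eq_zero (hf : HasJet f a b c) (hf0 : ∀ᶠ ε in 𝓝[≠] 0, f ε = 0) :
    a = 0 ∧ b = 0 ∧ c = 0 := by
  have ha : a = 0 := tendsto_nhds_unique hf.tendsto
    (tendsto_const_nhds.congr' (by filter_upwards [hf0] with ε hε; exact hε.symm))
  obtain ⟨s, hs, hfs⟩ := hf
  have hne : ∀ᶠ ε : 𝕜 in 𝓝[≠] 0, ε ≠ 0 := self_mem_nhdsWithin
  have hid : Tendsto (fun ε : 𝕜 => ε) (𝓝[≠] 0) (𝓝 0) := nhdsWithin_le_nhds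
  have hb : b = 0 := by
    have hlim := (hs.mul hid).const_add b
    rw [mul_zero, add_zero] at hlim
    refine tendsto_nhds_unique hlim (tendsto_const_nhds.congr' ?_)
    filter_upwards [hf0, hfs, hne] with ε hε0 hε hne
    rw [hε0, ha] at hε
    exact mul_left_cancel₀ hne (by linear_combination hε)
  refine ⟨ha, hb, tendsto_nhds_unique hs (tendsto_const_nhds.congr' ?_)⟩
  filter_upwards [hf0, hfs, hne] with ε hε0 hε hne
  rw [hε0, ha, hb] at hε
  exact mul_right_cancel₀ (pow_ne_zero 2 hne) (by linear_combination hε)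

theorem unique (hf : HasJet f a b c) (hf' : HasJet f a' b' c') : a = a' ∧ b = b' ∧ c = c' := by
  have h := (hf.add hf'.neg).eq_zero (.of_forall fun ε => add_neg_cancel _)
  simpa only [add_neg_eq_zero] using h

theorem comp_mul (hf : HasJet f a b c) {x : 𝕜} (hx : x ≠ 0) :
    HasJet (fun ε => f (x * ε)) a (b * x) (c * x ^ 2) := by
  obtain ⟨s, hs, hfs⟩ := hf
  have hid : Tendsto (fun ε : 𝕜 => ε) (𝓝[≠] 0) (𝓝 0) := nhdsWithin_le_nhds
  have hmul : Tendsto (fun ε : 𝕜 => x * ε) (𝓝[≠] 0) (𝓝[≠] 0) := by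
    refine tendsto_nhdsWithin_iff.2 ⟨by simpa using hid.const_mul x, ?_⟩
    filter_upwards [self_mem_nhdsWithin] with ε hε
    exact mul_ne_zero hx hε
  refine ⟨fun ε => s (x * ε) * x ^ 2, (hs.comp hmul).mul_const _, ?_⟩
  filter_upwards [hmul.eventually hfs] with ε hε
  rw [hε]
  ring

end HasJet

theorem differentiable_dslope_zero {f : ℂ → ℂ} (hf : Differentiable ℂ f) :
    Differentiable ℂ (dslope f 0) := by
  rw [← differentiableOn_univ] at hf ⊢
  exact (Complex.differentiableOn_dslope Filter.univ_mem).2 hf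

theorem eq_add_mul_dslope_zero {𝕜 : Type*} [NontriviallyNormedField 𝕜] (f : 𝕜 → 𝕜) (z : 𝕜) :
    f z = f 0 + z * dslope f 0 z := by
  have h := sub_smul_dslope f 0 z
  rw [sub_zero, smul_eq_mul] at h
  rw [h, add_sub_cancel]

theorem hasJet_of_differentiable {f : ℂ → ℂ} (hf : Differentiable ℂ f) :
    HasJet f (f 0) (deriv f 0) (deriv (dslope f 0) 0) := by
  have hd := differentiable_dslope_zero (differentiable_dslope_zero hf)
  refine ⟨dslope (dslope f 0) 0, ?_, .of_forall fun z => ?_⟩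
  · have hlim := hd.continuous.tendsto 0
    rw [dslope_same] at hlim
    exact hlim.mono_left nhdsWithin_le_nhds
  · rw [eq_add_mul_dslope_zero f z, eq_add_mul_dslope_zero (dslope f 0) z, dslope_same]
    ring

end Jets

/-! ### The Kronecker function -/

section Kronecker

open Complex

theorem three_term_of_addition {K : Type*} [Field K] [CharZero K] {G A B : K → K}
    (hadd : ∀ x y, G (x + y) * G (x - y) = A x * B y - B x * A y) (X Y P Q : K) :
    G (X + P) * G (X + Y + Q) * G Y * G (P + Q) - G (Y + Q) * G (X + P + Q) * G (X + Y) * G P +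
      G (X + Y + P + Q) * G (P - Y) * G X * G Q = 0 := by
  -- the Plücker relation between the minors `A a * B b - B a * A b`
  have plucker (a b c d : K) :
      (G (a + d) * G (a - d)) * (G (b + c) * G (b - c)) -
      (G (b + d) * G (b - d)) * (G (a + c) * G (a - c)) +
      (G (a + b) * G (a - b)) * (G (c + d) * G (c - d)) = 0 := by
    simp only [hadd]; ring
  have h := plucker (X + (Y + P + Q) / 2) ((Y + P + Q) / 2) ((Q + P - Y) / 2) ((P - Y - Q) / 2)
  ring_nf at h ⊢
  linear_combination h

theorem yang_baxter_of_addition {K : Type*} [Field K] [CharZero K] {G A B : K → K}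
    (hodd : ∀ z, G (-z) = -G z)
    (hadd : ∀ x y, G (x + y) * G (x - y) = A x * B y - B x * A y) {X Y Z P Q S : K}
    (hXYZ : X + Y + Z = 0) (hPQS : P + Q + S = 0) (hX : G X ≠ 0) (hY : G Y ≠ 0) (hZ : G Z ≠ 0)
    (hP : G P ≠ 0) (hQ : G Q ≠ 0) (hS : G S ≠ 0) :
    G (X + P) / (G X * G P) * (G (-Z + Q) / (G (-Z) * G Q)) +
    G (Y + Q) / (G Y * G Q) * (G (-X + S) / (G (-X) * G S)) +
    G (Z + S) / (G Z * G S) * (G (-Y + P) / (G (-Y) * G P)) = 0 := by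
  obtain rfl : Z = -(X + Y) := by linear_combination hXYZ
  obtain rfl : S = -(P + Q) := by linear_combination hPQS
  have h := three_term_of_addition hadd X Y P Q
  rw [show -(-(X + Y)) + Q = X + Y + Q by ring, show -X + -(P + Q) = -(X + P + Q) by ring,
    show -(X + Y) + -(P + Q) = -(X + Y + P + Q) by ring, show -Y + P = P - Y by ring]
  rw [hodd, neg_ne_zero] at hZ hS
  simp only [hodd, neg_neg]
  field_simp
  linear_combination h

variable (n : ℕ) (τ : ℂ)

/-- The theta function with characteristic `α ∈ ℤ/n`. -/
def thFun (α : ZMod n) : ℂ → ℂ := thetaChar n τ α.val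

/-- The Kronecker function `θ_0'(0) θ_{α+β}(x+y) / (θ_α(x) θ_β(y))`; the coefficients `c_{i,r}` are
its constant terms at `x = y = 0`. -/
def kron (α β : ZMod n) (x y : ℂ) : ℂ :=
  thD n τ 0 * thFun n τ (α + β) (x + y) / (thFun n τ α x * thFun n τ β y)

/-- The exponential factor that relates `kron` with characteristics `a` and `b` to the quotient of
theta functions without characteristics at the shifted arguments `x + aτ/n` and `y + bτ/n`. -/
def kronPhase (a b : ℤ) (x y : ℂ) : ℂ := expTwoPi (a * y + b * x + a * b / n * τ)

theorem thFun_zero : thFun n τ 0 = thetaChar n τ 0 := by simp [thFun]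

theorem kron_comm (α β : ZMod n) (x y : ℂ) : kron n τ α β x y = kron n τ β α y x := by
  rw [kron, kron, add_comm α, add_comm x, mul_comm (thFun n τ α x)]

theorem kronPhase_neg (a b : ℤ) (x y : ℂ) :
    kronPhase n τ (-a) (-b) (-x) (-y) = kronPhase n τ a b x y := by
  rw [kronPhase, kronPhase]
  push_cast
  ring_nf

theorem kronPhase_mul_kronPhase {X Y Z P Q S : ℤ} {x y z p q s : ℂ} (hXYZ : X + Y + Z = 0)
    (hPQS : P + Q + S = 0) (hxyz : x + y + z = 0) (hpqs : p + q + s = 0) :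
    kronPhase n τ X P x p * kronPhase n τ (-Z) Q (-z) q =
      kronPhase n τ Y Q y q * kronPhase n τ (-X) S (-x) s := by
  obtain rfl : Z = -(X + Y) := by linear_combination hXYZ
  obtain rfl : S = -(P + Q) := by linear_combination hPQS
  obtain rfl : z = -(x + y) := by linear_combination hxyz
  obtain rfl : s = -(p + q) := by linear_combination hpqs
  simp only [kronPhase, ← expTwoPi_add]
  push_cast
  ring_nf

variable [NeZero n] {τ}

theorem thetaChar_eq_thFun (hτ : 0 < τ.im) (a : ℤ) : thetaChar n τ a = thFun n τ (a : ZMod n) := by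
  funext z
  have hval : ((a : ZMod n).val : ℤ) = a % n := ZMod.val_intCast a
  rw [thFun, hval, ← thetaChar_add_mul_natCast n hτ (a % n) (a / n), mul_comm (a / n),
    Int.emod_add_mul_ediv]

theorem thFun_zero_neg (hτ : 0 < τ.im) (z : ℂ) : thFun n τ 0 (-z) = -thFun n τ 0 z := by
  simpa [thFun_zero] using thetaChar_zero_neg n hτ z

theorem thFun_intCast (hτ : 0 < τ.im) (a : ℤ) (z : ℂ) :
    thFun n τ a z = exp (Real.pi * I * (2 * a * z - a / n + a ^ 2 / n * τ)) *
      thFun n τ 0 (z + a / n * τ) := by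
  rw [← thetaChar_eq_thFun n hτ, thetaChar_eq_shift, thFun_zero]

theorem kron_intCast (hτ : 0 < τ.im) (a b : ℤ) (x y : ℂ) : kron n τ a b x y =
    thD n τ 0 * kronPhase n τ a b x y *
      (thFun n τ 0 ((x + a / n * τ) + (y + b / n * τ)) /
        (thFun n τ 0 (x + a / n * τ) * thFun n τ 0 (y + b / n * τ))) := by
  have hphase : exp (Real.pi * I * (2 * (a + b : ℤ) * (x + y) - (a + b : ℤ) / n +
      (a + b : ℤ) ^ 2 / n * τ)) = kronPhase n τ a b x y *
      (exp (Real.pi * I * (2 * a * x - a / n + a ^ 2 / n * τ)) *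
      exp (Real.pi * I * (2 * b * y - b / n + b ^ 2 / n * τ))) := by
    rw [kronPhase, expTwoPi, ← exp_add, ← exp_add]
    push_cast
    ring_nf
  have harg : (x + y) + ((a + b : ℤ) : ℂ) / n * τ = (x + a / n * τ) + (y + b / n * τ) := by
    push_cast; ring
  rw [kron, ← Int.cast_add, thFun_intCast n hτ, thFun_intCast n hτ, thFun_intCast n hτ, hphase,
    harg, mul_mul_mul_comm (exp _) (thFun _ _ _ _), ← mul_assoc, ← mul_assoc, mul_right_comm _ _
    (thFun _ _ _ _), mul_comm (exp _ * exp _) (thFun _ _ _ _ * _),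
    mul_div_mul_right _ _ (mul_ne_zero (exp_ne_zero _) (exp_ne_zero _)), mul_div_assoc]

theorem kron_neg (hτ : 0 < τ.im) (α β : ZMod n) (x y : ℂ) :
    kron n τ (-α) (-β) (-x) (-y) = -kron n τ α β x y := by
  obtain ⟨a, rfl⟩ := ZMod.intCast_surjective α
  obtain ⟨b, rfl⟩ := ZMod.intCast_surjective β
  have hneg (c : ℤ) (w : ℂ) : -w + ((-c : ℤ) : ℂ) / n * τ = -(w + c / n * τ) := by push_cast; ring
  rw [← Int.cast_neg, ← Int.cast_neg, kron_intCast n hτ, kron_intCast n hτ, kronPhase_neg, hneg,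
    hneg, ← neg_add]
  rw [thFun_zero_neg n hτ, thFun_zero_neg n hτ, thFun_zero_neg n hτ, neg_mul_neg, neg_div, mul_neg]

theorem kron_yang_baxter (hτ : 0 < τ.im) {X Y Z P Q S : ZMod n} {x y z p q s : ℂ}
    (hXYZ : X + Y + Z = 0) (hPQS : P + Q + S = 0) (hxyz : x + y + z = 0) (hpqs : p + q + s = 0)
    (hX : thFun n τ X x ≠ 0) (hY : thFun n τ Y y ≠ 0) (hZ : thFun n τ Z z ≠ 0)
    (hP : thFun n τ P p ≠ 0) (hQ : thFun n τ Q q ≠ 0) (hS : thFun n τ S s ≠ 0) :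
    kron n τ X P x p * kron n τ (-Z) Q (-z) q + kron n τ Y Q y q * kron n τ (-X) S (-x) s +
      kron n τ Z S z s * kron n τ (-Y) P (-y) p = 0 := by
  obtain ⟨A, B, hadd⟩ := exists_thetaChar_add_mul_sub n hτ
  rw [← thFun_zero] at hadd
  obtain ⟨X, rfl⟩ := ZMod.intCast_surjective X
  obtain ⟨Y, rfl⟩ := ZMod.intCast_surjective Y
  obtain ⟨P, rfl⟩ := ZMod.intCast_surjective P
  obtain ⟨Q, rfl⟩ := ZMod.intCast_surjective Q
  obtain ⟨Z, hXYZ', rfl⟩ : ∃ Z' : ℤ, X + Y + Z' = 0 ∧ (Z' : ZMod n) = Z :=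
    ⟨-(X + Y), by ring, by push_cast; linear_combination -hXYZ⟩
  obtain ⟨S, hPQS', rfl⟩ : ∃ S' : ℤ, P + Q + S' = 0 ∧ (S' : ZMod n) = S :=
    ⟨-(P + Q), by ring, by push_cast; linear_combination -hPQS⟩
  rw [thFun_intCast n hτ] at hX hY hZ hP hQ hS
  have hquot := yang_baxter_of_addition (thFun_zero_neg n hτ) hadd
    (X := x + X / n * τ) (Y := y + Y / n * τ) (Z := z + Z / n * τ)
    (P := p + P / n * τ) (Q := q + Q / n * τ) (S := s + S / n * τ)
    (by linear_combination hxyz + τ / n * (by exact_mod_cast hXYZ' : (X + Y + Z : ℂ) = 0))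
    (by linear_combination hpqs + τ / n * (by exact_mod_cast hPQS' : (P + Q + S : ℂ) = 0))
    (right_ne_zero_of_mul hX) (right_ne_zero_of_mul hY) (right_ne_zero_of_mul hZ)
    (right_ne_zero_of_mul hP) (right_ne_zero_of_mul hQ) (right_ne_zero_of_mul hS)
  have hphase := kronPhase_mul_kronPhase n τ hXYZ' hPQS' hxyz hpqs
  have hphase' := kronPhase_mul_kronPhase n τ (X := Y) (Y := Z) (Z := X) (P := Q) (Q := S) (S := P)
    (x := y) (y := z) (z := x) (p := q) (q := s) (s := p) (by linarith) (by linarith)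
    (by linear_combination hxyz) (by linear_combination hpqs)
  have hneg (c : ℤ) (w : ℂ) : -w + ((-c : ℤ) : ℂ) / n * τ = -(w + c / n * τ) := by push_cast; ring
  simp only [← Int.cast_neg, kron_intCast n hτ, hneg]
  have regroup (d a b u v : ℂ) : d * a * u * (d * b * v) = d ^ 2 * (a * b) * (u * v) := by ring
  rw [regroup, regroup, regroup, ← hphase', ← hphase, ← mul_add, ← mul_add, hquot, mul_zero]

end Kronecker

/-! ### The constant terms of the Kronecker function -/

section Coefficients

open Filter Topology Complex

variable (n : ℕ) (τ : ℂ)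

/-- The quadratic Taylor coefficient of `θ_α` at zero. -/
def thTwo (α : ZMod n) : ℂ := deriv (dslope (thFun n τ α) 0) 0

/-- The cubic Taylor coefficient of `θ_0` at zero. -/
def thThree : ℂ := deriv (dslope (dslope (thFun n τ 0) 0) 0) 0

/-- The constant term of the Kronecker function `kron n τ α β` at the origin. -/
def kronConst (α β : ZMod n) : ℂ :=
  if α = 0 then (if β = 0 then 0 else thD n τ β / th n τ β)
  else if β = 0 then thD n τ α / th n τ α
  else thD n τ 0 * th n τ (α + β) / (th n τ α * th n τ β)

/-- The derivative in the first variable of the Kronecker function `kron n τ α β` at the origin,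
with the polar part removed. -/
def kronDeriv (α β : ZMod n) : ℂ :=
  if α = 0 then
    (if β = 0 then 2 * (thThree n τ / thD n τ 0)
    else thTwo n τ β / th n τ β - thThree n τ / thD n τ 0)
  else if β = 0 then 2 * (thTwo n τ α / th n τ α) - (thD n τ α / th n τ α) ^ 2
  else thD n τ 0 * (thD n τ (α + β) / (th n τ α * th n τ β) -
    th n τ (α + β) * thD n τ α / (th n τ α ^ 2 * th n τ β))

/-- The linear term of the Kronecker function `kron n τ α β` at the origin. -/
def kronLinear (α β : ZMod n) (x y : ℂ) : ℂ := x * kronDeriv n τ α β + y * kronDeriv n τ β α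

variable {n} in
/-- The indicator of zero. The polar part of `kron n τ α β` is `atZero α / x + atZero β / y`. -/
def atZero (α : ZMod n) : ℂ := if α = 0 then 1 else 0

theorem atZero_neg (α : ZMod n) : atZero (-α) = atZero α := by simp only [atZero, neg_eq_zero]

variable {τ}

theorem differentiable_thFun (hτ : 0 < τ.im) (α : ZMod n) : Differentiable ℂ (thFun n τ α) :=
  differentiable_thetaChar hτ n _

theorem hasJet_thFun (hτ : 0 < τ.im) (α : ZMod n) :
    HasJet (thFun n τ α) (th n τ α) (thD n τ α) (thTwo n τ α) :=
  hasJet_of_differentiable (differentiable_thFun n hτ α)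

theorem atZero_div_mul_kronLinear_sub {X Y Z : ZMod n} {x y z : ℂ} (hXYZ : X + Y + Z = 0)
    (hxyz : x + y + z = 0) (hx : x ≠ 0) (Q : ZMod n) (q : ℂ) :
    atZero X / x * (kronLinear n τ (-Z) Q (-z) q - kronLinear n τ Y Q y q) =
      atZero X * kronDeriv n τ Y Q := by
  by_cases hX : X = 0
  · obtain rfl : Y = -Z := by rw [hX] at hXYZ; linear_combination hXYZ
    simp only [kronLinear]
    field_simp
    linear_combination -atZero X * kronDeriv n τ (-Z) Q * hxyz
  · simp [atZero, hX]

variable [NeZero n]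

theorem th_ne_zero (hτ : 0 < τ.im) {α : ZMod n} (hα : α ≠ 0) : th n τ α ≠ 0 := by
  refine thetaChar_apply_zero_ne_zero n hτ fun h => hα ?_
  rw [← ZMod.natCast_zmod_val α]
  exact (ZMod.natCast_eq_zero_iff α.val n).2 (by exact_mod_cast h)

theorem thD_zero_ne_zero (hτ : 0 < τ.im) : thD n τ 0 ≠ 0 := by
  simpa [thD] using deriv_thetaChar_zero_ne_zero n hτ

theorem thFun_zero_eq_mul (hτ : 0 < τ.im) (z : ℂ) :
    thFun n τ 0 z = z * dslope (thFun n τ 0) 0 z := by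
  have h0 : thFun n τ 0 0 = 0 := by rw [thFun_zero]; exact thetaChar_zero_zero n hτ
  conv_lhs => rw [eq_add_mul_dslope_zero (thFun n τ 0) z, h0, zero_add]

theorem thTwo_zero (hτ : 0 < τ.im) : thTwo n τ 0 = 0 := by
  have hodd : HasJet (fun ε => thFun n τ 0 (-1 * ε)) _ _ _ := (hasJet_thFun n hτ 0).neg.congr
    (.of_forall fun ε => by rw [neg_one_mul, thFun_zero_neg n hτ])
  have h := (((hasJet_thFun n hτ 0).comp_mul (neg_ne_zero.2 one_ne_zero)).unique hodd).2.2
  linear_combination h / 2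

theorem hasJet_dslope_thFun_zero (hτ : 0 < τ.im) :
    HasJet (dslope (thFun n τ 0) 0) (thD n τ 0) 0 (thThree n τ) := by
  have h := hasJet_of_differentiable (differentiable_dslope_zero (differentiable_thFun n hτ 0))
  rwa [dslope_same, show deriv (dslope (thFun n τ 0) 0) 0 = 0 from thTwo_zero n hτ] at h

theorem eventually_thFun_ne_zero (hτ : 0 < τ.im) (α : ZMod n) {x : ℂ} (hx : x ≠ 0) :
    ∀ᶠ ε in 𝓝[≠] 0, thFun n τ α (x * ε) ≠ 0 := by
  by_cases hα : α = 0
  · subst hα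
    have h := ((hasJet_dslope_thFun_zero n hτ).comp_mul hx).eventually_ne_zero
      (thD_zero_ne_zero n hτ)
    filter_upwards [h, self_mem_nhdsWithin] with ε hε hε0
    rw [thFun_zero_eq_mul n hτ]
    exact mul_ne_zero (mul_ne_zero hx hε0) hε
  · exact ((hasJet_thFun n hτ α).comp_mul hx).eventually_ne_zero (th_ne_zero n hτ hα)

theorem hasJet_kron_zero_zero (hτ : 0 < τ.im) {x y : ℂ} (hx : x ≠ 0) (hy : y ≠ 0)
    (hxy : x + y ≠ 0) :
    HasJet (fun ε => ε * kron n τ 0 0 (x * ε) (y * ε)) (1 / x + 1 / y) (kronConst n τ 0 0)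
      (kronLinear n τ 0 0 x y) := by
  have hD := thD_zero_ne_zero n hτ
  have jet := hasJet_dslope_thFun_zero n hτ
  have j := (((HasJet.const (thD n τ 0 * (x + y) / (x * y))).mul (jet.comp_mul hxy)).mul
    (((jet.comp_mul hx).mul (jet.comp_mul hy)).inv (mul_ne_zero hD hD))).congr
    (g := fun ε => ε * kron n τ 0 0 (x * ε) (y * ε)) (by
      filter_upwards [self_mem_nhdsWithin] with ε (hε : ε ≠ 0)
      rw [kron, add_zero, ← add_mul]
      simp only [thFun_zero_eq_mul n hτ (_ * ε), div_eq_mul_inv, mul_inv]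
      field_simp)
  convert j using 1
  · field_simp
    ring
  · simp [kronConst]
  · simp only [kronLinear, kronDeriv, if_true]
    field_simp
    ring

theorem hasJet_kron_zero_right (hτ : 0 < τ.im) {α : ZMod n} (hα : α ≠ 0) {x y : ℂ} (hx : x ≠ 0)
    (hy : y ≠ 0) (hxy : x + y ≠ 0) :
    HasJet (fun ε => ε * kron n τ α 0 (x * ε) (y * ε)) (1 / y) (kronConst n τ α 0)
      (kronLinear n τ α 0 x y) := by
  have hD := thD_zero_ne_zero n hτ
  have hth := th_ne_zero n hτ hα
  have jet := hasJet_thFun n hτ α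
  have j := (((HasJet.const (thD n τ 0 / y)).mul (jet.comp_mul hxy)).mul
    (((jet.comp_mul hx).mul ((hasJet_dslope_thFun_zero n hτ).comp_mul hy)).inv
      (mul_ne_zero hth hD))).congr
    (g := fun ε => ε * kron n τ α 0 (x * ε) (y * ε)) (by
      filter_upwards [self_mem_nhdsWithin] with ε (hε : ε ≠ 0)
      rw [kron, add_zero, thFun_zero_eq_mul n hτ (y * ε), ← add_mul]
      simp only [div_eq_mul_inv, mul_inv]
      field_simp)
  convert j using 1
  · field_simp
  · simp only [kronConst, hα, if_false, if_true]
    field_simp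
    ring
  · simp only [kronLinear, kronDeriv, hα, if_false, if_true]
    field_simp
    ring

theorem hasJet_kron_of_ne_zero (hτ : 0 < τ.im) {α β : ZMod n} (hα : α ≠ 0) (hβ : β ≠ 0) {x y : ℂ}
    (hx : x ≠ 0) (hy : y ≠ 0) (hxy : x + y ≠ 0) :
    HasJet (fun ε => ε * kron n τ α β (x * ε) (y * ε)) 0 (kronConst n τ α β)
      (kronLinear n τ α β x y) := by
  have hthα := th_ne_zero n hτ hα
  have hthβ := th_ne_zero n hτ hβ
  have jet := hasJet_thFun n hτ
  have j := ((HasJet.id.mul ((HasJet.const (thD n τ 0)).mul ((jet (α + β)).comp_mul hxy))).mul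
    ((((jet α).comp_mul hx).mul ((jet β).comp_mul hy)).inv (mul_ne_zero hthα hthβ))).congr
    (g := fun ε => ε * kron n τ α β (x * ε) (y * ε)) (.of_forall fun ε => by
      rw [kron, ← add_mul, div_eq_mul_inv]
      ring)
  convert j using 1
  · simp
  · simp only [kronConst, hα, hβ, if_false]
    field_simp
    ring
  · simp only [kronLinear, kronDeriv, hα, hβ, if_false]
    rw [add_comm β α]
    field_simp
    ring

theorem hasJet_kron (hτ : 0 < τ.im) (α β : ZMod n) {x y : ℂ} (hx : x ≠ 0) (hy : y ≠ 0)
    (hxy : x + y ≠ 0) :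
    HasJet (fun ε => ε * kron n τ α β (x * ε) (y * ε)) (atZero α / x + atZero β / y)
      (kronConst n τ α β) (kronLinear n τ α β x y) := by
  by_cases hα : α = 0 <;> by_cases hβ : β = 0
  · subst hα hβ
    simpa [atZero] using hasJet_kron_zero_zero n hτ hx hy hxy
  · subst hα
    have j := hasJet_kron_zero_right n hτ hβ hy hx (by rwa [add_comm])
    simp only [kron_comm n τ β 0] at j
    convert j using 1
    · simp [atZero, hβ]
    · simp [kronConst, hβ]
    · simp only [kronLinear, add_comm]
  · subst hβ
    simpa [atZero, hα] using hasJet_kron_zero_right n hτ hα hx hy hxy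
  · simpa [atZero, hα, hβ] using hasJet_kron_of_ne_zero n hτ hα hβ hx hy hxy

theorem kronConst_neg_and_kronLinear_neg (hτ : 0 < τ.im) (α β : ZMod n) {x y : ℂ} (hx : x ≠ 0)
    (hy : y ≠ 0) (hxy : x + y ≠ 0) :
    kronConst n τ (-α) (-β) = -kronConst n τ α β ∧
      kronLinear n τ (-α) (-β) (-x) (-y) = -kronLinear n τ α β x y := by
  have hodd : HasJet (fun ε => ε * kron n τ (-α) (-β) (-x * ε) (-y * ε)) _ _ _ :=
    (hasJet_kron n hτ α β hx hy hxy).neg.congr (.of_forall fun ε => by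
      rw [neg_mul, neg_mul, kron_neg n hτ, mul_neg])
  exact ((hasJet_kron n hτ (-α) (-β) (neg_ne_zero.2 hx) (neg_ne_zero.2 hy)
    (by rw [← neg_add]; exact neg_ne_zero.2 hxy)).unique hodd).2

theorem kronConst_neg (hτ : 0 < τ.im) (α β : ZMod n) :
    kronConst n τ (-α) (-β) = -kronConst n τ α β :=
  (kronConst_neg_and_kronLinear_neg n hτ α β (one_ne_zero' ℂ) (one_ne_zero' ℂ) (by norm_num)).1

theorem kronDeriv_neg (hτ : 0 < τ.im) (α β : ZMod n) :
    kronDeriv n τ (-α) (-β) = kronDeriv n τ α β := by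
  have h1 := (kronConst_neg_and_kronLinear_neg n hτ α β (x := 1) (y := 1) (by norm_num)
    (by norm_num) (by norm_num)).2
  have h2 := (kronConst_neg_and_kronLinear_neg n hτ α β (x := 2) (y := 1) (by norm_num)
    (by norm_num) (by norm_num)).2
  simp only [kronLinear] at h1 h2
  linear_combination h1 - h2

/-- This compares the constant terms in `kron_yang_baxter` along a line through the origin. -/
theorem kronConst_yang_baxter_add_polar (hτ : 0 < τ.im) {X Y Z P Q S : ZMod n} {x y z p q s : ℂ}
    (hXYZ : X + Y + Z = 0) (hPQS : P + Q + S = 0) (hxyz : x + y + z = 0) (hpqs : p + q + s = 0)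
    (hx : x ≠ 0) (hy : y ≠ 0) (hz : z ≠ 0) (hp : p ≠ 0) (hq : q ≠ 0) (hs : s ≠ 0)
    (hxp : x + p ≠ 0) (hzq : -z + q ≠ 0) (hyq : y + q ≠ 0) (hxs : -x + s ≠ 0) (hzs : z + s ≠ 0)
    (hyp : -y + p ≠ 0) :
    (kronConst n τ X P * kronConst n τ (-Z) Q + kronConst n τ Y Q * kronConst n τ (-X) S +
      kronConst n τ Z S * kronConst n τ (-Y) P) +
    (atZero X / x + atZero P / p) * kronLinear n τ (-Z) Q (-z) q +
    (atZero (-Z) / -z + atZero Q / q) * kronLinear n τ X P x p +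
    (atZero Y / y + atZero Q / q) * kronLinear n τ (-X) S (-x) s +
    (atZero (-X) / -x + atZero S / s) * kronLinear n τ Y Q y q +
    (atZero Z / z + atZero S / s) * kronLinear n τ (-Y) P (-y) p +
    (atZero (-Y) / -y + atZero P / p) * kronLinear n τ Z S z s = 0 := by
  have hx' := neg_ne_zero.2 hx
  have hy' := neg_ne_zero.2 hy
  have hz' := neg_ne_zero.2 hz
  have jet := ((((hasJet_kron n hτ X P hx hp hxp).mul (hasJet_kron n hτ (-Z) Q hz' hq hzq)).add
    ((hasJet_kron n hτ Y Q hy hq hyq).mul (hasJet_kron n hτ (-X) S hx' hs hxs))).add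
    ((hasJet_kron n hτ Z S hz hs hzs).mul (hasJet_kron n hτ (-Y) P hy' hp hyp)))
  have h := (jet.eq_zero (by
    filter_upwards [eventually_thFun_ne_zero n hτ X hx, eventually_thFun_ne_zero n hτ Y hy,
      eventually_thFun_ne_zero n hτ Z hz, eventually_thFun_ne_zero n hτ P hp,
      eventually_thFun_ne_zero n hτ Q hq, eventually_thFun_ne_zero n hτ S hs]
      with ε hXε hYε hZε hPε hQε hSε
    have hyb := kron_yang_baxter n hτ hXYZ hPQS (by linear_combination ε * hxyz)
      (by linear_combination ε * hpqs) hXε hYε hZε hPε hQε hSε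
    simp only [← neg_mul] at hyb
    linear_combination ε ^ 2 * hyb)).2.2
  linear_combination h

theorem atZero_div_mul_kronLinear_add (hτ : 0 < τ.im) {P Q S : ZMod n} {p q s : ℂ}
    (hPQS : P + Q + S = 0) (hpqs : p + q + s = 0) (hp : p ≠ 0) (Z : ZMod n) (z : ℂ) :
    atZero P / p * (kronLinear n τ (-Z) Q (-z) q + kronLinear n τ Z S z s) =
      -(atZero P * kronDeriv n τ Q (-Z)) := by
  by_cases hP : P = 0
  · obtain rfl : S = -Q := by rw [hP] at hPQS; linear_combination hPQS
    have hneg := kronDeriv_neg n hτ Q (-Z)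
    have hneg' := kronDeriv_neg n hτ (-Z) Q
    rw [neg_neg] at hneg hneg'
    simp only [kronLinear, hneg, hneg']
    field_simp
    linear_combination atZero P * kronDeriv n τ Q (-Z) * hpqs
  · simp [atZero, hP]

theorem kronConst_yang_baxter (hτ : 0 < τ.im) {X Y Z P Q S : ZMod n}
    (hXYZ : X + Y + Z = 0) (hPQS : P + Q + S = 0) :
    kronConst n τ X P * kronConst n τ (-Z) Q + kronConst n τ Y Q * kronConst n τ (-X) S +
      kronConst n τ Z S * kronConst n τ (-Y) P =
    atZero P * kronDeriv n τ Q (-Z) + atZero Q * kronDeriv n τ S (-X) +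
      atZero S * kronDeriv n τ P (-Y) - atZero X * kronDeriv n τ Y Q -
      atZero Y * kronDeriv n τ Z S - atZero Z * kronDeriv n τ X P := by
  -- any direction along which no theta function vanishes identically will do
  obtain ⟨x, y, z, p, q, s, hx, hy, hz, hp, hq, hs, hxyz, hpqs, hxp, hzq, hyq, hxs, hzs, hyp⟩ :
      ∃ x y z p q s : ℂ, x ≠ 0 ∧ y ≠ 0 ∧ z ≠ 0 ∧ p ≠ 0 ∧ q ≠ 0 ∧ s ≠ 0 ∧ x + y + z = 0 ∧
        p + q + s = 0 ∧ x + p ≠ 0 ∧ -z + q ≠ 0 ∧ y + q ≠ 0 ∧ -x + s ≠ 0 ∧ z + s ≠ 0 ∧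
        -y + p ≠ 0 :=
    ⟨1, 1, -2, 2, 1, -3, by norm_num⟩
  have hYZX : Y + Z + X = 0 := by rw [← hXYZ]; ring
  have hZXY : Z + X + Y = 0 := by rw [← hXYZ]; ring
  have hQSP : Q + S + P = 0 := by rw [← hPQS]; ring
  have hSPQ : S + P + Q = 0 := by rw [← hPQS]; ring
  have hyzx : y + z + x = 0 := by rw [← hxyz]; ring
  have hzxy : z + x + y = 0 := by rw [← hxyz]; ring
  have hqsp : q + s + p = 0 := by rw [← hpqs]; ring
  have hspq : s + p + q = 0 := by rw [← hpqs]; ring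
  have h := kronConst_yang_baxter_add_polar n hτ hXYZ hPQS hxyz hpqs hx hy hz hp hq hs hxp hzq hyq
    hxs hzs hyp
  simp only [atZero_neg, div_neg] at h
  linear_combination h - atZero_div_mul_kronLinear_sub n (τ := τ) hXYZ hxyz hx Q q -
    atZero_div_mul_kronLinear_sub n (τ := τ) hYZX hyzx hy S s -
    atZero_div_mul_kronLinear_sub n (τ := τ) hZXY hzxy hz P p -
    atZero_div_mul_kronLinear_add n hτ hPQS hpqs hp Z z -
    atZero_div_mul_kronLinear_add n hτ hQSP hqsp hq X x -
    atZero_div_mul_kronLinear_add n hτ hSPQ hspq hs Y y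

end Coefficients

/-! ### Derivations and the cyclic quotient -/

section Derivations

variable {R S : Type*} [Ring R] [Algebra ℂ R] [Ring S] [Algebra ℂ S]

theorem tr_mul_comm (a b : R) : tr (a * b) = tr (b * a) :=
  (Submodule.Quotient.eq _).2 (Submodule.subset_span ⟨a, b, rfl⟩)

theorem tr_surjective : Function.Surjective (tr : R → Cyc R) :=
  Submodule.mkQ_surjective _

theorem Cyc.lift_tr {M : Type*} [AddCommGroup M] [Module ℂ M] (φ : R →ₗ[ℂ] M)
    (h : ∀ a b, φ (a * b) = φ (b * a)) (a : R) : Cyc.lift φ h (tr a) = φ a :=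
  Submodule.liftQ_apply _ _ _

theorem Cyc.map_tr (φ : R →ₐ[ℂ] S) (a : R) : Cyc.map φ (tr a) = tr (φ a) :=
  Cyc.lift_tr _ _ a

theorem Cyc.map_comp {T : Type*} [Ring T] [Algebra ℂ T] (ψ : S →ₐ[ℂ] T) (φ : R →ₐ[ℂ] S)
    (f : Cyc R) : Cyc.map (ψ.comp φ) f = Cyc.map ψ (Cyc.map φ f) := by
  obtain ⟨a, rfl⟩ := tr_surjective f
  simp only [Cyc.map_tr, AlgHom.comp_apply]

variable {D D' : R →ₗ[ℂ] R}

theorem IsDer.tr_congr (hD : IsDer D) {a b : R} (h : tr a = tr b) : tr (D a) = tr (D b) := by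
  have hcomm : ∀ a b, (tr ∘ₗ D) (a * b) = (tr ∘ₗ D) (b * a) := fun a b => by
    simp only [LinearMap.comp_apply, hD a b, hD b a, map_add]
    rw [tr_mul_comm (D a), tr_mul_comm a, add_comm]
  have h' := congrArg (Cyc.lift (tr ∘ₗ D) hcomm) h
  rwa [Cyc.lift_tr, Cyc.lift_tr] at h'

theorem IsDer.map_one (hD : IsDer D) : D 1 = 0 := by
  have h := hD 1 1
  rwa [mul_one, mul_one, one_mul, left_eq_add] at h

theorem IsDer.neg (hD : IsDer D) : IsDer (-D) := fun a b => by
  simp only [LinearMap.neg_apply, hD a b, neg_add, neg_mul, mul_neg]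

theorem IsDer.sub (hD : IsDer D) (hD' : IsDer D') : IsDer (D - D') := fun a b => by
  simp only [LinearMap.sub_apply, hD a b, hD' a b]
  noncomm_ring

theorem IsDer.commutator (hD : IsDer D) (hD' : IsDer D') : IsDer (D ∘ₗ D' - D' ∘ₗ D) := by
  intro a b
  simp only [LinearMap.sub_apply, LinearMap.comp_apply, hD a b, hD' a b, map_add, hD _ _, hD' _ _]
  noncomm_ring

variable {ι : Type*} [Fintype ι] {x : ι → R} {p : ι → Cyc R →ₗ[ℂ] R}

/-- The chain rule `df = ∑ p_i(f) dx_i` modulo commutators, tested on derivations. The `x_i` need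
not be independent. -/
def HasChainRule (x : ι → R) (p : ι → Cyc R →ₗ[ℂ] R) : Prop :=
  ∀ D : R →ₗ[ℂ] R, IsDer D → ∀ a, tr (D a) = ∑ i, tr (p i (tr a) * D (x i))

theorem HasChainRule.tr_comp (hp : HasChainRule x p) (hD : IsDer D) (hD' : IsDer D') (a : R) :
    tr (D (D' a)) =
      ∑ i, tr (D (p i (tr a)) * D' (x i)) + ∑ i, tr (p i (tr a) * D (D' (x i))) := by
  have h : tr (D' a) = tr (∑ i, p i (tr a) * D' (x i)) := by rw [hp D' hD', map_sum]
  rw [hD.tr_congr h]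
  simp only [map_sum, hD _ _, map_add, Finset.sum_add_distrib]

/-- Compare `D (D' f) - D' (D f)` with the chain rule for the derivation `[D, D']`. -/
theorem HasChainRule.sum_second_derivative_comm (hp : HasChainRule x p) (hD : IsDer D)
    (hD' : IsDer D') (f : Cyc R) :
    ∑ i, tr (D (p i f) * D' (x i)) = ∑ i, tr (D' (p i f) * D (x i)) := by
  obtain ⟨a, rfl⟩ := tr_surjective f
  have h := hp _ (hD.commutator hD') a
  simp only [LinearMap.sub_apply, LinearMap.comp_apply, map_sub, hp.tr_comp hD hD',
    hp.tr_comp hD' hD, mul_sub, Finset.sum_sub_distrib] at h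
  rw [← sub_eq_zero, ← sub_eq_zero.2 h]
  abel

end Derivations

/-! ### Double derivations and coordinates -/

section DoubleDerivations

variable {R S : Type*} [Ring R] [Algebra ℂ R] [Ring S] [Algebra ℂ S]

/-- The linear map `a ⊗ b ↦ (z ↦ a z b)`. -/
def innerMul : R ⊗[ℂ] R →ₗ[ℂ] R →ₗ[ℂ] R :=
  TensorProduct.lift <| LinearMap.mk₂ ℂ (fun a b => LinearMap.mulLeftRight ℂ (a, b))
    (fun _ _ _ => by ext; simp [add_mul]) (fun _ _ _ => by ext; simp)
    (fun _ _ _ => by ext; simp [mul_add]) (fun _ _ _ => by ext; simp)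

/-- The linear map `a ⊗ b ↦ (w ↦ b w a)`. -/
def outerMul : R ⊗[ℂ] R →ₗ[ℂ] R →ₗ[ℂ] R :=
  innerMul ∘ₗ (TensorProduct.comm ℂ R R).toLinearMap

@[simp] theorem innerMul_tmul (a b z : R) : innerMul (a ⊗ₜ[ℂ] b) z = a * z * b := by
  simp [innerMul]

@[simp] theorem outerMul_tmul (a b w : R) : outerMul (a ⊗ₜ[ℂ] b) w = b * w * a := by
  simp [outerMul]

@[simp] theorem innerMul_one (z : R) : innerMul (1 : R ⊗[ℂ] R) z = z := by
  simp [Algebra.TensorProduct.one_def]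

@[simp] theorem outerMul_one (w : R) : outerMul (1 : R ⊗[ℂ] R) w = w := by
  simp [Algebra.TensorProduct.one_def]

theorem revMul_eq_outerMul (t : R ⊗[ℂ] R) : revMul R t = outerMul t 1 := by
  induction t with
  | zero => simp
  | tmul a b => simp [revMul]
  | add s t hs ht => simp only [map_add, LinearMap.add_apply, hs, ht]

theorem outerMul_tmul_one_mul (f w : R) (t : R ⊗[ℂ] R) :
    outerMul ((f ⊗ₜ[ℂ] (1 : R)) * t) w = outerMul t (w * f) := by
  induction t with
  | zero => simp
  | tmul a b => simp [mul_assoc]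
  | add s t hs ht => simp only [mul_add, map_add, LinearMap.add_apply, hs, ht]

theorem outerMul_mul_one_tmul (f w : R) (t : R ⊗[ℂ] R) :
    outerMul (t * ((1 : R) ⊗ₜ[ℂ] f)) w = outerMul t (f * w) := by
  induction t with
  | zero => simp
  | tmul a b => simp [mul_assoc]
  | add s t hs ht => simp only [add_mul, map_add, LinearMap.add_apply, hs, ht]

theorem innerMul_tmul_one_mul (f z : R) (t : R ⊗[ℂ] R) :
    innerMul ((f ⊗ₜ[ℂ] (1 : R)) * t) z = f * innerMul t z := by
  induction t with
  | zero => simp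
  | tmul a b => simp [mul_assoc]
  | add s t hs ht => simp only [mul_add, map_add, LinearMap.add_apply, hs, ht]

theorem innerMul_mul_one_tmul (f z : R) (t : R ⊗[ℂ] R) :
    innerMul (t * ((1 : R) ⊗ₜ[ℂ] f)) z = innerMul t z * f := by
  induction t with
  | zero => simp
  | tmul a b => simp [mul_assoc]
  | add s t hs ht => simp only [add_mul, map_add, LinearMap.add_apply, hs, ht]

theorem tr_innerMul (t : R ⊗[ℂ] R) (z : R) : tr (innerMul t z) = tr (outerMul t 1 * z) := by
  induction t with
  | zero => simp
  | tmul a b => simp [mul_assoc, tr_mul_comm b]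
  | add s t hs ht => simp only [map_add, LinearMap.add_apply, add_mul, hs, ht]

variable {Φ : R →ₐ[ℂ] Matrix (Fin 2) (Fin 2) (R ⊗[ℂ] R)}

theorem IsDoubleDer.apply_mul (h : IsDoubleDer Φ) (f g : R) :
    Φ (f * g) 0 1 = (f ⊗ₜ[ℂ] (1 : R)) * Φ g 0 1 + Φ f 0 1 * ((1 : R) ⊗ₜ[ℂ] g) := by
  simp [Matrix.mul_apply, Fin.sum_univ_two, (h f).1, (h g).2.2]

/-- The polarization `w ↦ ∑ b w a` of the cyclic derivative of `f`, where `Δ f = ∑ a ⊗ b`. Unlike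
the cyclic derivative itself it obeys a product rule, `polar_mul`. -/
def polar (Φ : R →ₐ[ℂ] Matrix (Fin 2) (Fin 2) (R ⊗[ℂ] R)) : R →ₗ[ℂ] R →ₗ[ℂ] R :=
  outerMul ∘ₗ Matrix.entryLinearMap ℂ (R ⊗[ℂ] R) 0 1 ∘ₗ Φ.toLinearMap

theorem polar_apply (f w : R) : polar Φ f w = outerMul (Φ f 0 1) w := rfl

theorem polar_mul (h : IsDoubleDer Φ) (f g w : R) :
    polar Φ (f * g) w = polar Φ f (g * w) + polar Φ g (w * f) := by
  rw [polar_apply, h.apply_mul, map_add, LinearMap.add_apply, outerMul_tmul_one_mul,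
    outerMul_mul_one_tmul, add_comm]
  rfl

theorem polar_algebraMap (r : ℂ) : polar Φ (algebraMap ℂ R r) = 0 := by
  ext w
  rw [polar_apply, AlgHom.commutes]
  simp [Matrix.algebraMap_matrix_apply]

theorem polar_one : polar Φ 1 = 0 := by
  rw [← map_one (algebraMap ℂ R), polar_algebraMap]

theorem cycDeriv_tr (h : IsDoubleDer Φ) (f : R) : cycDeriv Φ h (tr f) = polar Φ f 1 := by
  rw [cycDeriv, Cyc.lift_tr, polar_apply, ← revMul_eq_outerMul]
  rfl

variable {X : Type*} [DecidableEq X] {u : X → R}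
  {Ψ : X → R →ₐ[ℂ] Matrix (Fin 2) (Fin 2) (R ⊗[ℂ] R)}

/-- Elements `u_i` and double derivations `D/Du_i` that behave like coordinates and partial
derivatives: `D u_j / D u_i = δ_ij 1 ⊗ 1`, and the algebra is generated by the `u_i` and
inverses. -/
structure IsCoordinates (u : X → R) (Ψ : X → R →ₐ[ℂ] Matrix (Fin 2) (Fin 2) (R ⊗[ℂ] R)) :
    Prop where
  doubleDer : ∀ i, IsDoubleDer (Ψ i)
  apply_coord : ∀ i j, Ψ i (u j) 0 1 = if j = i then 1 else 0
  generate : ∀ A : Subalgebra ℂ R, (∀ i, u i ∈ A) →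
    (∀ a b, a ∈ A → a * b = 1 → b * a = 1 → b ∈ A) → A = ⊤

namespace IsCoordinates

@[elab_as_elim]
theorem induction (h : IsCoordinates u Ψ) {P : R → Prop} (coord : ∀ i, P (u i))
    (algebraMap : ∀ r, P (algebraMap ℂ R r)) (add : ∀ a b, P a → P b → P (a + b))
    (mul : ∀ a b, P a → P b → P (a * b))
    (inv : ∀ a b, P a → a * b = 1 → b * a = 1 → P b) (a : R) : P a := by
  let A : Subalgebra ℂ R :=
    { carrier := {a | P a}
      mul_mem' := fun {a b} => mul a b
      add_mem' := fun {a b} => add a b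
      algebraMap_mem' := algebraMap }
  have ha : a ∈ A := h.generate A coord inv ▸ Algebra.mem_top
  exact ha

/-- The nonabelian partial derivatives `∂/∂u_i`. -/
def partialDeriv (h : IsCoordinates u Ψ) (i : X) : Cyc R →ₗ[ℂ] R :=
  cycDeriv (Ψ i) (h.doubleDer i)

theorem partialDeriv_tr (h : IsCoordinates u Ψ) (i : X) (f : R) :
    h.partialDeriv i (tr f) = polar (Ψ i) f 1 :=
  cycDeriv_tr (h.doubleDer i) f

theorem derivation_eq_zero (h : IsCoordinates u Ψ) {D : R →ₗ[ℂ] R} (hD : IsDer D)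
    (h0 : ∀ i, D (u i) = 0) : D = 0 := by
  ext a
  rw [LinearMap.zero_apply]
  induction a using h.induction with
  | coord i => exact h0 i
  | algebraMap r => rw [Algebra.algebraMap_eq_smul_one, map_smul, hD.map_one, smul_zero]
  | add a b ha hb => rw [map_add, ha, hb, add_zero]
  | mul a b ha hb => rw [hD, ha, hb, zero_mul, mul_zero, add_zero]
  | inv a b ha hab hba =>
    have hb := hD a b
    rw [hab, hD.map_one, ha, zero_mul, zero_add] at hb
    rw [← one_mul (D b), ← hba, mul_assoc, ← hb, mul_zero]

variable [Fintype X]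

theorem exists_derivation (h : IsCoordinates u Ψ) (z : X → R) :
    ∃ D : R →ₗ[ℂ] R, IsDer D ∧ (∀ i, D (u i) = z i) ∧
      ∀ a, tr (D a) = ∑ i, tr (h.partialDeriv i (tr a) * z i) := by
  let D : R →ₗ[ℂ] R := ∑ i, (innerMul.flip (z i)) ∘ₗ
    Matrix.entryLinearMap ℂ (R ⊗[ℂ] R) 0 1 ∘ₗ (Ψ i).toLinearMap
  have hDapply : ∀ a, D a = ∑ i, innerMul (Ψ i a 0 1) (z i) := fun a => by
    simp [D, LinearMap.sum_apply]
  refine ⟨D, fun a b => ?_, fun i => ?_, fun a => ?_⟩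
  · simp only [hDapply, fun i => (h.doubleDer i).apply_mul, map_add, LinearMap.add_apply,
      innerMul_tmul_one_mul, innerMul_mul_one_tmul, Finset.sum_add_distrib, Finset.mul_sum,
      Finset.sum_mul]
    rw [add_comm]
  · rw [hDapply, Finset.sum_eq_single i]
    · rw [h.apply_coord, if_pos rfl, innerMul_one]
    · intro j _ hj
      rw [h.apply_coord, if_neg hj.symm, map_zero, LinearMap.zero_apply]
    · simp
  · simp only [hDapply, map_sum, tr_innerMul, h.partialDeriv_tr, polar_apply]

theorem hasChainRule (h : IsCoordinates u Ψ) : HasChainRule u h.partialDeriv := by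
  intro D hD a
  obtain ⟨D', hD', hcoord, htr⟩ := h.exists_derivation fun i => D (u i)
  have hzero : D - D' = 0 := h.derivation_eq_zero (hD.sub hD') fun i => by
    rw [LinearMap.sub_apply, hcoord, sub_self]
  rw [← htr, sub_eq_zero.1 hzero]

theorem sum_commutator_polar (h : IsCoordinates u Ψ) (f w : R) :
    ∑ i, (polar (Ψ i) f w * u i - u i * polar (Ψ i) f w) = w * f - f * w := by
  have hmul : ∀ f g w, ∑ i, (polar (Ψ i) (f * g) w * u i - u i * polar (Ψ i) (f * g) w) =
      ∑ i, (polar (Ψ i) f (g * w) * u i - u i * polar (Ψ i) f (g * w)) +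
      ∑ i, (polar (Ψ i) g (w * f) * u i - u i * polar (Ψ i) g (w * f)) := fun f g w => by
    rw [← Finset.sum_add_distrib]
    refine Finset.sum_congr rfl fun i _ => ?_
    rw [polar_mul (h.doubleDer i)]
    noncomm_ring
  induction f using h.induction generalizing w with
  | coord j =>
    rw [Finset.sum_eq_single j]
    · rw [polar_apply, h.apply_coord, if_pos rfl, outerMul_one]
    · intro i _ hi
      simp [polar_apply, h.apply_coord, hi.symm]
    · simp
  | algebraMap r => simp [polar_algebraMap, Algebra.commutes]
  | add a b ha hb =>
    rw [show w * (a + b) - (a + b) * w = (w * a - a * w) + (w * b - b * w) by noncomm_ring,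
      ← ha, ← hb, ← Finset.sum_add_distrib]
    refine Finset.sum_congr rfl fun i _ => ?_
    rw [map_add, LinearMap.add_apply]
    noncomm_ring
  | mul a b ha hb =>
    rw [hmul, ha, hb]
    noncomm_ring
  | inv a b ha hab hba =>
    have hprod := hmul a b (w * b)
    simp only [hab, polar_one, LinearMap.zero_apply, zero_mul, mul_zero, sub_zero,
      Finset.sum_const_zero, ha, mul_assoc w b a, hba, mul_one] at hprod
    have hconj : b * (w * b) * a - a * (b * (w * b)) = b * w - w * b := by
      rw [mul_assoc, mul_assoc, hba, mul_one, ← mul_assoc a, hab, one_mul]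
    rw [hconj] at hprod
    rw [← sub_eq_zero, hprod]
    noncomm_ring

theorem sum_commutator_partialDeriv (h : IsCoordinates u Ψ) (f : Cyc R) :
    ∑ i, (h.partialDeriv i f * u i - u i * h.partialDeriv i f) = 0 := by
  obtain ⟨a, rfl⟩ := tr_surjective f
  simp only [h.partialDeriv_tr]
  rw [h.sum_commutator_polar, one_mul, mul_one, sub_self]

end IsCoordinates

theorem isCoordinates_freeAlgebra : IsCoordinates (FreeAlgebra.ι ℂ) (freeDD (X := X)) := by
  refine ⟨isDoubleDer_freeDD, fun i j => by simp [freeDD], fun A hA _ => ?_⟩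
  rw [← top_le_iff, ← FreeAlgebra.adjoin_range_ι]
  exact Algebra.adjoin_le (Set.range_subset_iff.2 hA)

theorem freePartial_tr (i : X) (f : FreeAlgebra ℂ X) :
    freePartial i (tr f) = polar (freeDD i) f 1 :=
  cycDeriv_tr (isDoubleDer_freeDD i) f

theorem polar_freeDD_ι (i j : X) (w : FreeAlgebra ℂ X) :
    polar (freeDD i) (FreeAlgebra.ι ℂ j) w = if j = i then w else 0 := by
  rw [polar_apply, isCoordinates_freeAlgebra.apply_coord]
  split_ifs <;> simp

variable [Fintype X] {Θ : S →ₐ[ℂ] Matrix (Fin 2) (Fin 2) (S ⊗[ℂ] S)}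

theorem polar_map (hΘ : IsDoubleDer Θ) (φ : FreeAlgebra ℂ X →ₐ[ℂ] S) (f w : FreeAlgebra ℂ X) :
    polar Θ (φ f) (φ w) =
      ∑ i, polar Θ (φ (FreeAlgebra.ι ℂ i)) (φ (polar (freeDD i) f w)) := by
  induction f using FreeAlgebra.induction generalizing w with
  | grade0 r => simp [polar_algebraMap]
  | grade1 j =>
    rw [Finset.sum_eq_single j]
    · rw [polar_freeDD_ι, if_pos rfl]
    · intro i _ hi
      rw [polar_freeDD_ι, if_neg hi.symm, map_zero, map_zero]
    · simp
  | mul a b ha hb =>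
    rw [map_mul, polar_mul hΘ, ← map_mul, ← map_mul, ha, hb, ← Finset.sum_add_distrib]
    refine Finset.sum_congr rfl fun i _ => ?_
    rw [polar_mul (isDoubleDer_freeDD i), map_add, map_add]
  | add a b ha hb =>
    rw [map_add, map_add, LinearMap.add_apply, ha, hb, ← Finset.sum_add_distrib]
    refine Finset.sum_congr rfl fun i _ => ?_
    rw [map_add, LinearMap.add_apply, map_add, map_add]

theorem cycDeriv_map (hΘ : IsDoubleDer Θ) (φ : FreeAlgebra ℂ X →ₐ[ℂ] S)
    (f : Cyc (FreeAlgebra ℂ X)) :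
    cycDeriv Θ hΘ (Cyc.map φ f) =
      ∑ i, polar Θ (φ (FreeAlgebra.ι ℂ i)) (φ (freePartial i f)) := by
  obtain ⟨a, rfl⟩ := tr_surjective f
  have h := polar_map hΘ φ a 1
  rw [map_one] at h
  simp only [Cyc.map_tr, cycDeriv_tr, h, freePartial_tr]

end DoubleDerivations

/-! ### Quadratic brackets -/

section Quadratic

variable {n : ℕ} [NeZero n] {R : Type*} [Ring R] [Algebra ℂ R]
  {c : ZMod n → ZMod n → ℂ} {x : ZMod n → R}

/-- The expression `∑ c_{i-j,r} tr(y_i x_{i-r} z_j ξ_{j+r})` defining the quadratic bracket; its two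
`x`-slots are kept apart because they are differentiated separately. -/
def quadForm (c : ZMod n → ZMod n → ℂ) (x ξ y z : ZMod n → R) : Cyc R :=
  ∑ i, ∑ j, ∑ r, c (i - j) r • tr (y i * x (i - r) * z j * ξ (j + r))

/-- The quadratic operator `z ↦ ∑ c_{i-j,r} x_{i-r} z_j x_{j+r}`: for `z_j = ∂g/∂x_j` it gives the
velocity of `x_i` along the Hamiltonian vector field of `g`. -/
def quadFlow (c : ZMod n → ZMod n → ℂ) (x z : ZMod n → R) (i : ZMod n) : R :=
  ∑ j, ∑ r, c (i - j) r • (x (i - r) * z j * x (j + r))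

theorem quadBracket_apply (p : ZMod n → Cyc R →ₗ[ℂ] R) (f g : Cyc R) :
    quadBracket c x p f g = quadForm c x x (fun i => p i f) (fun i => p i g) := by
  simp only [quadBracket, LinearMap.mk₂_apply, quadForm, map_sum, map_smul]

theorem quadForm_self (y z : ZMod n → R) :
    quadForm c x x y z = ∑ i, tr (y i * quadFlow c x z i) := by
  simp only [quadForm, quadFlow, Finset.mul_sum, map_sum, mul_smul_comm, map_smul, mul_assoc]

theorem quadForm_swap (hc : ∀ i r, c (-i) (-r) = -c i r) (x ξ y z : ZMod n → R) :
    quadForm c ξ x y z = -quadForm c x ξ z y := by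
  rw [quadForm, quadForm, Finset.sum_comm]
  simp only [← Finset.sum_neg_distrib]
  refine Finset.sum_congr rfl fun i _ => Finset.sum_congr rfl fun j _ =>
    Fintype.sum_equiv (Equiv.neg _) _ _ fun r => ?_
  have hodd := hc (i - j) (-r)
  rw [neg_sub, neg_neg] at hodd
  rw [Equiv.neg_apply, hodd, neg_smul, mul_assoc, tr_mul_comm, sub_neg_eq_add, ← sub_eq_add_neg,
    ← mul_assoc]

theorem quadForm_sub_mul (x ξ y z : ZMod n → R) (a : R) :
    quadForm c x (fun i => ξ i - a * x i) y z =
      quadForm c x ξ y z - quadForm c x x y fun i => z i * a := by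
  simp only [quadForm, mul_sub, map_sub, smul_sub, Finset.sum_sub_distrib, mul_assoc]

theorem IsDer.tr_quadForm {D : R →ₗ[ℂ] R} (hD : IsDer D) (y z : ZMod n → R) :
    tr (D (∑ i, ∑ j, ∑ r, c (i - j) r • (y i * x (i - r) * z j * x (j + r)))) =
      quadForm c x x (fun i => D (y i)) z + quadForm c x x y (fun i => D (z i)) +
        quadForm c x (fun i => D (x i)) y z + quadForm c (fun i => D (x i)) x y z := by
  simp only [quadForm, map_sum, map_smul, hD _ _, ← Finset.sum_add_distrib, ← smul_add, ← map_add]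
  refine Finset.sum_congr rfl fun i _ => Finset.sum_congr rfl fun j _ =>
    Finset.sum_congr rfl fun r _ => ?_
  congr 2
  noncomm_ring

/-- `D` is a derivation representing the Hamiltonian vector field of `g`. In homogeneous coordinates
`a = 0`; in an affine chart, where one coordinate is constant, the projective correction `-a x_i`
appears, and the Euler relation `∑ x_i p_i = 0` makes it invisible to functions. -/
structure IsHamiltonianDer (c : ZMod n → ZMod n → ℂ) (x : ZMod n → R)
    (p : ZMod n → Cyc R →ₗ[ℂ] R) (g : Cyc R) (D : R →ₗ[ℂ] R) (a : R) : Prop where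
  isDer : IsDer D
  apply_coord : ∀ i, D (x i) = quadFlow c x (fun j => p j g) i - a * x i
  euler : a = 0 ∨ ∀ f, ∑ i, x i * p i f = 0

/-- The quadratic bracket with coefficients `c` in the coordinates `x`, with partial derivatives
`p`, is antisymmetric and every function has a Hamiltonian vector field. -/
structure IsHamiltonian (c : ZMod n → ZMod n → ℂ) (x : ZMod n → R)
    (p : ZMod n → Cyc R →ₗ[ℂ] R) : Prop where
  odd : ∀ i r, c (-i) (-r) = -c i r
  chainRule : HasChainRule x p
  exists_hamiltonianDer : ∀ g, ∃ D a, IsHamiltonianDer c x p g D a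

variable {p : ZMod n → Cyc R →ₗ[ℂ] R} {f g h : Cyc R} {Df Dg Dh : R →ₗ[ℂ] R} {af ag ah : R}

theorem IsHamiltonianDer.sum_tr_mul_correction (hg : IsHamiltonianDer c x p g Dg ag)
    (hh : IsHamiltonianDer c x p h Dh ah) (f : Cyc R) :
    ∑ i, tr (Dh (p i f) * (ag * x i)) =
      -∑ i, tr (p i f * ag * quadFlow c x (fun j => p j h) i) := by
  rcases hg.euler with rfl | euler
  · simp
  have hdiff : ∑ i, (quadFlow c x (fun j => p j h) i * p i f + x i * Dh (p i f)) = 0 := by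
    have hD : ∑ i, Dh (x i * p i f) = 0 := by rw [← map_sum, euler f, map_zero]
    simp only [hh.isDer _ _, hh.apply_coord, sub_mul, mul_assoc, Finset.sum_add_distrib,
      Finset.sum_sub_distrib, ← Finset.mul_sum, euler f, mul_zero, sub_zero] at hD
    rw [Finset.sum_add_distrib, hD]
  have htr := congrArg (fun z => tr (ag * z)) hdiff
  simp only [Finset.mul_sum, map_sum, mul_add, map_add, Finset.sum_add_distrib, mul_zero,
    map_zero] at htr
  rw [eq_neg_iff_add_eq_zero, add_comm, ← htr]
  congr 1 <;> refine Finset.sum_congr rfl fun i _ => ?_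
  · rw [mul_assoc, tr_mul_comm, mul_assoc]
  · rw [tr_mul_comm, mul_assoc]

theorem IsHamiltonian.quadBracket_tr (H : IsHamiltonian c x p)
    (hg : IsHamiltonianDer c x p g Dg ag) (b : R) :
    quadBracket c x p (tr b) g = tr (Dg b) := by
  have hcorrection : ∑ i, tr (p i (tr b) * (ag * x i)) = 0 := by
    rcases hg.euler with rfl | euler
    · simp
    · calc ∑ i, tr (p i (tr b) * (ag * x i)) = tr (ag * ∑ i, x i * p i (tr b)) := by
            rw [Finset.mul_sum, map_sum]
            exact Finset.sum_congr rfl fun i _ => by rw [tr_mul_comm, mul_assoc]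
        _ = 0 := by rw [euler, mul_zero, map_zero]
  rw [quadBracket_apply, quadForm_self, H.chainRule Dg hg.isDer]
  simp only [hg.apply_coord, mul_sub, map_sub, Finset.sum_sub_distrib, hcorrection, sub_zero]

theorem IsHamiltonian.isNCBivector (H : IsHamiltonian c x p) :
    IsNCBivector (quadBracket c x p) := by
  have anti : ∀ f g, quadBracket c x p f g = -quadBracket c x p g f := fun f g => by
    rw [quadBracket_apply, quadBracket_apply, quadForm_swap H.odd]
  have left : ∀ g, IsNCVectorField ((quadBracket c x p).flip g) := fun g => by
    obtain ⟨D, a, hg⟩ := H.exists_hamiltonianDer g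
    exact ⟨D, hg.isDer, H.quadBracket_tr hg⟩
  refine ⟨anti, left, fun f => ?_⟩
  obtain ⟨D, hD, htr⟩ := left f
  refine ⟨-D, fun a b => ?_, fun a => ?_⟩
  · simp only [LinearMap.neg_apply, hD a b, neg_add, neg_mul, mul_neg]
  · rw [anti, LinearMap.neg_apply, map_neg, ← htr, LinearMap.flip_apply]

theorem IsHamiltonianDer.quadForm_apply (hg : IsHamiltonianDer c x p g Dg ag)
    (hh : IsHamiltonianDer c x p h Dh ah) (f : Cyc R) :
    quadForm c x x (fun i => Dh (p i f)) (fun i => p i g) =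
      ∑ i, tr (Dh (p i f) * Dg (x i)) -
        quadForm c x x (fun i => p i f * ag) (fun i => p i h) := by
  rw [quadForm_self, quadForm_self, sub_eq_add_neg, ← hg.sum_tr_mul_correction hh f,
    ← Finset.sum_add_distrib]
  refine Finset.sum_congr rfl fun i _ => ?_
  rw [← map_add, hg.apply_coord, ← mul_add, sub_add_cancel]

theorem IsHamiltonian.quadBracket_quadBracket (H : IsHamiltonian c x p)
    (hf : IsHamiltonianDer c x p f Df af) (hg : IsHamiltonianDer c x p g Dg ag)
    (hh : IsHamiltonianDer c x p h Dh ah) :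
    quadBracket c x p (quadBracket c x p f g) h =
      ∑ i, tr (Dh (p i f) * Dg (x i)) - ∑ i, tr (Dh (p i g) * Df (x i)) +
      quadForm c x (quadFlow c x fun i => p i h) (fun i => p i f) (fun i => p i g) -
      quadForm c x (quadFlow c x fun i => p i h) (fun i => p i g) (fun i => p i f) -
      quadForm c x x (fun i => p i f * ag) (fun i => p i h) +
      quadForm c x x (fun i => p i g * af) (fun i => p i h) +
      quadForm c x x (fun i => p i g * ah) (fun i => p i f) -
      quadForm c x x (fun i => p i f * ah) (fun i => p i g) := by
  have hrep : quadBracket c x p f g = tr (∑ i, ∑ j, ∑ r,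
    c (i - j) r • (p i f * x (i - r) * p j g * x (j + r))) := rfl
  rw [hrep, H.quadBracket_tr hh, hh.isDer.tr_quadForm,
    quadForm_swap H.odd x x (fun i => p i f) (fun i => Dh (p i g)),
    quadForm_swap H.odd x (fun i => Dh (x i)), hg.quadForm_apply hh, hf.quadForm_apply hh]
  simp only [hh.apply_coord, quadForm_sub_mul]
  rw [quadForm_swap H.odd x x (fun i => p i f) (fun i => p i g * ah),
    quadForm_swap H.odd x x (fun i => p i g) (fun i => p i f * ah)]
  abel

/-- The cyclic sum `{{f, g}, h} + {{g, h}, f} + {{h, f}, g}`, which vanishes exactly when the Jacobi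
identity holds. -/
def jacobiator (β : Cyc R →ₗ[ℂ] Cyc R →ₗ[ℂ] Cyc R) (f g h : Cyc R) : Cyc R :=
  β (β f g) h + β (β g h) f + β (β h f) g

/-- The cyclic sum of the forms in which a Hamiltonian vector field acts on a coordinate; this is
the part of the Jacobiator of a quadratic bracket without second derivatives. -/
def quadJacobiForm (c : ZMod n → ZMod n → ℂ) (x y z t : ZMod n → R) : Cyc R :=
  quadForm c x (quadFlow c x t) y z + quadForm c x (quadFlow c x y) z t +
    quadForm c x (quadFlow c x z) t y

theorem IsHamiltonian.jacobiator_eq (H : IsHamiltonian c x p) (f g h : Cyc R) :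
    jacobiator (quadBracket c x p) f g h =
      quadJacobiForm c x (fun i => p i f) (fun i => p i g) (fun i => p i h) -
      quadJacobiForm c x (fun i => p i g) (fun i => p i f) (fun i => p i h) := by
  obtain ⟨Df, af, hf⟩ := H.exists_hamiltonianDer f
  obtain ⟨Dg, ag, hg⟩ := H.exists_hamiltonianDer g
  obtain ⟨Dh, ah, hh⟩ := H.exists_hamiltonianDer h
  rw [jacobiator, H.quadBracket_quadBracket hf hg hh, H.quadBracket_quadBracket hg hh hf,
    H.quadBracket_quadBracket hh hf hg, H.chainRule.sum_second_derivative_comm hh.isDer hg.isDer f,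
    H.chainRule.sum_second_derivative_comm hh.isDer hf.isDer g,
    H.chainRule.sum_second_derivative_comm hf.isDer hg.isDer h, quadJacobiForm, quadJacobiForm]
  abel

end Quadratic

section Schouten

variable {R : Type*} [Ring R] [Algebra ℂ R]

theorem sum_perm_fin_three {M : Type*} [AddCommMonoid M] (F : Equiv.Perm (Fin 3) → M) :
    ∑ σ, F σ = F 1 + F (Equiv.swap 0 1) + F (Equiv.swap 0 2) + F (Equiv.swap 1 2) +
      F (Equiv.swap 0 1 * Equiv.swap 1 2) + F (Equiv.swap 1 2 * Equiv.swap 0 1) := by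
  have huniv : (Finset.univ : Finset (Equiv.Perm (Fin 3))) =
      {1, Equiv.swap 0 1, Equiv.swap 0 2, Equiv.swap 1 2, Equiv.swap 0 1 * Equiv.swap 1 2,
        Equiv.swap 1 2 * Equiv.swap 0 1} := by decide
  rw [huniv, Finset.sum_insert (by decide), Finset.sum_insert (by decide),
    Finset.sum_insert (by decide), Finset.sum_insert (by decide), Finset.sum_insert (by decide),
    Finset.sum_singleton]
  simp only [add_assoc]

theorem schouten_self_eq_jacobiator {β : Cyc R →ₗ[ℂ] Cyc R →ₗ[ℂ] Cyc R}
    (hβ : ∀ f g, β f g = -β g f) (v : Fin 3 → Cyc R) :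
    schouten β β v = (4 : ℂ) • jacobiator β (v 0) (v 1) (v 2) := by
  have hfix₂ : (Equiv.swap 0 1 : Equiv.Perm (Fin 3)) 2 = 2 := by decide
  have hfix₁ : (Equiv.swap 0 2 : Equiv.Perm (Fin 3)) 1 = 1 := by decide
  have hfix₀ : (Equiv.swap 1 2 : Equiv.Perm (Fin 3)) 0 = 0 := by decide
  have hsum : ∑ σ : Equiv.Perm (Fin 3),
      (Equiv.Perm.sign σ : ℤ) • β (β (v (σ 0)) (v (σ 1))) (v (σ 2)) =
        (2 : ℂ) • jacobiator β (v 0) (v 1) (v 2) := by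
    rw [sum_perm_fin_three]
    simp only [Equiv.Perm.sign_one, Equiv.Perm.sign_mul,
      Equiv.Perm.sign_swap (show (0 : Fin 3) ≠ 1 by decide),
      Equiv.Perm.sign_swap (show (0 : Fin 3) ≠ 2 by decide),
      Equiv.Perm.sign_swap (show (1 : Fin 3) ≠ 2 by decide), Equiv.Perm.one_apply,
      Equiv.Perm.mul_apply, Equiv.swap_apply_left, Equiv.swap_apply_right, hfix₀, hfix₁, hfix₂,
      Units.val_one, Units.val_neg, mul_neg, neg_neg, mul_one, one_smul, neg_smul, jacobiator]
    rw [hβ (v 1) (v 0), hβ (v 2) (v 1), hβ (v 0) (v 2)]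
    simp only [map_neg, LinearMap.neg_apply, neg_neg, two_smul]
    abel
  rw [schouten, hsum, ← add_smul]
  norm_num

end Schouten

/-! ### Reduction of the Jacobi identity to the Euler relations -/

section Euler

variable {n : ℕ} [NeZero n] {R : Type*} [Ring R] [Algebra ℂ R]
  {κ : ZMod n → ZMod n → ZMod n → ZMod n → ZMod n → ℂ}
  {c d e : ZMod n → ZMod n → ℂ} {x : ZMod n → R}

/-- The form `∑ κ_{i,j,l,u,v} tr(y_i x_{i-u} z_j x_{j-v} t_l x_{l+u+v})`, the shape of every term of
the Jacobi identity of a quadratic bracket. -/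
def triForm (κ : ZMod n → ZMod n → ZMod n → ZMod n → ZMod n → ℂ) (x y z t : ZMod n → R) : Cyc R :=
  ∑ i, ∑ j, ∑ l, ∑ u, ∑ v,
    κ i j l u v • tr (y i * x (i - u) * z j * x (j - v) * t l * x (l + (u + v)))

/-- The sum of a coefficient of `triForm` over the cyclic permutations of its three vectors. -/
def cycCoeff (κ : ZMod n → ZMod n → ZMod n → ZMod n → ZMod n → ℂ) (i j l u v : ZMod n) : ℂ :=
  κ i j l u v + κ j l i v (-u - v) + κ l i j (-u - v) u

theorem triForm_rotate (κ : ZMod n → ZMod n → ZMod n → ZMod n → ZMod n → ℂ)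
    (x y z t : ZMod n → R) :
    triForm κ x z t y = triForm (fun i j l u v => κ j l i v (-u - v)) x y z t := by
  simp only [triForm]
  rw [Finset.sum_congr rfl fun j _ => Finset.sum_comm, Finset.sum_comm]
  refine Finset.sum_congr rfl fun i _ => Finset.sum_congr rfl fun j _ =>
    Finset.sum_congr rfl fun l _ => ?_
  conv_rhs => rw [Finset.sum_comm]
  refine Finset.sum_congr rfl fun v _ => ?_
  refine (Fintype.sum_equiv (Equiv.subLeft (-v)) _ _ fun u => ?_).symm
  have hcyc := tr_mul_comm (y i * x (i - u)) (z j * x (j - v) * t l * x (l + (u + v)))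
  rw [Equiv.subLeft_apply, show v + (-v - u) = -u by ring, show -v - u = -u - v by ring,
    ← sub_eq_add_neg, show l - (-u - v) = l + (u + v) by ring]
  simp only [mul_assoc] at hcyc ⊢
  rw [hcyc]

theorem triForm_cyclic_sum (κ : ZMod n → ZMod n → ZMod n → ZMod n → ZMod n → ℂ)
    (x y z t : ZMod n → R) :
    triForm κ x y z t + triForm κ x z t y + triForm κ x t y z = triForm (cycCoeff κ) x y z t := by
  rw [triForm_rotate κ x y z t, triForm_rotate κ x z t y, triForm_rotate _ x y z t]
  simp only [triForm, cycCoeff, ← Finset.sum_add_distrib, ← add_smul,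
    show ∀ u v : ZMod n, -v - (-u - v) = u from fun u v => by ring]

/-- The coefficients of the terms `quadForm c x (quadFlow c x t) y z` of the Jacobi identity. -/
def jacobiCoeff (c : ZMod n → ZMod n → ℂ) (i j l u v : ZMod n) : ℂ :=
  c (i - j) u * c (j + u - l) (u + v)

theorem quadForm_quadFlow (x y z t : ZMod n → R) :
    quadForm c x (quadFlow c x t) y z = triForm (jacobiCoeff c) x y z t := by
  simp only [quadForm, quadFlow, triForm, Finset.mul_sum, map_sum, Finset.smul_sum]
  refine Finset.sum_congr rfl fun i _ => Finset.sum_congr rfl fun j _ => ?_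
  rw [Finset.sum_comm]
  refine Finset.sum_congr rfl fun l _ => Finset.sum_congr rfl fun u _ => ?_
  refine (Fintype.sum_equiv (Equiv.addLeft u) _ _ fun v => ?_).symm
  rw [Equiv.coe_addLeft, jacobiCoeff, mul_smul, mul_smul_comm, map_smul,
    show j + u - (u + v) = j - v by ring]
  simp only [mul_assoc]

/-- Coefficients for which `triForm` only involves `y` and `z` through the Euler expressions
`∑ y_i x_i` and `∑ x_i z_i`. -/
def eulerCoeff (d e : ZMod n → ZMod n → ℂ) (i j l u v : ZMod n) : ℂ :=
  atZero (i - j - u) * e (u + v) (j - v - l) - atZero u * d v (j - v - l)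

/-- The part of `eulerForm` that contains the Euler expression `∑ x_i z_i`, called `L` here. -/
def leftEulerForm (e : ZMod n → ZMod n → ℂ) (x y t : ZMod n → R) (L : R) : Cyc R :=
  ∑ l, ∑ b, ∑ a, e (a - l) (b - l) • tr (y (b + a - l) * L * x b * t l * x a)

/-- The part of `eulerForm` that contains the Euler expression `∑ y_i x_i`, called `E` here. -/
def rightEulerForm (d : ZMod n → ZMod n → ℂ) (x z t : ZMod n → R) (E : R) : Cyc R :=
  ∑ j, ∑ l, ∑ v, d v (j - v - l) • tr (E * z j * x (j - v) * t l * x (l + v))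

theorem triForm_left (x y z t : ZMod n → R) :
    triForm (fun i j l u v => atZero (i - j - u) * e (u + v) (j - v - l)) x y z t =
      leftEulerForm e x y t (∑ i, x i * z i) := by
  have hdelta : ∀ i j l : ZMod n, ∑ u, ∑ v, (atZero (i - j - u) * e (u + v) (j - v - l)) •
      tr (y i * x (i - u) * z j * x (j - v) * t l * x (l + (u + v))) =
      ∑ b, e (i - b) (b - l) • tr (y i * x j * z j * x b * t l * x (l + (i - b))) := by
    intro i j l
    rw [Finset.sum_eq_single (i - j) (fun u _ hu => by simp [atZero, sub_eq_zero, Ne.symm hu])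
      (by simp)]
    refine Fintype.sum_equiv (Equiv.subLeft j) _ _ fun v => ?_
    rw [Equiv.subLeft_apply, show i - (j - v) = i - j + v by ring]
    simp [atZero]
  have hsum : ∀ i, ∑ j, ∑ l, ∑ b, e (i - b) (b - l) •
      tr (y i * x j * z j * x b * t l * x (l + (i - b))) =
      ∑ l, ∑ b, e (i - b) (b - l) •
        tr (y i * (∑ j, x j * z j) * x b * t l * x (l + (i - b))) := by
    intro i
    simp only [Finset.mul_sum, Finset.sum_mul, map_sum, Finset.smul_sum]
    rw [Finset.sum_comm]
    refine Finset.sum_congr rfl fun l _ => ?_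
    rw [Finset.sum_comm]
    simp only [mul_assoc]
  simp only [triForm, leftEulerForm, hdelta, hsum]
  rw [Finset.sum_comm]
  refine Finset.sum_congr rfl fun l _ => ?_
  rw [Finset.sum_comm]
  refine Finset.sum_congr rfl fun b _ => ?_
  refine Fintype.sum_equiv (Equiv.addRight (l - b)) _ _ fun i => ?_
  simp only [Equiv.coe_addRight]
  rw [show b + (i + (l - b)) - l = i by ring,
    show i + (l - b) - l = i - b by ring, show i + (l - b) = l + (i - b) by ring]

theorem triForm_right (x y z t : ZMod n → R) :
    triForm (fun _ j l u v => atZero u * d v (j - v - l)) x y z t =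
      rightEulerForm d x z t (∑ i, y i * x i) := by
  have hdelta : ∀ i j l : ZMod n, ∑ u, ∑ v, (atZero u * d v (j - v - l)) •
      tr (y i * x (i - u) * z j * x (j - v) * t l * x (l + (u + v))) =
      ∑ v, d v (j - v - l) • tr (y i * x i * z j * x (j - v) * t l * x (l + v)) := by
    intro i j l
    rw [Finset.sum_eq_single 0 (fun u _ hu => by simp [atZero, hu]) (by simp)]
    simp [atZero]
  simp only [triForm, rightEulerForm, hdelta, Finset.sum_mul, map_sum, Finset.smul_sum]
  rw [Finset.sum_comm]
  refine Finset.sum_congr rfl fun j _ => ?_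
  rw [Finset.sum_comm]
  exact Finset.sum_congr rfl fun l _ => Finset.sum_comm

/-- The trilinear expressions that contain an Euler expression: `L` stands for `∑ x_i z_i` and `E`
for `∑ y_i x_i`. -/
def eulerForm (d e : ZMod n → ZMod n → ℂ) (x y z t : ZMod n → R) (L E : R) : Cyc R :=
  leftEulerForm e x y t L - rightEulerForm d x z t E

theorem triForm_eulerCoeff (x y z t : ZMod n → R) :
    triForm (eulerCoeff d e) x y z t =
      eulerForm d e x y z t (∑ i, x i * z i) (∑ i, y i * x i) := by
  rw [eulerForm, ← triForm_left, ← triForm_right]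
  simp only [triForm, eulerCoeff, sub_smul, Finset.sum_sub_distrib]

/-- The cyclic sum of `eulerForm` over the three vectors `y`, `z`, `t`. -/
def cycEulerForm (d e : ZMod n → ZMod n → ℂ) (x y z t : ZMod n → R) : Cyc R :=
  eulerForm d e x y z t (∑ i, x i * z i) (∑ i, y i * x i) +
  eulerForm d e x z t y (∑ i, x i * t i) (∑ i, z i * x i) +
  eulerForm d e x t y z (∑ i, x i * y i) (∑ i, t i * x i)

theorem quadJacobiForm_eq_cycEulerForm
    (hcoeff : ∀ i j l u v,
      cycCoeff (jacobiCoeff c) i j l u v = cycCoeff (eulerCoeff d e) i j l u v)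
    (x y z t : ZMod n → R) : quadJacobiForm c x y z t = cycEulerForm d e x y z t := by
  rw [quadJacobiForm, quadForm_quadFlow, quadForm_quadFlow, quadForm_quadFlow, triForm_cyclic_sum,
    cycEulerForm, ← triForm_eulerCoeff, ← triForm_eulerCoeff, ← triForm_eulerCoeff,
    triForm_cyclic_sum]
  simp only [triForm, hcoeff]

end Euler

/-! ### The elliptic coefficients -/

section EllipticCoefficients

variable (n : ℕ) {k : ℕ} {τ : ℂ}

theorem natCast_mul_eq_zero_iff_of_coprime (hk : Nat.Coprime k n) (r : ZMod n) :
    (k : ZMod n) * r = 0 ↔ r = 0 :=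
  ((ZMod.isUnit_iff_coprime k n).2 hk).mul_right_eq_zero

theorem ellCoeff_eq_kronConst (hk : Nat.Coprime k n) (i r : ZMod n) :
    ellCoeff n k τ i r = kronConst n τ (k * r) (i - r) := by
  rw [ellCoeff, kronConst, show (k : ZMod n) * r + (i - r) = i + r * (k - 1) by ring]
  simp only [natCast_mul_eq_zero_iff_of_coprime n hk]
  rcases eq_or_ne r 0 with rfl | hr
  · simp
  · rcases eq_or_ne r i with rfl | hi
    · simp [hr]
    · simp [hr, hi, sub_eq_zero, hi.symm]

variable [NeZero n]

theorem ellCoeff_neg (hk : Nat.Coprime k n) (hτ : 0 < τ.im) (i r : ZMod n) :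
    ellCoeff n k τ (-i) (-r) = -ellCoeff n k τ i r := by
  rw [ellCoeff_eq_kronConst n hk, ellCoeff_eq_kronConst n hk, ← kronConst_neg n hτ]
  congr 1 <;> ring

/-- The coefficients of the right Euler expressions in the Jacobi identity for `ellCoeff`. -/
def rightEulerCoeff (k : ℕ) (τ : ℂ) (u t : ZMod n) : ℂ := kronDeriv n τ (k * u) t

/-- The coefficients of the left Euler expressions in the Jacobi identity for `ellCoeff`. -/
def leftEulerCoeff (k : ℕ) (τ : ℂ) (u t : ZMod n) : ℂ := kronDeriv n τ t (k * u)

theorem rightEulerCoeff_neg (hτ : 0 < τ.im) (u t : ZMod n) :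
    rightEulerCoeff n k τ (-u) (-t) = rightEulerCoeff n k τ u t := by
  rw [rightEulerCoeff, rightEulerCoeff, ← kronDeriv_neg n hτ, mul_neg, neg_neg, neg_neg]

theorem leftEulerCoeff_neg (hτ : 0 < τ.im) (u t : ZMod n) :
    leftEulerCoeff n k τ (-u) (-t) = leftEulerCoeff n k τ u t := by
  rw [leftEulerCoeff, leftEulerCoeff, ← kronDeriv_neg n hτ, mul_neg, neg_neg, neg_neg]

theorem cycCoeff_ellCoeff (hk : Nat.Coprime k n) (hτ : 0 < τ.im) (i j l u v : ZMod n) :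
    cycCoeff (jacobiCoeff (ellCoeff n k τ)) i j l u v =
      cycCoeff (eulerCoeff (rightEulerCoeff n k τ) (leftEulerCoeff n k τ)) i j l u v := by
  have hYB := kronConst_yang_baxter n hτ (X := k * u) (Y := k * v) (Z := k * (-u - v))
    (P := i - j - u) (Q := j - l - v) (S := l - i - (-u - v)) (by ring) (by ring)
  simp only [cycCoeff, jacobiCoeff, eulerCoeff, ellCoeff_eq_kronConst n hk, rightEulerCoeff,
    leftEulerCoeff]
  simp only [atZero, natCast_mul_eq_zero_iff_of_coprime n hk, ← mul_neg] at hYB ⊢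
  rw [show -(-u - v) = u + v by ring] at hYB
  rw [show j + u - l - (u + v) = j - l - v by ring, show v + (-u - v) = -u by ring,
    show l + v - i - -u = l - i - (-u - v) by ring, show -u - v + u = -v by ring,
    show i + (-u - v) - j - -v = i - j - u by ring, show j - v - l = j - l - v by ring,
    show l - (-u - v) - i = l - i - (-u - v) by ring, show i - u - j = i - j - u by ring, hYB]
  ring

end EllipticCoefficients

/-! ### Brackets on a free algebra and in affine charts -/

section Affine

variable {n : ℕ} [NeZero n] {R S : Type*} [Ring R] [Algebra ℂ R] [Ring S] [Algebra ℂ S]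
  {c d e : ZMod n → ZMod n → ℂ}

theorem isHamiltonian_freeAlgebra (hc : ∀ i r, c (-i) (-r) = -c i r) :
    IsHamiltonian c (FreeAlgebra.ι ℂ) (freePartial (X := ZMod n)) where
  odd := hc
  chainRule := isCoordinates_freeAlgebra.hasChainRule
  exists_hamiltonianDer g := by
    obtain ⟨D, hD, hcoord, -⟩ := (isCoordinates_freeAlgebra (X := ZMod n)).exists_derivation
      (quadFlow c (FreeAlgebra.ι ℂ) fun j => freePartial j g)
    exact ⟨D, 0, hD, fun i => by rw [hcoord, zero_mul, sub_zero], .inl rfl⟩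

theorem eulerForm_zero (x y z t : ZMod n → R) : eulerForm d e x y z t 0 0 = 0 := by
  simp [eulerForm, leftEulerForm, rightEulerForm]

theorem IsHamiltonian.isNCPoisson {x : ZMod n → R} {p : ZMod n → Cyc R →ₗ[ℂ] R}
    (H : IsHamiltonian c x p)
    (hcoeff : ∀ i j l u v,
      cycCoeff (jacobiCoeff c) i j l u v = cycCoeff (eulerCoeff d e) i j l u v)
    (hleft : ∀ f, ∑ i, x i * p i f = 0) (hright : ∀ f, ∑ i, p i f * x i = 0) :
    IsNCPoisson (quadBracket c x p) := by
  refine ⟨H.isNCBivector, fun v => ?_⟩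
  rw [schouten_self_eq_jacobiator H.isNCBivector.antisymm, H.jacobiator_eq,
    quadJacobiForm_eq_cycEulerForm hcoeff, quadJacobiForm_eq_cycEulerForm hcoeff]
  simp only [cycEulerForm, hleft, hright, eulerForm_zero, add_zero, sub_zero, smul_zero]

/-- The partial derivatives with respect to homogeneous coordinates `u_i` normalized by `u_j = 1`,
given the partial derivatives `P` with respect to the affine coordinates `u_i`, `i ≠ j`: the one
with respect to `u_j` is determined by the Euler relation. -/
def homPartial (j : ZMod n) (u : ZMod n → R) (P : {i : ZMod n // i ≠ j} → Cyc R →ₗ[ℂ] R)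
    (i : ZMod n) : Cyc R →ₗ[ℂ] R :=
  if h : i = j then -∑ i' : {i : ZMod n // i ≠ j}, LinearMap.mulLeft ℂ (u i') ∘ₗ P i' else P ⟨i, h⟩

variable {j : ZMod n} {u : ZMod n → R}

section

variable {P : {i : ZMod n // i ≠ j} → Cyc R →ₗ[ℂ] R}

theorem homPartial_coe (i : {i : ZMod n // i ≠ j}) : homPartial j u P i = P i := dif_neg i.2

theorem homPartial_self (f : Cyc R) :
    homPartial j u P j f = -∑ i : {i : ZMod n // i ≠ j}, u i * P i f := by
  simp [homPartial]

theorem sum_mul_homPartial (hu : u j = 1) (f : Cyc R) : ∑ i, u i * homPartial j u P i f = 0 := by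
  rw [Fintype.sum_eq_add_sum_subtype_ne _ j, homPartial_self, hu, one_mul]
  simp only [homPartial_coe, neg_add_cancel]

end

variable {Ψ : {i : ZMod n // i ≠ j} → R →ₐ[ℂ] Matrix (Fin 2) (Fin 2) (R ⊗[ℂ] R)}

theorem sum_homPartial_mul (hu : u j = 1)
    (h : IsCoordinates (fun i : {i : ZMod n // i ≠ j} => u i) Ψ) (f : Cyc R) :
    ∑ i, homPartial j u h.partialDeriv i f * u i = 0 := by
  rw [Fintype.sum_eq_add_sum_subtype_ne _ j, homPartial_self, hu, mul_one]
  simp only [homPartial_coe]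
  rw [neg_add_eq_sub, ← Finset.sum_sub_distrib]
  exact h.sum_commutator_partialDeriv f

theorem isHamiltonian_homPartial (hc : ∀ i r, c (-i) (-r) = -c i r) (hu : u j = 1)
    (h : IsCoordinates (fun i : {i : ZMod n // i ≠ j} => u i) Ψ) :
    IsHamiltonian c u (homPartial j u h.partialDeriv) where
  odd := hc
  chainRule D hD a := by
    rw [h.hasChainRule D hD, Fintype.sum_eq_add_sum_subtype_ne _ j, hu, hD.map_one, mul_zero,
      map_zero, zero_add]
    simp only [homPartial_coe]
  exists_hamiltonianDer g := by
    set z := quadFlow c u fun i => homPartial j u h.partialDeriv i g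
    obtain ⟨D, hD, hcoord, -⟩ := h.exists_derivation fun i => z i - z j * u i
    refine ⟨D, z j, hD, fun i => ?_, .inr (sum_mul_homPartial hu)⟩
    rcases eq_or_ne i j with rfl | hi
    · rw [hu, hD.map_one, mul_one, sub_self]
    · exact hcoord ⟨i, hi⟩

theorem isNCPoisson_homPartial (hc : ∀ i r, c (-i) (-r) = -c i r)
    (hcoeff : ∀ i j l u v,
      cycCoeff (jacobiCoeff c) i j l u v = cycCoeff (eulerCoeff d e) i j l u v)
    (hu : u j = 1) (h : IsCoordinates (fun i : {i : ZMod n // i ≠ j} => u i) Ψ) :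
    IsNCPoisson (quadBracket c u (homPartial j u h.partialDeriv)) :=
  (isHamiltonian_homPartial hc hu h).isNCPoisson hcoeff (sum_mul_homPartial hu)
    (sum_homPartial_mul hu h)

theorem quadBracket_map (φ : R →ₐ[ℂ] S) {x : ZMod n → R} {y : ZMod n → S}
    {p : ZMod n → Cyc R →ₗ[ℂ] R} {q : ZMod n → Cyc S →ₗ[ℂ] S} {a : S}
    (hx : ∀ i, φ (x i) = a * y i) (hp : ∀ i f, q i (Cyc.map φ f) = φ (p i f) * a) (f g : Cyc R) :
    quadBracket c y q (Cyc.map φ f) (Cyc.map φ g) = Cyc.map φ (quadBracket c x p f g) := by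
  rw [quadBracket_apply, quadBracket_apply, quadForm, quadForm]
  simp only [map_sum, map_smul, Cyc.map_tr, map_mul, hx, hp, mul_assoc]

end Affine

/-! ### Homogeneity -/

section Homogeneity

section Laurent

variable {X : Type*} [DecidableEq X]

theorem lauDD_lx (i j : X) : lauDD i (lx j) 0 1 = if j = i then 1 else 0 := by
  simp [lauDD, lauUnit]

theorem lauDD_lxInv (i j : X) :
    lauDD i (lxInv j) 0 1 = if j = i then (-lxInv j) ⊗ₜ[ℂ] lxInv j else 0 := by
  simp [lauDD, lauUnit]

theorem polar_lauDD_lx (i j : X) (w : Laurent X) :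
    polar (lauDD i) (lx j) w = if j = i then w else 0 := by
  rw [polar_apply, lauDD_lx]
  split_ifs <;> simp

theorem polar_lauDD_lxInv (i j : X) (w : Laurent X) :
    polar (lauDD i) (lxInv j) w = if j = i then -(lxInv j * w * lxInv j) else 0 := by
  rw [polar_apply, lauDD_lxInv]
  split_ifs <;> simp

end Laurent

theorem dilate_inclA_ι (n : ℕ) (i : ZMod n) :
    (dilate n).comp (inclA n) (FreeAlgebra.ι ℂ i) = lx none * lx (some i) := by
  rw [← map_mul]
  simp [dilate, inclA]

variable (n : ℕ) [NeZero n]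

theorem lauPartial_dilate (i : ZMod n) (f : Cyc (Aff n)) :
    lauPartial (some i) (Cyc.map ((dilate n).comp (inclA n)) f) =
      (dilate n).comp (inclA n) (freePartial i f) * lx none := by
  rw [lauPartial, cycDeriv_map]
  simp only [dilate_inclA_ι, polar_mul (isDoubleDer_lauDD _), polar_lauDD_lx]
  simp [-MonoidAlgebra.of_apply]

theorem ellNu_homogeneous (k : ℕ) (τ : ℂ) (f g : Aff n) :
    ellNuA n k τ (tr (dilate n (inclA n f))) (tr (dilate n (inclA n g))) =
      Cyc.map (dilate n) (Cyc.map (inclA n) (ellNu n k τ (tr f) (tr g))) := by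
  rw [← Cyc.map_comp]
  exact quadBracket_map ((dilate n).comp (inclA n)) (dilate_inclA_ι n) (lauPartial_dilate n)
    (tr f) (tr g)

end Homogeneity

/-! ### Charts and overlaps -/

section Overlap

section

variable {R : Type*} [Ring R] [Algebra ℂ R] {u w : R} (p : Prop) [Decidable p]

theorem upperTriangular_mul_inv (h : u * w = 1) :
    !![u ⊗ₜ[ℂ] 1, if p then 1 else 0; 0, 1 ⊗ₜ[ℂ] u] *
      !![w ⊗ₜ[ℂ] 1, if p then -(w ⊗ₜ[ℂ] w) else 0; 0, 1 ⊗ₜ[ℂ] w] = 1 := by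
  rw [Matrix.mul_fin_two, Matrix.one_fin_two]
  split_ifs <;> simp [h, Algebra.TensorProduct.one_def]

theorem upperTriangular_inv_mul (h : w * u = 1) :
    !![w ⊗ₜ[ℂ] 1, if p then -(w ⊗ₜ[ℂ] w) else 0; 0, 1 ⊗ₜ[ℂ] w] *
      !![u ⊗ₜ[ℂ] 1, if p then 1 else 0; 0, 1 ⊗ₜ[ℂ] u] = 1 := by
  rw [Matrix.mul_fin_two, Matrix.one_fin_two]
  split_ifs <;> simp [h, Algebra.TensorProduct.one_def]

end

variable {n : ℕ} {j k : ZMod n} (h : k ≠ j)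

theorem ovU_self : ovU n j k h j = 1 := dif_pos rfl

theorem ovU_coe (i : {i : ZMod n // i ≠ j}) : ovU n j k h i =
    RingQuot.mkAlgHom ℂ (OverlapRel n j k h) (FreeAlgebra.ι ℂ (some i)) := dif_neg i.2

theorem ovU_mul_ovInv : ovU n j k h k * ovInv n j k h = 1 := by
  rw [ovU_coe h ⟨k, h⟩, ovInv, ← map_mul, ← map_one (RingQuot.mkAlgHom ℂ (OverlapRel n j k h))]
  exact RingQuot.mkAlgHom_rel ℂ .mul_inv

theorem ovInv_mul_ovU : ovInv n j k h * ovU n j k h k = 1 := by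
  rw [ovU_coe h ⟨k, h⟩, ovInv, ← map_mul, ← map_one (RingQuot.mkAlgHom ℂ (OverlapRel n j k h))]
  exact RingQuot.mkAlgHom_rel ℂ .inv_mul

/-- The values on the generators of the homomorphism `a ↦ !![a ⊗ 1, Δ a; 0, 1 ⊗ a]` of the overlap,
where `Δ` is the double derivation with respect to the coordinate `u_i`. -/
def ovMatrix (i : {i : ZMod n // i ≠ j}) : Option {i : ZMod n // i ≠ j} →
    Matrix (Fin 2) (Fin 2) (Overlap n j k h ⊗[ℂ] Overlap n j k h)
  | some i' => !![ovU n j k h i' ⊗ₜ[ℂ] 1, if i' = i then 1 else 0; 0, 1 ⊗ₜ[ℂ] ovU n j k h i']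
  | none => !![ovInv n j k h ⊗ₜ[ℂ] 1,
      if ⟨k, h⟩ = i then -(ovInv n j k h ⊗ₜ[ℂ] ovInv n j k h) else 0; 0, 1 ⊗ₜ[ℂ] ovInv n j k h]

/-- The double derivation with respect to the coordinate `u_i` of the overlap. -/
def ovDD (i : {i : ZMod n // i ≠ j}) : Overlap n j k h →ₐ[ℂ]
    Matrix (Fin 2) (Fin 2) (Overlap n j k h ⊗[ℂ] Overlap n j k h) :=
  RingQuot.liftAlgHom ℂ ⟨FreeAlgebra.lift ℂ (ovMatrix h i), by
    rintro _ _ (_ | _) <;>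
      rw [map_mul, map_one, FreeAlgebra.lift_ι_apply, FreeAlgebra.lift_ι_apply]
    · exact upperTriangular_mul_inv _ (ovU_mul_ovInv h)
    · exact upperTriangular_inv_mul _ (ovInv_mul_ovU h)⟩

theorem ovDD_mkAlgHom (i : {i : ZMod n // i ≠ j})
    (a : FreeAlgebra ℂ (Option {i : ZMod n // i ≠ j})) :
    ovDD h i (RingQuot.mkAlgHom ℂ _ a) = FreeAlgebra.lift ℂ (ovMatrix h i) a :=
  RingQuot.liftAlgHom_mkAlgHom_apply ℂ _ _ _

theorem ovDD_ovU (i i' : {i : ZMod n // i ≠ j}) :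
    ovDD h i (ovU n j k h i') = ovMatrix h i (some i') := by
  rw [ovU_coe, ovDD_mkAlgHom, FreeAlgebra.lift_ι_apply]

theorem ovDD_ovInv (i : {i : ZMod n // i ≠ j}) : ovDD h i (ovInv n j k h) = ovMatrix h i none := by
  rw [ovInv, ovDD_mkAlgHom, FreeAlgebra.lift_ι_apply]

theorem isDoubleDer_ovDD (i : {i : ZMod n // i ≠ j}) : IsDoubleDer (ovDD h i) := by
  intro f
  obtain ⟨a, rfl⟩ := RingQuot.mkAlgHom_surjective ℂ _ f
  induction a using FreeAlgebra.induction with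
  | grade0 r =>
    simp [Algebra.algebraMap_eq_smul_one, Algebra.TensorProduct.one_def, TensorProduct.smul_tmul']
  | grade1 x =>
    cases x with
    | none => rw [← ovInv, ovDD_ovInv]; simp [ovMatrix]
    | some i' => rw [← ovU_coe, ovDD_ovU]; simp [ovMatrix]
  | mul a b ha hb =>
    simp [Matrix.mul_apply, Fin.sum_univ_two, ha.1, ha.2.1, ha.2.2, hb.1, hb.2.1, hb.2.2]
  | add a b ha hb =>
    simp [ha.1, ha.2.1, ha.2.2, hb.1, hb.2.1, hb.2.2, TensorProduct.add_tmul,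
      TensorProduct.tmul_add]

theorem polar_ovDD_ovInv (i : {i : ZMod n // i ≠ j}) (z : Overlap n j k h) :
    polar (ovDD h i) (ovInv n j k h) z =
      if k = i then -(ovInv n j k h * z * ovInv n j k h) else 0 := by
  rw [polar_apply, ovDD_ovInv, ovMatrix]
  simp only [Subtype.ext_iff]
  split_ifs <;> simp

theorem isCoordinates_overlap :
    IsCoordinates (fun i : {i : ZMod n // i ≠ j} => ovU n j k h i) (ovDD h) where
  doubleDer := isDoubleDer_ovDD h
  apply_coord i i' := by rw [ovDD_ovU]; simp [ovMatrix]
  generate A hA hinv := by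
    have hle : (⊤ : Subalgebra ℂ (FreeAlgebra ℂ (Option {i : ZMod n // i ≠ j}))) ≤
        A.comap (RingQuot.mkAlgHom ℂ (OverlapRel n j k h)) := by
      rw [← FreeAlgebra.adjoin_range_ι]
      refine Algebra.adjoin_le (Set.range_subset_iff.2 fun o => ?_)
      cases o with
      | some i =>
        rw [SetLike.mem_coe, Subalgebra.mem_comap, ← ovU_coe]
        exact hA i
      | none => exact hinv _ _ (hA ⟨k, h⟩) (ovU_mul_ovInv h) (ovInv_mul_ovU h)
    rw [← top_le_iff]
    intro f _
    obtain ⟨a, rfl⟩ := RingQuot.mkAlgHom_surjective ℂ _ f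
    exact hle Algebra.mem_top

end Overlap

section Charts

/-- The homogeneous coordinates on a chart: `u_{i,j}` for `i ≠ j`, and `u_{j,j} = 1`. -/
def chartU (n : ℕ) (j i : ZMod n) : Chart n j := if h : i = j then 1 else FreeAlgebra.ι ℂ ⟨i, h⟩

variable {n : ℕ}

theorem chartU_self (j : ZMod n) : chartU n j j = 1 := dif_pos rfl

theorem chartU_coe (j : ZMod n) (i : {i : ZMod n // i ≠ j}) : chartU n j i = FreeAlgebra.ι ℂ i :=
  dif_neg i.2

theorem isCoordinates_chart (j : ZMod n) :
    IsCoordinates (fun i : {i : ZMod n // i ≠ j} => chartU n j i) freeDD := by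
  simpa only [chartU_coe] using isCoordinates_freeAlgebra (X := {i : ZMod n // i ≠ j})

theorem map_chartU {S : Type*} [Ring S] [Algebra ℂ S] {j : ZMod n} {φ : Chart n j →ₐ[ℂ] S}
    {v : ZMod n → S} (hself : v j = 1) (hcoe : ∀ i : {i : ZMod n // i ≠ j}, φ (.ι ℂ i) = v i)
    (i : ZMod n) : φ (chartU n j i) = v i := by
  rcases eq_or_ne i j with rfl | hi
  · rw [chartU_self, map_one, hself]
  · rw [chartU_coe j ⟨i, hi⟩, hcoe]

theorem chartEmb_chartU (j i : ZMod n) : chartEmb n j (chartU n j i) = lxInv j * lx i :=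
  map_chartU (v := fun i => lxInv j * lx i)
    (by rw [← map_mul, inv_mul_cancel, map_one]) (fun i => FreeAlgebra.lift_ι_apply _ i) i

theorem resFst_chartU {j k : ZMod n} (h : k ≠ j) (i : ZMod n) :
    resFst n j k h (chartU n j i) = 1 * ovU n j k h i := by
  rw [one_mul]
  exact map_chartU (ovU_self h) (fun i => FreeAlgebra.lift_ι_apply _ i) i

theorem resSnd_chartU {j k : ZMod n} (h : k ≠ j) (i : ZMod n) :
    resSnd n j k h (chartU n k i) = ovInv n j k h * ovU n j k h i :=
  map_chartU (v := fun i => ovInv n j k h * ovU n j k h i) (ovInv_mul_ovU h)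
    (fun i => FreeAlgebra.lift_ι_apply _ i) i

section

variable {S : Type*} [Ring S]

theorem eq_of_sum_mul_eq {ι : Type*} [Fintype ι] {j : ι} {u a b : ι → S}
    (hu : u j = 1) (hsum : ∑ i, u i * a i = ∑ i, u i * b i)
    (hab : ∀ i : {i : ι // i ≠ j}, a i = b i) : a = b := by
  classical
  funext i
  rcases eq_or_ne i j with rfl | hi
  · simpa only [Fintype.sum_eq_add_sum_subtype_ne _ i, hab, hu, one_mul, add_left_inj] using hsum
  · exact hab ⟨i, hi⟩

theorem polar_homCoord [Algebra ℂ S] {j : ZMod n} {u : ZMod n → S}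
    {Ψ : {i : ZMod n // i ≠ j} → S →ₐ[ℂ] Matrix (Fin 2) (Fin 2) (S ⊗[ℂ] S)}
    (h : IsCoordinates (fun i : {i : ZMod n // i ≠ j} => u i) Ψ) (hu : u j = 1)
    (i : {i : ZMod n // i ≠ j}) (i' : ZMod n) (z : S) :
    polar (Ψ i) (u i') z = if i' = i then z else 0 := by
  rcases eq_or_ne i' j with rfl | hi
  · rw [hu, polar_one, if_neg i.2.symm, LinearMap.zero_apply]
  · rw [polar_apply, h.apply_coord i ⟨i', hi⟩]
    simp only [Subtype.ext_iff]
    split_ifs <;> simp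

end

variable [NeZero n] {S : Type*} [Ring S] [Algebra ℂ S] {j k : ZMod n}

/-- The partial derivatives with respect to the homogeneous coordinates on a chart. -/
def chartPartial (n : ℕ) [NeZero n] (j : ZMod n) : ZMod n → Cyc (Chart n j) →ₗ[ℂ] Chart n j :=
  homPartial j (chartU n j) freePartial

/-- The nonabelian Poisson structure on a chart. -/
def chartBracket (n : ℕ) [NeZero n] (k : ℕ) (τ : ℂ) (j : ZMod n) :
    Cyc (Chart n j) →ₗ[ℂ] Cyc (Chart n j) →ₗ[ℂ] Cyc (Chart n j) :=
  quadBracket (ellCoeff n k τ) (chartU n j) (chartPartial n j)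

/-- `w` plays the role of the inverse of the homogeneous coordinate `v k`, whence the hypothesis
on its derivative. -/
theorem cycDeriv_map_chart {Θ : S →ₐ[ℂ] Matrix (Fin 2) (Fin 2) (S ⊗[ℂ] S)} (hΘ : IsDoubleDer Θ)
    {φ : Chart n k →ₐ[ℂ] S} {v : ZMod n → S} {w : S} (hφ : ∀ i, φ (chartU n k i) = w * v i)
    {i : ZMod n} (hv : ∀ i' z, polar Θ (v i') z = if i' = i then z else 0)
    (hw : ∀ z, polar Θ w z = if k = i then -(w * z * w) else 0) (f : Cyc (Chart n k)) :
    cycDeriv Θ hΘ (Cyc.map φ f) = φ (chartPartial n k i f) * w := by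
  simp only [cycDeriv_map, ← chartU_coe, hφ, polar_mul hΘ, hv, hw, chartPartial]
  rcases eq_or_ne i k with rfl | hi
  · have hne (i' : {i' : ZMod n // i' ≠ i}) : ((i' : ZMod n) = i) = False := eq_false i'.2
    simp only [if_true, hne, if_false, add_zero, homPartial_self, map_neg, map_sum, map_mul, hφ,
      neg_mul, Finset.sum_mul, Finset.sum_neg_distrib, mul_assoc]
  · lift i to {i : ZMod n // i ≠ k} using hi
    simp only [if_neg i.2.symm, zero_add, homPartial_coe, ← Subtype.ext_iff, Finset.sum_ite_eq',
      Finset.mem_univ, if_true]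

theorem homPartial_map_chart {u : ZMod n → S}
    {Ψ : {i : ZMod n // i ≠ j} → S →ₐ[ℂ] Matrix (Fin 2) (Fin 2) (S ⊗[ℂ] S)}
    (h : IsCoordinates (fun i : {i : ZMod n // i ≠ j} => u i) Ψ) (hu : u j = 1)
    {φ : Chart n k →ₐ[ℂ] S} {w w' : S} (hφ : ∀ i, φ (chartU n k i) = w * u i) (hw' : w' * w = 1)
    (hw : ∀ (i : {i : ZMod n // i ≠ j}) z, polar (Ψ i) w z = if k = i then -(w * z * w) else 0)
    (i : ZMod n) (f : Cyc (Chart n k)) :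
    homPartial j u h.partialDeriv i (Cyc.map φ f) = φ (chartPartial n k i f) * w := by
  refine congrFun (eq_of_sum_mul_eq (a := fun i => homPartial j u h.partialDeriv i (Cyc.map φ f))
    (b := fun i => φ (chartPartial n k i f) * w) hu ?_ fun i => ?_) i
  · have heuler : ∑ i, w * u i * φ (chartPartial n k i f) = 0 := by
      simp only [← hφ, ← map_mul, ← map_sum]
      exact (congrArg φ (sum_mul_homPartial (chartU_self k) f)).trans (map_zero φ)
    calc ∑ i, u i * homPartial j u h.partialDeriv i (Cyc.map φ f)
        = w' * (∑ i, w * u i * φ (chartPartial n k i f)) * w := by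
          rw [sum_mul_homPartial hu, heuler, mul_zero, zero_mul]
      _ = ∑ i, u i * (φ (chartPartial n k i f) * w) := by
          simp only [Finset.mul_sum, Finset.sum_mul, ← mul_assoc, hw', one_mul]
  · rw [homPartial_coe]
    exact cycDeriv_map_chart (h.doubleDer i) hφ (polar_homCoord h hu i) (hw i) f

theorem lauPartial_chartEmb (j i : ZMod n) (f : Cyc (Chart n j)) :
    lauPartial i (Cyc.map (chartEmb n j) f) = chartEmb n j (chartPartial n j i f) * lxInv j :=
  cycDeriv_map_chart (isDoubleDer_lauDD i) (chartEmb_chartU j) (polar_lauDD_lx i)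
    (polar_lauDD_lxInv i j) f

theorem chartBracket_chartEmb (k : ℕ) (τ : ℂ) (j : ZMod n) (f g : Cyc (Chart n j)) :
    Cyc.map (chartEmb n j) (chartBracket n k τ j f g) =
      ellNuLaurent n k τ (Cyc.map (chartEmb n j) f) (Cyc.map (chartEmb n j) g) :=
  (quadBracket_map (chartEmb n j) (chartEmb_chartU j) (lauPartial_chartEmb j) f g).symm

theorem isProjPoisson_chartBracket {k : ℕ} (hk : Nat.Coprime k n) {τ : ℂ} (hτ : 0 < τ.im) :
    IsProjPoisson n (chartBracket n k τ) where
  poisson j := isNCPoisson_homPartial (ellCoeff_neg n hk hτ) (cycCoeff_ellCoeff n hk hτ)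
    (chartU_self j) (isCoordinates_chart j)
  glue j l h := by
    have hcoord := isCoordinates_overlap h
    have hself := ovU_self h
    refine ⟨quadBracket (ellCoeff n k τ) (ovU n j l h) (homPartial j _ hcoord.partialDeriv),
      isNCPoisson_homPartial (ellCoeff_neg n hk hτ) (cycCoeff_ellCoeff n hk hτ) hself hcoord,
      quadBracket_map (resFst n j l h) (resFst_chartU h) ?_,
      quadBracket_map (resSnd n j l h) (resSnd_chartU h) ?_⟩
    · refine homPartial_map_chart hcoord hself (resFst_chartU h) (one_mul 1) fun i z => ?_
      rw [polar_one, LinearMap.zero_apply, if_neg i.2.symm]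
    · exact homPartial_map_chart hcoord hself (resSnd_chartU h) (ovU_mul_ovInv h)
        (polar_ovDD_ovInv h)

end Charts

/-! ### The Schouten square on the free algebra -/

section Schouten

variable (n : ℕ) [NeZero n]

theorem mem_eulerSpan {E : Cyc (Aff n) → Aff n} (hE : E = eulerLeft n ∨ E = eulerRight n)
    (σ : Equiv.Perm (Fin 3)) (a b c : Aff n) (j l : ZMod n) :
    (fun v => tr (a * E (v (σ 0)) * b * freePartial j (v (σ 1)) * c * freePartial l (v (σ 2)))) ∈
      eulerSpan n :=
  Submodule.subset_span ⟨σ, E, a, b, c, j, l, hE, rfl⟩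

/-- The gradient of `f` with respect to the generators of the free algebra. -/
def freeGrad (f : Cyc (Aff n)) (i : ZMod n) : Aff n := freePartial i f

theorem leftEulerForm_mem_eulerSpan (e : ZMod n → ZMod n → ℂ) (σ : Equiv.Perm (Fin 3)) :
    (fun v => leftEulerForm e (FreeAlgebra.ι ℂ) (freeGrad n (v (σ 0))) (freeGrad n (v (σ 2)))
      (eulerLeft n (v (σ 1)))) ∈ eulerSpan n := by
  have hterm (l b a : ZMod n) : (fun v => tr (freePartial (b + a - l) (v (σ 0)) *
      eulerLeft n (v (σ 1)) * FreeAlgebra.ι ℂ b * freePartial l (v (σ 2)) *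
        FreeAlgebra.ι ℂ a)) ∈ eulerSpan n := by
    convert mem_eulerSpan n (.inl rfl) (σ * finRotate 3) 1 (FreeAlgebra.ι ℂ b)
      (FreeAlgebra.ι ℂ a) l (b + a - l) using 2 with v
    simp only [mul_assoc, one_mul]
    rw [tr_mul_comm]
    simp only [mul_assoc]
    rfl
  convert Submodule.sum_mem (eulerSpan n) fun l (_ : l ∈ Finset.univ) =>
    Submodule.sum_mem _ fun b (_ : b ∈ Finset.univ) =>
    Submodule.sum_mem _ fun a (_ : a ∈ Finset.univ) =>
    Submodule.smul_mem _ (e (a - l) (b - l)) (hterm l b a) using 1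
  funext v
  simp only [leftEulerForm, freeGrad, Finset.sum_apply, Pi.smul_apply]

theorem rightEulerForm_mem_eulerSpan (d : ZMod n → ZMod n → ℂ) (σ : Equiv.Perm (Fin 3)) :
    (fun v => rightEulerForm d (FreeAlgebra.ι ℂ) (freeGrad n (v (σ 1))) (freeGrad n (v (σ 2)))
      (eulerRight n (v (σ 0)))) ∈ eulerSpan n := by
  have hterm (j l u : ZMod n) : (fun v => tr (eulerRight n (v (σ 0)) * freePartial j (v (σ 1)) *
      FreeAlgebra.ι ℂ (j - u) * freePartial l (v (σ 2)) * FreeAlgebra.ι ℂ (l + u))) ∈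
        eulerSpan n := by
    convert mem_eulerSpan n (.inr rfl) σ (FreeAlgebra.ι ℂ (l + u)) 1
      (FreeAlgebra.ι ℂ (j - u)) j l using 2 with v
    rw [tr_mul_comm, mul_one]
    simp only [mul_assoc]
  convert Submodule.sum_mem (eulerSpan n) fun j (_ : j ∈ Finset.univ) =>
    Submodule.sum_mem _ fun l (_ : l ∈ Finset.univ) =>
    Submodule.sum_mem _ fun u (_ : u ∈ Finset.univ) =>
    Submodule.smul_mem _ (d u (j - u - l)) (hterm j l u) using 1
  funext v
  simp only [rightEulerForm, freeGrad, Finset.sum_apply, Pi.smul_apply]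

theorem eulerForm_mem_eulerSpan (d e : ZMod n → ZMod n → ℂ) (σ : Equiv.Perm (Fin 3)) :
    (fun v => eulerForm d e (FreeAlgebra.ι ℂ) (freeGrad n (v (σ 0))) (freeGrad n (v (σ 1)))
      (freeGrad n (v (σ 2))) (eulerLeft n (v (σ 1))) (eulerRight n (v (σ 0)))) ∈ eulerSpan n :=
  Submodule.sub_mem _ (leftEulerForm_mem_eulerSpan n e σ) (rightEulerForm_mem_eulerSpan n d σ)

theorem cycEulerForm_mem_eulerSpan (d e : ZMod n → ZMod n → ℂ) (σ : Equiv.Perm (Fin 3)) :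
    (fun v => cycEulerForm d e (FreeAlgebra.ι ℂ) (freeGrad n (v (σ 0))) (freeGrad n (v (σ 1)))
      (freeGrad n (v (σ 2)))) ∈ eulerSpan n :=
  Submodule.add_mem _ (Submodule.add_mem _ (eulerForm_mem_eulerSpan n d e σ)
    (eulerForm_mem_eulerSpan n d e (σ * finRotate 3)))
    (eulerForm_mem_eulerSpan n d e (σ * finRotate 3 * finRotate 3))

variable {k : ℕ} {τ : ℂ}

theorem isHamiltonian_ellCoeff (hk : Nat.Coprime k n) (hτ : 0 < τ.im) :
    IsHamiltonian (ellCoeff n k τ) (FreeAlgebra.ι ℂ) freePartial :=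
  isHamiltonian_freeAlgebra (ellCoeff_neg n hk hτ)

theorem isNCBivector_ellNu (hk : Nat.Coprime k n) (hτ : 0 < τ.im) :
    IsNCBivector (ellNu n k τ) :=
  (isHamiltonian_ellCoeff n hk hτ).isNCBivector

theorem jacobiator_ellNu (hk : Nat.Coprime k n) (hτ : 0 < τ.im) (f g h : Cyc (Aff n)) :
    jacobiator (ellNu n k τ) f g h =
      cycEulerForm (rightEulerCoeff n k τ) (leftEulerCoeff n k τ) (FreeAlgebra.ι ℂ)
        (freeGrad n f) (freeGrad n g) (freeGrad n h) -
      cycEulerForm (rightEulerCoeff n k τ) (leftEulerCoeff n k τ) (FreeAlgebra.ι ℂ)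
        (freeGrad n g) (freeGrad n f) (freeGrad n h) := by
  rw [ellNu, (isHamiltonian_ellCoeff n hk hτ).jacobiator_eq,
    quadJacobiForm_eq_cycEulerForm (cycCoeff_ellCoeff n hk hτ),
    quadJacobiForm_eq_cycEulerForm (cycCoeff_ellCoeff n hk hτ)]
  rfl

theorem schouten_ellNu_mem_eulerSpan (hk : Nat.Coprime k n) (hτ : 0 < τ.im) :
    schouten (ellNu n k τ) (ellNu n k τ) ∈ eulerSpan n := by
  have hmem := cycEulerForm_mem_eulerSpan n (rightEulerCoeff n k τ) (leftEulerCoeff n k τ)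
  convert Submodule.smul_mem _ (4 : ℂ)
    (Submodule.sub_mem _ (hmem 1) (hmem (Equiv.swap 0 1))) using 1
  funext v
  rw [schouten_self_eq_jacobiator (isNCBivector_ellNu n hk hτ).antisymm, jacobiator_ellNu n hk hτ]
  rfl

end Schouten

/-! ### The abelianization -/

section Commutative

variable {n : ℕ} [NeZero n] {R P : Type*} [Ring R] [Algebra ℂ R] [CommRing P] [Algebra ℂ P]
  {φ : Cyc R →ₗ[ℂ] P} {ψ : R →ₐ[ℂ] P} {d e : ZMod n → ZMod n → ℂ}

theorem map_leftEulerForm_swap (hφ : ∀ a, φ (tr a) = ψ a) (he : ∀ u t, e (-u) (-t) = e u t)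
    (x y t : ZMod n → R) (L : R) :
    φ (leftEulerForm e x y t L) = φ (leftEulerForm e x t y L) := by
  have hcomm (F : ZMod n → ZMod n → ZMod n → P) :
      ∑ l, ∑ b, ∑ a, F l b a = ∑ b, ∑ a, ∑ l, F l b a := by
    rw [Finset.sum_comm]
    exact Finset.sum_congr rfl fun b _ => Finset.sum_comm
  simp only [leftEulerForm, map_sum, map_smul, hφ, map_mul]
  refine (hcomm _).trans (Finset.sum_comm.trans (Eq.trans ?_ (hcomm _).symm))
  refine Finset.sum_congr rfl fun a _ => Finset.sum_congr rfl fun b _ => ?_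
  refine Fintype.sum_equiv (Equiv.subLeft (b + a)) _ _ fun l => ?_
  rw [Equiv.subLeft_apply, ← he (a - l), show b - (b + a - l) = -(a - l) by ring,
    show a - (b + a - l) = -(b - l) by ring, show a + b - (b + a - l) = l by ring]
  congr 1
  ring

theorem map_rightEulerForm_swap (hφ : ∀ a, φ (tr a) = ψ a) (hd : ∀ u t, d (-u) (-t) = d u t)
    (x z t : ZMod n → R) (E : R) :
    φ (rightEulerForm d x z t E) = φ (rightEulerForm d x t z E) := by
  simp only [rightEulerForm, map_sum, map_smul, hφ, map_mul]
  rw [Finset.sum_comm]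
  refine Finset.sum_congr rfl fun j _ => Finset.sum_congr rfl fun l _ => ?_
  refine Fintype.sum_equiv (Equiv.neg _) _ _ fun v => ?_
  rw [Equiv.neg_apply, ← hd v, show -(l - v - j) = j - -v - l by ring, sub_neg_eq_add,
    ← sub_eq_add_neg]
  congr 1
  ring

theorem map_cycEulerForm_swap (hφ : ∀ a, φ (tr a) = ψ a) (hd : ∀ u t, d (-u) (-t) = d u t)
    (he : ∀ u t, e (-u) (-t) = e u t) (x y z t : ZMod n → R) :
    φ (cycEulerForm d e x y z t) = φ (cycEulerForm d e x z y t) := by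
  simp only [cycEulerForm, eulerForm, map_add, map_sub]
  rw [map_leftEulerForm_swap hφ he x y t, map_leftEulerForm_swap hφ he x z y,
    map_leftEulerForm_swap hφ he x t z, map_rightEulerForm_swap hφ hd x z t,
    map_rightEulerForm_swap hφ hd x t y, map_rightEulerForm_swap hφ hd x y z]
  ring

end Commutative

section Abelianization

open MvPolynomial

variable (n : ℕ)

/-- The abelianization homomorphism `A → ℂ[x_i]`. -/
def abelHom : Aff n →ₐ[ℂ] MvPolynomial (ZMod n) ℂ := FreeAlgebra.lift ℂ X

theorem abelHom_ι (i : ZMod n) : abelHom n (FreeAlgebra.ι ℂ i) = X i :=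
  FreeAlgebra.lift_ι_apply _ _

theorem abel_tr (a : Aff n) : abel n (tr a) = abelHom n a := Cyc.lift_tr _ _ a

theorem abel_surjective : Function.Surjective (abel n) := by
  intro f
  induction f using MvPolynomial.induction_on with
  | C a => exact ⟨tr (algebraMap ℂ _ a), by rw [abel_tr, AlgHom.commutes, algebraMap_eq]⟩
  | add f g hf hg =>
    obtain ⟨a, rfl⟩ := hf
    obtain ⟨b, rfl⟩ := hg
    exact ⟨a + b, map_add _ _ _⟩
  | mul_X f i hf =>
    obtain ⟨a, rfl⟩ := hf
    obtain ⟨a, rfl⟩ := tr_surjective a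
    exact ⟨tr (a * FreeAlgebra.ι ℂ i), by rw [abel_tr, abel_tr, map_mul, abelHom_ι]⟩

theorem abelHom_polar (i : ZMod n) (f w : Aff n) :
    abelHom n (polar (freeDD i) f w) = abelHom n w * pderiv i (abelHom n f) := by
  induction f using FreeAlgebra.induction generalizing w with
  | grade0 r =>
    rw [polar_algebraMap, LinearMap.zero_apply, map_zero, AlgHom.commutes, algebraMap_eq, pderiv_C,
      mul_zero]
  | grade1 j =>
    rw [polar_freeDD_ι, abelHom_ι, pderiv_X, Pi.single_apply]
    split_ifs <;> simp
  | mul a b ha hb =>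
    rw [polar_mul (isDoubleDer_freeDD i), map_add, ha, hb, map_mul, map_mul, map_mul,
      Derivation.leibniz, smul_eq_mul, smul_eq_mul]
    ring
  | add a b ha hb =>
    rw [map_add, LinearMap.add_apply, map_add, ha, hb, map_add, map_add, mul_add]

theorem abelHom_freePartial (i : ZMod n) (f : Cyc (Aff n)) :
    abelHom n (freePartial i f) = pderiv i (abel n f) := by
  obtain ⟨a, rfl⟩ := tr_surjective f
  rw [freePartial_tr, abelHom_polar, map_one, one_mul, abel_tr]

theorem relabel_X (i : ZMod n) : relabel n (X i) = X (-i) := by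
  simp [relabel]

theorem relabel_pderiv (i : ZMod n) (f : MvPolynomial (ZMod n) ℂ) :
    relabel n (pderiv i f) = pderiv (-i) (relabel n f) :=
  (pderiv_rename neg_injective i f).symm

variable {n} [NeZero n] {c : ZMod n → ZMod n → ℂ}

/-- The abelianization of the value at `(x_j, x_i)` of the quadratic bracket with
coefficients `c`. -/
def quadGen (c : ZMod n → ZMod n → ℂ) (i j : ZMod n) : MvPolynomial (ZMod n) ℂ :=
  ∑ r, c (j - i) r • (X (j - r) * X (i + r))

theorem quadGen_swap (hc : ∀ i r, c (-i) (-r) = -c i r) (i j : ZMod n) :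
    quadGen c j i = -quadGen c i j := by
  rw [quadGen, quadGen, ← Finset.sum_neg_distrib]
  refine Fintype.sum_equiv (Equiv.neg _) _ _ fun r => ?_
  rw [Equiv.neg_apply, ← neg_sub i j, hc, neg_smul, neg_neg, sub_neg_eq_add, ← sub_eq_add_neg,
    mul_comm]

theorem quadGen_self (hc : ∀ i r, c (-i) (-r) = -c i r) (i : ZMod n) : quadGen c i i = 0 :=
  self_eq_neg.1 (quadGen_swap hc i i)

theorem relabel_quadGen (c : ZMod n → ZMod n → ℂ) (i j : ZMod n) :
    relabel n (quadGen c i j) = quadGen c (-j) (-i) := by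
  rw [quadGen, quadGen, map_sum]
  refine Finset.sum_congr rfl fun r _ => ?_
  rw [map_smul, map_mul, relabel_X, relabel_X, mul_comm, show -i - -j = j - i by ring,
    show -(i + r) = -i - r by ring, show -(j - r) = -j + r by ring]

theorem abel_quadBracket (c : ZMod n → ZMod n → ℂ) (f g : Cyc (Aff n)) :
    abel n (quadBracket c (FreeAlgebra.ι ℂ) freePartial f g) =
      ∑ i, ∑ j, quadGen c j i * pderiv i (abel n f) * pderiv j (abel n g) := by
  simp only [quadBracket_apply, quadForm, quadGen, map_sum, map_smul, abel_tr, map_mul,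
    abelHom_freePartial, abelHom_ι, Finset.sum_mul, smul_mul_assoc]
  refine Finset.sum_congr rfl fun i _ => Finset.sum_congr rfl fun j _ =>
    Finset.sum_congr rfl fun r _ => congrArg _ ?_
  ring

variable (n) {k : ℕ} {τ : ℂ}

theorem qGen_eq_quadGen (hk : Nat.Coprime k n) (hτ : 0 < τ.im) (i j : ZMod n) :
    qGen n k τ i j = quadGen (ellCoeff n k τ) i j := by
  rcases eq_or_ne i j with rfl | h
  · rw [qGen, if_pos rfl, quadGen_self (ellCoeff_neg n hk hτ)]
  have hji : j - i ≠ 0 := sub_ne_zero.2 h.symm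
  have herase : Finset.univ.filter (fun r : ZMod n => r ≠ 0 ∧ r ≠ j - i) =
      (Finset.univ.erase 0).erase (j - i) := by
    ext r
    simp [and_comm]
  rw [qGen, if_neg h, quadGen, ← Finset.add_sum_erase _ _ (Finset.mem_univ 0),
    ← Finset.add_sum_erase _ _ (Finset.mem_erase.2 ⟨hji, Finset.mem_univ (j - i)⟩), ← add_assoc,
    herase]
  congr 1
  · rw [ellCoeff, if_pos rfl, if_neg hji, ellCoeff, if_neg hji, if_pos rfl, sub_zero, add_zero,
      sub_sub_cancel, add_sub_cancel, add_smul, mul_comm (X j)]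
  · refine Finset.sum_congr rfl fun r hr => ?_
    rw [Finset.mem_erase, Finset.mem_erase] at hr
    rw [ellCoeff, if_neg hr.2.1, if_neg hr.1]

theorem qBracket_apply (hk : Nat.Coprime k n) (hτ : 0 < τ.im) (f g : MvPolynomial (ZMod n) ℂ) :
    qBracket n k τ f g =
      ∑ i, ∑ j, quadGen (ellCoeff n k τ) i j * pderiv i f * pderiv j g := by
  simp only [← qGen_eq_quadGen n hk hτ]
  rfl

theorem isAbelianization_ellNu (hk : Nat.Coprime k n) (hτ : 0 < τ.im) :
    IsAbelianization n (ellNu n k τ) (-qBracket n k τ) := by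
  intro f g
  rw [ellNu, abel_quadBracket, LinearMap.neg_apply, LinearMap.neg_apply, qBracket_apply n hk hτ]
  simp only [← Finset.sum_neg_distrib, ← neg_mul]
  refine Finset.sum_congr rfl fun i _ => Finset.sum_congr rfl fun j _ => ?_
  rw [quadGen_swap (ellCoeff_neg n hk hτ)]

theorem abel_jacobiator (hk : Nat.Coprime k n) (hτ : 0 < τ.im) (f g h : Cyc (Aff n)) :
    abel n (jacobiator (ellNu n k τ) f g h) = 0 := by
  rw [jacobiator_ellNu n hk hτ, map_sub,
    map_cycEulerForm_swap (abel_tr n) (rightEulerCoeff_neg n hτ) (leftEulerCoeff_neg n hτ),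
    sub_self]

theorem isPoissonBracket_qBracket (hk : Nat.Coprime k n) (hτ : 0 < τ.im) :
    IsPoissonBracket (qBracket n k τ) where
  antisymm f g := by
    rw [qBracket_apply n hk hτ, qBracket_apply n hk hτ, Finset.sum_comm]
    simp only [← Finset.sum_neg_distrib]
    refine Finset.sum_congr rfl fun j _ => Finset.sum_congr rfl fun i _ => ?_
    rw [quadGen_swap (ellCoeff_neg n hk hτ) j i]
    ring
  leibniz f g h := by
    simp only [qBracket_apply n hk hτ, Derivation.leibniz, smul_eq_mul, Finset.mul_sum,
      ← Finset.sum_add_distrib]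
    refine Finset.sum_congr rfl fun i _ => Finset.sum_congr rfl fun j _ => ?_
    ring
  jacobi f g h := by
    obtain ⟨f, rfl⟩ := abel_surjective n f
    obtain ⟨g, rfl⟩ := abel_surjective n g
    obtain ⟨h, rfl⟩ := abel_surjective n h
    simpa only [jacobiator, map_add, isAbelianization_ellNu n hk hτ _ _, LinearMap.neg_apply,
      map_neg, neg_neg] using abel_jacobiator n hk hτ f g h

theorem relabel_qBracket (hk : Nat.Coprime k n) (hτ : 0 < τ.im) (f g : MvPolynomial (ZMod n) ℂ) :
    relabel n ((-qBracket n k τ) f g) = qBracket n k τ (relabel n f) (relabel n g) := by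
  simp only [LinearMap.neg_apply, qBracket_apply n hk hτ, map_neg, map_sum, map_mul,
    relabel_quadGen, relabel_pderiv, ← Finset.sum_neg_distrib]
  refine Fintype.sum_equiv (Equiv.neg _) _ _ fun i =>
    Fintype.sum_equiv (Equiv.neg _) _ _ fun j => ?_
  rw [quadGen_swap (ellCoeff_neg n hk hτ) (-i), neg_mul, neg_mul, neg_neg]
  rfl

end Abelianization

end NCPoisson

end

theorem mainTheorem1 (n k : ℕ) [NeZero n] (hk : 1 ≤ k) (hkn : k < n) (hcop : Nat.Coprime k n)
    (τ : ℂ) (hτ : 0 < τ.im) :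
    -- `ν` is a homogeneous nonabelian bivector field
    IsNCBivector (ellNu n k τ) ∧
    (∀ f g : Aff n,
      ellNuA n k τ (tr (dilate n (inclA n f))) (tr (dilate n (inclA n g))) =
        Cyc.map (dilate n) (Cyc.map (inclA n) (ellNu n k τ (tr f) (tr g)))) ∧
    -- its Schouten square vanishes modulo the Euler-type identities
    schouten (ellNu n k τ) (ellNu n k τ) ∈ eulerSpan n ∧
    -- it induces a nonabelian Poisson structure on the noncommutative projective space
    (∃ b : ∀ j, Cyc (Chart n j) →ₗ[ℂ] Cyc (Chart n j) →ₗ[ℂ] Cyc (Chart n j),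
      IsProjPoisson n b ∧
      ∀ j f g, Cyc.map (chartEmb n j) (b j f g) =
        ellNuLaurent n k τ (Cyc.map (chartEmb n j) f) (Cyc.map (chartEmb n j) g)) ∧
    -- its abelianization is `q_{n,k}(τ)` with the sign of the bracket reversed, which
    -- the relabelling `x_i ↦ x_{-i}` identifies with `q_{n,k}(τ)`
    IsPoissonBracket (qBracket n k τ) ∧
    IsAbelianization n (ellNu n k τ) (-qBracket n k τ) ∧
    (∀ f g, relabel n ((-qBracket n k τ) f g) =
      qBracket n k τ (relabel n f) (relabel n g)) := by
  exact ⟨isNCBivector_ellNu n hcop hτ, ellNu_homogeneous n k τ,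
    schouten_ellNu_mem_eulerSpan n hcop hτ,
    ⟨chartBracket n k τ, isProjPoisson_chartBracket hcop hτ, chartBracket_chartEmb k τ⟩,
    isPoissonBracket_qBracket n hcop hτ, isAbelianization_ellNu n hcop hτ,
    relabel_qBracket n hcop hτ⟩
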